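/- **Problem.** Let $f=\frac1N\sum_{j=1}^N f_j$ with $f_j:\mathbb R^{n_1}\to\mathbb R$ convex and differentiable, $g:\mathbb R^{n_2}\to\mathbb R$, $A\in\mathbb R^{n\times n_1}$, $B\in\mathbb R^{n\times n_2}$, $b\in\mathbb R^n$, and consider $$\min\{f(x)+g(y): x\in\mathbb R^{n_1},\ y\in\mathbb R^{n_2},\ Ax+By=b\}.\qquad (P)$$ A primal-dual solution is a triple $w^*=(x^*,y^*,\lambda^*)$ such that for all $w=(x,y,\lambda)$, $F(w)-F(w^*)+(w-w^*)^{\mathsf T}J(w^*)\ge 0$, where $F(w)=f(x)+g(y)$ and $J(w)=(-A^{\mathsf T}\lambda,\,-B^{\mathsf T}\lambda,\,Ax+By-b)$. Write $\|u\|_G^2=u^{\mathsf T}Gu$. **Algorithm (AS-ADMM).** Fix $\beta>0$, $s>0$, a symmetric positive definite $\mathcal H$, and a deterministic starting point $(x^0,y^0,\lambda^0)$, $\breve x^0=x^0$. At outer iteration $k=0,1,\dots$ choose, from the information available so far, an integer $M_k\ge1$, a real $\eta_k>0$ and a symmetric $\mathcal M_k$ with $D_k:=\mathcal M_k-\beta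 A^{\mathsf T}A\succeq0$; put $h^k=-A^{\mathsf T}[\lambda^k-\beta(Ax^k+By^k-b)]$. Start with $x_1=x^k$, $\breve x_1=\breve x^k$, and for $t=1,\dots,M_k$ draw $\xi_t$ uniformly from $\{1,\dots,N\}$, independently of the past, let $e_t$ be an integrable random vector with mean zero given the past before step $t$ (it may depend on $\xi_t$), and with $\beta_t=\frac2{t+1}$, $\gamma_t=\frac2{t\eta_k}$ put $$\hat x_t=\beta_t\breve x_t+(1-\beta_t)x_t,\qquad d_t=\nabla f_{\xi_t}(\hat x_t)+e_t,\qquad \delta_t=\nabla f(\hat x_t)-d_t,$$ $$\breve x_{t+1}=\arg\min_x\Big\{\langle d_t+h^k,x\rangle+\tfrac{\gamma_t}2\|x-\breve x_t\|_{\mathcal H}^2+\tfrac12\|x-x^k\|_{\mathcal M_k}^2\Big\},\qquad x_{t+1}=\beta_t\breve x_{t+1}+(1-\beta_t)x_t.$$ Then $x^{k+1}=x_{M_k+1}$, $\breve x^{k+1}=\breve x_{M_k+1}$, $y^{k+1}\in\arg\min_y\{g(y)+\frac\beta2\|Ax^{k+1}+By-b-\lambda^k/\beta\|^2\}$ and $\lambda^{k+1}=\lambda^k-s\beta(Ax^{k+1}+By^{k+1}-b)$.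 **Assumptions.** (P) has a primal-dual solution; for some $\nu>0$, $\|\nabla f_j(u)-\nabla f_j(v)\|_{\mathcal H^{-1}}\le\nu\|u-v\|_{\mathcal H}$ for all $u,v,j$; and * (L1)–(L2) for some $\alpha>0$, $f$ and $g$ are strongly convex with modulus $\alpha$ and differentiable with $\nu$-Lipschitz gradients on the whole spaces $\mathbb R^{n_1}$ and $\mathbb R^{n_2}$; * (L3) $0<s<(1+\sqrt5)/2$; there are $c_1,c_2>0$ with $c_1I\preceq D_{k+1}\preceq D_k\preceq c_2I$ for all $k$; and there is $\sigma>0$ such that for all $k\ge0$, $t\ge1$ the vector $\delta_t$ of outer iteration $k$ satisfies $\mathbb E[\|\delta_t\|_{\mathcal H^{-1}}^2]\le\sigma^2$, the expectation being over the event $\{t\le M_k\}$ on which step $t$ is carried out; * (L4) for some $\theta>0$, $M_k=\lceil(1+\theta)^2M_{k-1}(\|\breve x^k\|^2+1)\rceil$ for $k\ge1$ and $\eta_k=(1+\theta)^{-k}/M_k$ for $k\ge0$. **Conclusion.** Let $(x^*,y^*)$ be the solution of (P), let $\Lambda^*$ be the set of all $\lambda$ for which $(x^*,y^*,\lambda)$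 is a primal-dual solution, and let $\bar\lambda^k$ be the projection of $\lambda^k$ onto $\Lambda^*$. Then there exist $c>0$ and $0<\tau<1$ such that for all $k\ge0$ the following expectation is finite and $$\mathbb E\big[\|x^k-x^*\|^2+\|y^k-y^*\|^2+\|\lambda^k-\bar\lambda^k\|^2\big]\le c\,\tau^k .$$ -/

import Mathlib

open MeasureTheory ProbabilityTheory

noncomputable section

namespace ASADMM

/-- Real column vectors of dimension `n`, with the Euclidean norm and inner product. -/
abbrev Vec (n : ℕ) : Type := EuclideanSpace ℝ (Fin n)

/-- The matrix-vector product `A x`. -/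
def mulV {m n : ℕ} (A : Matrix (Fin m) (Fin n) ℝ) (x : Vec n) : Vec m :=
  Matrix.toEuclideanLin A x

/-- `‖x‖_G² = xᵀ G x`. -/
def normSq {n : ℕ} (G : Matrix (Fin n) (Fin n) ℝ) (x : Vec n) : ℝ :=
  inner ℝ x (mulV G x)

/-- `‖x‖_G = √(xᵀ G x)`, for positive semidefinite `G`. -/
def wnorm {n : ℕ} (G : Matrix (Fin n) (Fin n) ℝ) (x : Vec n) : ℝ :=
  Real.sqrt (normSq G x)

/-- `p` is a nearest point of `S` to `z`, i.e. a projection of `z` onto `S`. -/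
def IsProjection {n : ℕ} (S : Set (Vec n)) (z p : Vec n) : Prop :=
  p ∈ S ∧ ∀ q ∈ S, ‖z - p‖ ≤ ‖z - q‖

/-- Data of the problem `min { f x + g y : A x + B y = b }` over all of
`ℝ^{n₁} × ℝ^{n₂}`, where `f` is the average of `N` components. -/
structure Problem (n₁ n₂ n N : ℕ) where
  comp : Fin N → Vec n₁ → ℝ
  g : Vec n₂ → ℝ
  A : Matrix (Fin n) (Fin n₁) ℝ
  B : Matrix (Fin n) (Fin n₂) ℝ
  b : Vec n

namespace Problem

variable {n₁ n₂ n N : ℕ} (Q : Problem n₁ n₂ n N)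

/-- `f = (1/N) ∑ⱼ fⱼ`. -/
def f (x : Vec n₁) : ℝ := (1 / (N : ℝ)) * ∑ j, Q.comp j x

/-- The residual `A x + B y - b` of the linear constraint. -/
def residual (x : Vec n₁) (y : Vec n₂) : Vec n := mulV Q.A x + mulV Q.B y - Q.b

/-- `(x, y)` is a (global) solution of the problem. -/
def IsSolution (x : Vec n₁) (y : Vec n₂) : Prop :=
  Q.residual x y = 0 ∧
    ∀ x' y', Q.residual x' y' = 0 → Q.f x + Q.g y ≤ Q.f x' + Q.g y'

/-- The primal-dual solutions `(x*, y*, λ*)`: those with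
`F(w) - F(w*) + (w - w*)ᵀ J(w*) ≥ 0` for every `w = (x, y, λ)`, where
`F(w) = f x + g y` and `J(w) = (-Aᵀ λ, -Bᵀ λ, A x + B y - b)`. -/
def primalDual : Set (Vec n₁ × Vec n₂ × Vec n) :=
  {w | ∀ (x : Vec n₁) (y : Vec n₂) (l : Vec n),
    0 ≤ (Q.f x + Q.g y) - (Q.f w.1 + Q.g w.2.1)
      + (inner ℝ (x - w.1) (-(mulV Q.A.transpose w.2.2))
        + inner ℝ (y - w.2.1) (-(mulV Q.B.transpose w.2.2))
        + inner ℝ (l - w.2.2) (Q.residual w.1 w.2.1))}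

/-- The multipliers associated with `(x, y)`. -/
def multipliers (x : Vec n₁) (y : Vec n₂) : Set (Vec n) :=
  {l | (x, y, l) ∈ Q.primalDual}

/-- The components `fⱼ` are convex and differentiable, and
`‖∇fⱼ(u) - ∇fⱼ(v)‖_{H⁻¹} ≤ ν ‖u - v‖_H`. -/
structure ComponentRegular (H : Matrix (Fin n₁) (Fin n₁) ℝ) (ν : ℝ) : Prop where
  convex : ∀ j, ConvexOn ℝ Set.univ (Q.comp j)
  differentiable : ∀ j, Differentiable ℝ (Q.comp j)
  lipschitz : ∀ j u v,
    wnorm H⁻¹ (gradient (Q.comp j) u - gradient (Q.comp j) v) ≤ ν * wnorm H (u - v)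

end Problem

/-- `φ` is strongly convex with modulus `α`, and differentiable with a `ν`-Lipschitz gradient. -/
structure StronglyConvexSmooth {n : ℕ} (φ : Vec n → ℝ) (α ν : ℝ) : Prop where
  strongConvex : StrongConvexOn Set.univ α φ
  differentiable : Differentiable ℝ φ
  lipschitz : ∀ u v, ‖gradient φ u - gradient φ v‖ ≤ ν * ‖u - v‖

/-- All the random quantities that occur in a run of the algorithm. The first index is the outer
iteration `k ≥ 0`; a second index is the inner iteration `t ≥ 1` of the `x`-subroutine. Entries
with second index `0`, or beyond the number of inner iterations, are not used. -/
structure Run (n₁ n₂ n N : ℕ) (Ω : Type*) where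
  /-- outer iterates `x^k`, `x̆^k`, `y^k`, `λ^k` -/
  x : ℕ → Ω → Vec n₁
  xb : ℕ → Ω → Vec n₁
  y : ℕ → Ω → Vec n₂
  lam : ℕ → Ω → Vec n
  /-- parameters `M_k`, `η_k` and the matrix `𝓜_k` chosen at outer iteration `k` -/
  M : ℕ → Ω → ℕ
  eta : ℕ → Ω → ℝ
  MM : ℕ → Ω → Matrix (Fin n₁) (Fin n₁) ℝ
  /-- inner iterates `x_t`, `x̆_t` of outer iteration `k` -/
  xin : ℕ → ℕ → Ω → Vec n₁
  xbin : ℕ → ℕ → Ω → Vec n₁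
  /-- sampled index `ξ_t` and random vector `e_t` of outer iteration `k` -/
  xi : ℕ → ℕ → Ω → Fin N
  e : ℕ → ℕ → Ω → Vec n₁

namespace Run

variable {n₁ n₂ n N : ℕ} {Ω : Type*} (R : Run n₁ n₂ n N Ω) (Q : Problem n₁ n₂ n N)

/-- `β_t = 2/(t+1)`. -/
def bt (t : ℕ) : ℝ := 2 / ((t : ℝ) + 1)

/-- `γ_t = 2/(t η_k)`. -/
def gam (k t : ℕ) (ω : Ω) : ℝ := 2 / ((t : ℝ) * R.eta k ω)

/-- `x̂_t = β_t x̆_t + (1 - β_t) x_t`. -/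
def xhat (k t : ℕ) (ω : Ω) : Vec n₁ :=
  bt t • R.xbin k t ω + (1 - bt t) • R.xin k t ω

/-- `d_t = ∇f_{ξ_t}(x̂_t) + e_t`. -/
def d (k t : ℕ) (ω : Ω) : Vec n₁ :=
  gradient (Q.comp (R.xi k t ω)) (R.xhat k t ω) + R.e k t ω

/-- `δ_t = ∇f(x̂_t) - d_t`. -/
def delta (k t : ℕ) (ω : Ω) : Vec n₁ :=
  gradient Q.f (R.xhat k t ω) - R.d Q k t ω

/-- `h^k = -Aᵀ [λ^k - β (A x^k + B y^k - b)]`. -/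
def h (β : ℝ) (k : ℕ) (ω : Ω) : Vec n₁ :=
  -(mulV Q.A.transpose (R.lam k ω - β • Q.residual (R.x k ω) (R.y k ω)))

/-- `D_k = 𝓜_k - β Aᵀ A`. -/
def D (β : ℝ) (k : ℕ) (ω : Ω) : Matrix (Fin n₁) (Fin n₁) ℝ :=
  R.MM k ω - β • (Q.A.transpose * Q.A)

/-- The objective function minimized by `x̆_{t+1}`. -/
def innerObjective (β : ℝ) (H : Matrix (Fin n₁) (Fin n₁) ℝ) (k t : ℕ) (ω : Ω)
    (u : Vec n₁) : ℝ :=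
  inner ℝ (R.d Q k t ω + R.h Q β k ω) u
    + R.gam k t ω / 2 * normSq H (u - R.xbin k t ω)
    + 1 / 2 * normSq (R.MM k ω) (u - R.x k ω)

/-- The objective function minimized by `y^{k+1}`. -/
def yObjective (β : ℝ) (k : ℕ) (ω : Ω) (v : Vec n₂) : ℝ :=
  Q.g v + β / 2 *
    ‖mulV Q.A (R.x (k + 1) ω) + mulV Q.B v - Q.b - (1 / β) • R.lam k ω‖ ^ 2

/-- The update rules of the algorithm with penalty `β`, dual stepsize `s` and matrix `H`. -/
structure FollowsUpdates (β s : ℝ) (H : Matrix (Fin n₁) (Fin n₁) ℝ) : Prop where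
  init : ∃ (x₀ : Vec n₁) (y₀ : Vec n₂) (l₀ : Vec n), ∀ ω,
    R.x 0 ω = x₀ ∧ R.xb 0 ω = x₀ ∧ R.y 0 ω = y₀ ∧ R.lam 0 ω = l₀
  M_pos : ∀ k ω, 0 < R.M k ω
  eta_pos : ∀ k ω, 0 < R.eta k ω
  D_psd : ∀ k ω, (R.D Q β k ω).PosSemidef
  inner_start : ∀ k ω, R.xin k 1 ω = R.x k ω ∧ R.xbin k 1 ω = R.xb k ω
  inner_xb : ∀ k t ω, 1 ≤ t → t ≤ R.M k ω →
    ∀ u, R.innerObjective Q β H k t ω (R.xbin k (t + 1) ω) ≤ R.innerObjective Q β H k t ω u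
  inner_x : ∀ k t ω, 1 ≤ t → t ≤ R.M k ω →
    R.xin k (t + 1) ω = bt t • R.xbin k (t + 1) ω + (1 - bt t) • R.xin k t ω
  inner_return : ∀ k ω, R.x (k + 1) ω = R.xin k (R.M k ω + 1) ω ∧
    R.xb (k + 1) ω = R.xbin k (R.M k ω + 1) ω
  y_step : ∀ k ω v, R.yObjective Q β k ω (R.y (k + 1) ω) ≤ R.yObjective Q β k ω v
  lam_step : ∀ k ω,
    R.lam (k + 1) ω = R.lam k ω - (s * β) • Q.residual (R.x (k + 1) ω) (R.y (k + 1) ω)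

/-- The stochastic structure of a run. `𝓕 (k, t)`, with `(k, t)` ordered lexicographically, is the
information available once `t` inner iterations of outer iteration `k` have been carried out. The
iterates and the parameters chosen by the user depend only on the information available at the time;
the index `ξ_t` is uniformly distributed and independent of the past; the vector `e_t`, which may
depend on `ξ_t`, has mean zero given the past. -/
structure IsStochastic [mΩ : MeasurableSpace Ω] (P : Measure Ω)
    (𝓕 : Filtration (ℕ ×ₗ ℕ) mΩ) : Prop where
  meas_x : ∀ k, Measurable[𝓕 (toLex (k, 0))] (R.x k)
  meas_xb : ∀ k, Measurable[𝓕 (toLex (k, 0))] (R.xb k)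
  meas_y : ∀ k, Measurable[𝓕 (toLex (k, 0))] (R.y k)
  meas_lam : ∀ k, Measurable[𝓕 (toLex (k, 0))] (R.lam k)
  meas_M : ∀ k, Measurable[𝓕 (toLex (k, 0))] (R.M k)
  meas_eta : ∀ k, Measurable[𝓕 (toLex (k, 0))] (R.eta k)
  meas_MM : ∀ k i j, Measurable[𝓕 (toLex (k, 0))] (fun ω => R.MM k ω i j)
  meas_xin : ∀ k t, Measurable[𝓕 (toLex (k, t))] (R.xin k (t + 1))
  meas_xbin : ∀ k t, Measurable[𝓕 (toLex (k, t))] (R.xbin k (t + 1))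
  meas_xi : ∀ k t, Measurable[𝓕 (toLex (k, t + 1))] (R.xi k (t + 1))
  meas_e : ∀ k t, Measurable[𝓕 (toLex (k, t + 1))] (R.e k (t + 1))
  xi_uniform : ∀ k t j, P (R.xi k (t + 1) ⁻¹' {j}) = 1 / (N : ENNReal)
  xi_indep : ∀ k t,
    Indep (MeasurableSpace.comap (R.xi k (t + 1)) ⊤) (𝓕 (toLex (k, t))) P
  e_integrable : ∀ k t, Integrable (R.e k (t + 1)) P
  e_mean : ∀ k t, P[R.e k (t + 1) | 𝓕 (toLex (k, t))] =ᵐ[P] 0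

/-- `c₁ I ⪯ D_{k+1} ⪯ D_k ⪯ c₂ I` for all `k`. -/
def ProximalBounds (β c₁ c₂ : ℝ) : Prop :=
  ∀ k ω, (R.D Q β (k + 1) ω - c₁ • (1 : Matrix (Fin n₁) (Fin n₁) ℝ)).PosSemidef ∧
    (R.D Q β k ω - R.D Q β (k + 1) ω).PosSemidef ∧
    (c₂ • (1 : Matrix (Fin n₁) (Fin n₁) ℝ) - R.D Q β k ω).PosSemidef

/-- `E[‖δ_t‖²_{H⁻¹}] ≤ σ²` for all `k` and `t`. Since `δ_t` occurs only when inner iteration `t` is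
carried out, the expectation is over the event `t ≤ M_k`. -/
def NoiseBound [MeasurableSpace Ω] (P : Measure Ω) (H : Matrix (Fin n₁) (Fin n₁) ℝ)
    (σ : ℝ) : Prop :=
  ∀ k t, 1 ≤ t →
    ∫⁻ ω in {ω | t ≤ R.M k ω}, ENNReal.ofReal (normSq H⁻¹ (R.delta Q k t ω)) ∂P
      ≤ ENNReal.ofReal (σ ^ 2)

/-- `M_k = ⌈(1+θ)² M_{k-1} (‖x̆^k‖² + 1)⌉` for `k ≥ 1` and `η_k = (1+θ)^{-k} / M_k` for `k ≥ 0`. -/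
def GeometricGrowth (θ : ℝ) : Prop :=
  (∀ k ω, R.M (k + 1) ω =
    ⌈(1 + θ) ^ 2 * (R.M k ω : ℝ) * (‖R.xb (k + 1) ω‖ ^ 2 + 1)⌉₊) ∧
  ∀ k ω, R.eta k ω = ((1 + θ) ^ k)⁻¹ / (R.M k ω : ℝ)

end Run

end ASADMM

end

/-! Let `z` be the exact solution of the `x`-subproblem of outer iteration `k`, with `f` itself in
place of the sampled gradients. If `x^{k+1}` equalled `z`, the outer loop would be a proximal ADMM.
Measure the errors from `(x*, y*, λ̄^k)`. Since `s` lies below the golden ratio, `(1 - s)^2 < 2 -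
s`, and the function `lyapunov` decreases by a multiple of the squared primal errors and constraint
residuals (`lyapunov_descent`). The gradients are Lipschitz, so the optimality conditions bound the
images of the multiplier error under `Aᵀ` and `Bᵀ` by these same quantities. That error is
orthogonal to the common kernel of `Aᵀ` and `Bᵀ`, because `λ̄^k` is a projection. Hence the decrease
controls the whole function, which contracts by a factor `q < 1` up to a multiple of `‖x^{k+1} -
z‖²` (`lyapunov_contraction`).

It remains to bound `‖x^{k+1} - z‖²`. The proximal steps of the inner loop are linear in the noise,
so a linear process driven by the `δ_t` alone is subtracted from the iterates
(`exists_noise_process`). What is left is an accelerated gradient method whose gradients are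
evaluated at slightly shifted points. After rescaling, the averaged noise process solves a recursion
driven by the martingale `∑ (s + 1) δ_s` (`noise_average_energy`). Orthogonality of its increments
gives a noise contribution of order `M⁻² ∑ E‖δ_s‖²`, with a constant independent of the stepsize
(`integral_noiseSum_le`). The growth rule for `M_k` makes the contribution of the initial distance
at most of order `(1 + θ)^{-k}` times one plus the Lyapunov function (`Standing.inner_error`).

The number `M_k` is random, and the noise is bounded only on the event `t ≤ M_k`. The expectation is
therefore split over the events `M_k = m`. As `M_k ≥ (1 + θ)^{2k}`, the weight `m⁻²` is at most `(1
+ θ)^{-k} (s + 1)^{-3/2}` for `s < m`; summing over `m` first leaves a convergent series in `s`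
(`Run.exists_lintegral_noiseTerm_le`).

With `V` the Lyapunov function and `ρ = 1/(1 + θ)`, this yields `E V_{k+1} ≤ (q + K ρ^k) E V_k + K
ρ^k` for `k ≥ 1`, hence geometric decay (`exists_geometric_bound`). The initial `y^0` satisfies no
optimality condition, so `k = 0` is covered by a growth bound only. The error of `y^{k+1}` is
recovered from `V_k` and `V_{k+1}` through strong convexity of `g`. -/

namespace ASADMM

open scoped RealInnerProductSpace

/-! ### Gradients, strong convexity and existence of critical points. -/

section Convex

variable {E : Type*} [NormedAddCommGroup E] [InnerProductSpace ℝ E] [CompleteSpace E]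

theorem hasGradientAt_add {φ ψ : E → ℝ} {a b p : E} (hφ : HasGradientAt φ a p)
    (hψ : HasGradientAt ψ b p) : HasGradientAt (fun u => φ u + ψ u) (a + b) p := by
  rw [hasGradientAt_iff_hasFDerivAt] at *
  rw [map_add]
  exact hφ.add hψ

theorem hasGradientAt_const_mul {φ : E → ℝ} {a p : E} (c : ℝ) (hφ : HasGradientAt φ a p) :
    HasGradientAt (fun u => c * φ u) (c • a) p := by
  rw [hasGradientAt_iff_hasFDerivAt] at *
  have h := hφ.const_mul c
  exact h.congr_fderiv (by ext v; simp)

theorem hasGradientAt_inner_left (c p : E) : HasGradientAt (fun u => ⟪c, u⟫) c p := by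
  rw [hasGradientAt_iff_hasFDerivAt]
  exact ((InnerProductSpace.toDual ℝ E) c).hasFDerivAt

theorem hasGradientAt_eq_zero_of_forall_le {φ : E → ℝ} {a p : E} (h : HasGradientAt φ a p)
    (hmin : ∀ u, φ p ≤ φ u) : a = 0 := by
  rw [hasGradientAt_iff_hasFDerivAt] at h
  have h0 := IsLocalMin.hasFDerivAt_eq_zero (Filter.Eventually.of_forall hmin) h
  simpa using h0

theorem hasGradientAt_quadratic [FiniteDimensional ℝ E] {S : E →ₗ[ℝ] E}
    (hS : ∀ x y, ⟪S x, y⟫ = ⟪x, S y⟫) (c p : E) :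
    HasGradientAt (fun u => 1 / 2 * ⟪u - c, S (u - c)⟫) (S (p - c)) p := by
  rw [hasGradientAt_iff_hasFDerivAt]
  have h1 : HasFDerivAt (fun u : E => u - c) (ContinuousLinearMap.id ℝ E) p :=
    (hasFDerivAt_id p).sub_const c
  have h2 : HasFDerivAt (fun u : E => S (u - c)) (LinearMap.toContinuousLinearMap S) p := by
    exact ((LinearMap.toContinuousLinearMap S).hasFDerivAt (x := p - c)).comp p h1
  have h3 := (h1.inner ℝ h2).const_mul (1 / 2)
  refine h3.congr_fderiv ?_
  ext v
  simp only [InnerProductSpace.toDual_apply_apply, smul_apply, ContinuousLinearMap.comp_apply,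
    ContinuousLinearMap.prod_apply, fderivInnerCLM_apply, LinearMap.coe_toContinuousLinearMap',
    ContinuousLinearMap.id_apply, smul_eq_mul]
  rw [← hS, real_inner_comm v]
  ring

/-- Strong convexity on the segment from `x` to `y` is divided by `t`, and `t` tends to zero from
the right. -/
theorem strongConvexOn_inner_gradient_le {f : E → ℝ} {α : ℝ} (hf : StrongConvexOn Set.univ α f)
    {x a : E} (hd : HasGradientAt f a x) (y : E) :
    f x + ⟪a, y - x⟫ + α / 2 * ‖y - x‖ ^ 2 ≤ f y := by
  have hder : HasDerivAt (fun t : ℝ => f (x + t • (y - x))) ⟪a, y - x⟫ 0 := by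
    rw [hasGradientAt_iff_hasFDerivAt] at hd
    have h1 : HasDerivAt (fun t : ℝ => x + t • (y - x)) (y - x) 0 := by
      simpa using ((hasDerivAt_id (0 : ℝ)).smul_const (y - x)).const_add x
    have h2 : HasFDerivAt f ((InnerProductSpace.toDual ℝ E) a) (x + (0 : ℝ) • (y - x)) := by
      simpa using hd
    exact h2.comp_hasDerivAt (0 : ℝ) h1
  have hslope := (hasDerivAt_iff_tendsto_slope_zero.1 hder).mono_left
    (nhdsWithin_mono (0 : ℝ) (s := Set.Ioi 0) (fun t (ht : 0 < t) => ht.ne'))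
  have hub : Filter.Tendsto (fun t : ℝ => f y - f x - (1 - t) * (α / 2 * ‖y - x‖ ^ 2))
      (nhdsWithin 0 (Set.Ioi 0)) (nhds (f y - f x - (1 - 0) * (α / 2 * ‖y - x‖ ^ 2))) := by
    have : Continuous (fun t : ℝ => f y - f x - (1 - t) * (α / 2 * ‖y - x‖ ^ 2)) := by fun_prop
    exact this.continuousAt.tendsto.mono_left nhdsWithin_le_nhds
  have hle := le_of_tendsto_of_tendsto hslope hub (by
    filter_upwards [Ioo_mem_nhdsGT (show (0 : ℝ) < 1 by norm_num)] with t ht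
    have h := hf.2 (Set.mem_univ x) (Set.mem_univ y) (sub_nonneg.2 ht.2.le) ht.1.le (by ring)
    have e1 : (1 - t) • x + t • y = x + t • (y - x) := by module
    rw [e1, norm_sub_rev] at h
    simp only [smul_eq_mul, zero_add, zero_smul, add_zero] at h ⊢
    rw [inv_mul_le_iff₀ ht.1]
    nlinarith [h])
  linarith

theorem strongConvexOn_le_inner_sub {f : E → ℝ} {α : ℝ} (hf : StrongConvexOn Set.univ α f)
    {x y a b : E} (hx : HasGradientAt f a x) (hy : HasGradientAt f b y) :
    α * ‖y - x‖ ^ 2 ≤ ⟪b - a, y - x⟫ := by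
  have h1 := strongConvexOn_inner_gradient_le hf hx y
  have h2 := strongConvexOn_inner_gradient_le hf hy x
  rw [norm_sub_rev x y, ← neg_sub y x, inner_neg_right] at h2
  rw [inner_sub_left]
  linarith

/-- A differentiable strongly convex function plus a linear form attains a critical point. -/
theorem exists_gradient_add_eq_zero [FiniteDimensional ℝ E] {f : E → ℝ} {grad : E → E}
    (hgrad : ∀ x, HasGradientAt f (grad x) x)
    (hconv : ∀ x y, f x + ⟪grad x, y - x⟫ ≤ f y)
    {S : E →ₗ[ℝ] E} (hS : ∀ x y, ⟪S x, y⟫ = ⟪x, S y⟫) {c : ℝ} (hc : 0 < c)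
    (hSc : ∀ x, c * ‖x‖ ^ 2 ≤ ⟪x, S x⟫) (h p : E) :
    ∃ x, grad x + h + S (x - p) = 0 := by
  have hG : ∀ x, HasGradientAt (fun u => f u + ⟪h, u⟫ + 1 / 2 * ⟪u - p, S (u - p)⟫)
      (grad x + h + S (x - p)) x := fun x =>
    hasGradientAt_add (hasGradientAt_add (hgrad x) (hasGradientAt_inner_left h x))
      (hasGradientAt_quadratic hS p x)
  have hcont : Continuous (fun u => f u + ⟪h, u⟫ + 1 / 2 * ⟪u - p, S (u - p)⟫) :=
    continuous_iff_continuousAt.2 fun x => (hG x).continuousAt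
  obtain ⟨x, hx⟩ : ∃ x, ∀ u, f x + ⟪h, x⟫ + 1 / 2 * ⟪x - p, S (x - p)⟫
      ≤ f u + ⟪h, u⟫ + 1 / 2 * ⟪u - p, S (u - p)⟫ := by
    refine hcont.exists_forall_le (f := fun u => f u + ⟪h, u⟫ + 1 / 2 * ⟪u - p, S (u - p)⟫) ?_
    -- Coercivity: the tangent plane at `p` bounds `f` from below, and Young's inequality spends
    -- half of the quadratic term on the linear one.
    have hlow : ∀ u, (f p + ⟪h, p⟫ - ‖grad p + h‖ ^ 2 / c) + c / 4 * ‖u - p‖ ^ 2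
        ≤ f u + ⟪h, u⟫ + 1 / 2 * ⟪u - p, S (u - p)⟫ := by
      intro u
      have h1 := hconv p u
      have h2 := hSc (u - p)
      have h3 : -(‖grad p + h‖ * ‖u - p‖) ≤ ⟪grad p + h, u - p⟫ :=
        (abs_le.1 (abs_real_inner_le_norm _ _)).1
      have h4 : ⟪grad p + h, u - p⟫ = ⟪grad p, u - p⟫ + ⟪h, u⟫ - ⟪h, p⟫ := by
        rw [inner_add_left, inner_sub_right h]; ring
      have h5 : ‖grad p + h‖ * ‖u - p‖ ≤ ‖grad p + h‖ ^ 2 / c + c / 4 * ‖u - p‖ ^ 2 := by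
        have : 0 ≤ (‖grad p + h‖ - c / 2 * ‖u - p‖) ^ 2 / c := by positivity
        have e : (‖grad p + h‖ - c / 2 * ‖u - p‖) ^ 2 / c = ‖grad p + h‖ ^ 2 / c
          + c / 4 * ‖u - p‖ ^ 2 - ‖grad p + h‖ * ‖u - p‖ := by field_simp; ring
        linarith
      linarith
    refine Filter.tendsto_atTop_mono hlow ?_
    refine Filter.tendsto_atTop_add_const_left _ _ ?_
    refine Filter.Tendsto.const_mul_atTop (by positivity) ?_
    refine (Filter.tendsto_pow_atTop two_ne_zero).comp ?_
    have := tendsto_norm_cocompact_atTop (E := E)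
    refine Filter.tendsto_atTop_mono (fun u => norm_sub_norm_le u p) ?_
    exact Filter.tendsto_atTop_add_const_right _ _ this
  exact ⟨x, hasGradientAt_eq_zero_of_forall_le (hG x) hx⟩

end Convex

end ASADMM

/-! ### Inner iterations: separation of the noise and the accelerated rate. -/

namespace ASADMM

open scoped RealInnerProductSpace

noncomputable section

variable {E : Type*} [NormedAddCommGroup E] [InnerProductSpace ℝ E]

/-- Three-point identity: it turns the optimality condition of a proximal step into differences that
telescope. -/
theorem two_mul_inner_map_sub {H : E →ₗ[ℝ] E} (hH : ∀ x y, ⟪H x, y⟫ = ⟪x, H y⟫) (a b c : E) :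
    2 * ⟪H (a - b), a - c⟫ = ⟪a - c, H (a - c)⟫ - ⟪b - c, H (b - c)⟫ + ⟪a - b, H (a - b)⟫ := by
  have key : ∀ u v : E, 2 * ⟪H v, u⟫ = ⟪u, H u⟫ - ⟪u - v, H (u - v)⟫ + ⟪v, H v⟫ := by
    intro u v
    have e : ⟪u, H v⟫ = ⟪v, H u⟫ := by rw [← hH, real_inner_comm]
    rw [map_sub, inner_sub_left, inner_sub_right, inner_sub_right, hH, e]
    ring
  have h := key (a - c) (a - b)
  rwa [show a - c - (a - b) = b - c by abel] at h

theorem mul_le_sq_div_add {a b c : ℝ} (hc : 0 < c) : a * b ≤ a ^ 2 / (2 * c) + c / 2 * b ^ 2 := by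
  have h : 0 ≤ (a - c * b) ^ 2 / (2 * c) := by positivity
  have e : (a - c * b) ^ 2 / (2 * c) = a ^ 2 / (2 * c) + c / 2 * b ^ 2 - a * b := by
    field_simp; ring
  linarith

/-- The quadratic form of `γ • H + S` is coercive, so the map is injective, and in finite dimension
surjective. -/
theorem exists_smul_map_add_eq [FiniteDimensional ℝ E] {H S : E →ₗ[ℝ] E} {γ c : ℝ}
    (hγ : 0 ≤ γ) (hc : 0 < c) (hH : ∀ x, 0 ≤ ⟪x, H x⟫) (hS : ∀ x, c * ‖x‖ ^ 2 ≤ ⟪x, S x⟫)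
    (y : E) : ∃ x, γ • H x + S x = y := by
  have hinj : Function.Injective (γ • H + S) := by
    rw [← LinearMap.ker_eq_bot, LinearMap.ker_eq_bot']
    intro x hx
    have h1 : ⟪x, γ • H x + S x⟫ = 0 := by
      have : γ • H x + S x = 0 := by simpa using hx
      rw [this, inner_zero_right]
    rw [inner_add_right, inner_smul_right] at h1
    have h2 := mul_nonneg hγ (hH x)
    have h3 := hS x
    have h4 : ‖x‖ ^ 2 ≤ 0 := by
      by_contra h
      have := mul_pos hc (not_le.1 h)
      linarith
    have : ‖x‖ = 0 := by nlinarith [norm_nonneg x]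
    simpa using this
  obtain ⟨x, hx⟩ := LinearMap.injective_iff_surjective.1 hinj y
  exact ⟨x, by simpa using hx⟩

/-- The equation is tested with `b'`. Half of the coercivity of `S` absorbs `v`; the other half is
converted into `H`-energy and gives the damping `c / h₂`. -/
theorem resolvent_energy {H S : E →ₗ[ℝ] E} (hH : ∀ x y, ⟪H x, y⟫ = ⟪x, H y⟫) {γ c h₂ : ℝ}
    (hγ : 0 ≤ γ) (hc : 0 < c) (hh : 0 < h₂) (hHp : ∀ x, 0 ≤ ⟪x, H x⟫)
    (hHu : ∀ x, ⟪x, H x⟫ ≤ h₂ * ‖x‖ ^ 2) (hS : ∀ x, c * ‖x‖ ^ 2 ≤ ⟪x, S x⟫)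
    {b b' v : E} (h : γ • H (b' - b) + S b' = v) :
    (γ + c / h₂) * ⟪b', H b'⟫ ≤ γ * ⟪b, H b⟫ + ‖v‖ ^ 2 / c := by
  have h1 : γ * ⟪H (b' - b), b'⟫ + ⟪b', S b'⟫ = ⟪v, b'⟫ := by
    rw [← h, inner_add_left, real_inner_smul_left, real_inner_comm b' (S b')]
  have h2 := two_mul_inner_map_sub hH b' b 0
  simp only [sub_zero] at h2
  have h3 := real_inner_le_norm v b'
  have h4 := mul_le_sq_div_add (a := ‖v‖) (b := ‖b'‖) hc
  have h5 := hS b'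
  have h6 : c / h₂ * ⟪b', H b'⟫ ≤ c * ‖b'‖ ^ 2 := by
    calc c / h₂ * ⟪b', H b'⟫ ≤ c / h₂ * (h₂ * ‖b'‖ ^ 2) :=
          mul_le_mul_of_nonneg_left (hHu b') (by positivity)
      _ = c * ‖b'‖ ^ 2 := by field_simp
  have h7 := mul_nonneg hγ (hHp (b' - b))
  have h8 : ‖v‖ ^ 2 / (2 * c) = ‖v‖ ^ 2 / c / 2 := by field_simp
  have h9 : γ * (2 * ⟪H (b' - b), b'⟫) =
    γ * (⟪b', H b'⟫ - ⟪b, H b⟫ + ⟪b' - b, H (b' - b)⟫) := by rw [h2]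
  nlinarith

/-- A scalar bound for the energy of the noise accumulated by the inner iterations. -/
def noiseMajorant {V : Type*} [NormedAddCommGroup V] (η c μ : ℝ) (v : ℕ → V) : ℕ → ℝ
  | 0 => 0
  | j + 1 => (2 / ((j + 1) * η) * noiseMajorant η c μ v j + ‖v (j + 1)‖ ^ 2 / c)
      / (2 / ((j + 1) * η) + μ)

theorem noiseMajorant_nonneg {V : Type*} [NormedAddCommGroup V] {η c μ : ℝ} (hη : 0 < η)
    (hc : 0 < c) (hμ : 0 < μ) (v : ℕ → V) :
    ∀ j, 0 ≤ noiseMajorant η c μ v j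
  | 0 => le_rfl
  | j + 1 => by
    have := noiseMajorant_nonneg hη hc hμ v j
    rw [noiseMajorant]
    positivity

/-- The partial sums `∑_{s < j} (s + 1) δ_s`. -/
def weightedSum (δ : ℕ → E) (j : ℕ) : E := ∑ s ∈ Finset.range j, ((s : ℝ) + 1) • δ s

/-- The noise parts of the two inner sequences. -/
theorem exists_noise_process [FiniteDimensional ℝ E] {H S : E →ₗ[ℝ] E} {η c : ℝ}
    (hη : 0 < η) (hc : 0 < c) (hH : ∀ x, 0 ≤ ⟪x, H x⟫) (hS : ∀ x, c * ‖x‖ ^ 2 ≤ ⟪x, S x⟫)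
    (δ : ℕ → E) : ∃ n a : ℕ → E, n 0 = 0 ∧ a 0 = 0 ∧
      (∀ j : ℕ, (2 / (((j : ℝ) + 1) * η)) • H (n (j + 1) - n j) + S (n (j + 1)) = δ j) ∧
      ∀ j : ℕ, a (j + 1) = (2 / ((j : ℝ) + 2)) • n (j + 1) + (1 - 2 / ((j : ℝ) + 2)) • a j := by
  have hex : ∀ (j : ℕ) (u : E), ∃ x, (2 / (((j : ℝ) + 1) * η)) • H x + S x
      = δ j + (2 / (((j : ℝ) + 1) * η)) • H u := fun j u =>
    exists_smul_map_add_eq (by positivity) hc hH hS _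
  choose F hF using hex
  let n : ℕ → E := fun j => Nat.rec 0 (fun i u => F i u) j
  let a : ℕ → E := fun j => Nat.rec 0
    (fun i u => (2 / ((i : ℝ) + 2)) • n (i + 1) + (1 - 2 / ((i : ℝ) + 2)) • u) j
  refine ⟨n, a, rfl, rfl, fun j => ?_, fun j => rfl⟩
  have := hF j (n j)
  rw [map_sub, smul_sub, sub_add_eq_add_sub, sub_eq_iff_eq_add]
  exact this

section NoiseProcess

variable {H S : E →ₗ[ℝ] E} {η : ℝ} {δ n a : ℕ → E}

/-- The average `a j` weights `n i` by `i`, with total weight `j (j + 1) / 2`; the rescaled average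
is thus a plain sum with increments `(j + 1) • n (j + 1)`. -/
theorem noise_average_succ
    (ha : ∀ j : ℕ, a (j + 1) = (2 / ((j : ℝ) + 2)) • n (j + 1) + (1 - 2 / ((j : ℝ) + 2)) • a j)
    (j : ℕ) :
    ((j : ℝ) + 1) • n (j + 1) = ((((j + 1 : ℕ) : ℝ) * (((j + 1 : ℕ) : ℝ) + 1)) / 2) • a (j + 1)
      - (((j : ℝ) * ((j : ℝ) + 1)) / 2) • a j := by
  rw [ha j]
  have : (j : ℝ) + 2 ≠ 0 := by positivity
  push_cast
  match_scalars
  · field_simp; ring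
  · field_simp; ring

/-- Multiplied by `j + 1`, the recursion has the constant coefficient `2 / η` in front of `H`, so
the `H`-terms telescope and the right-hand sides add up to `weightedSum`. -/
theorem noise_average_eq (hη : η ≠ 0) (hn0 : n 0 = 0) (ha0 : a 0 = 0)
    (hn : ∀ j : ℕ, (2 / (((j : ℝ) + 1) * η)) • H (n (j + 1) - n j) + S (n (j + 1)) = δ j)
    (ha : ∀ j : ℕ, a (j + 1) = (2 / ((j : ℝ) + 2)) • n (j + 1) + (1 - 2 / ((j : ℝ) + 2)) • a j) :
    ∀ j : ℕ, (2 / η) • H (n j) + S (((((j : ℝ) * ((j : ℝ) + 1)) / 2)) • a j) = weightedSum δ j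
  | 0 => by simp [weightedSum, hn0]
  | j + 1 => by
    have ih := noise_average_eq hη hn0 ha0 hn ha j
    have h1 := noise_average_succ ha j
    rw [eq_sub_iff_add_eq] at h1
    rw [← h1, weightedSum, Finset.sum_range_succ, ← weightedSum, ← ih, ← hn j]
    have : (j : ℝ) + 1 ≠ 0 := by positivity
    simp only [map_add, map_smul, map_sub, smul_add, smul_sub, smul_smul]
    match_scalars <;> field_simp
    ring

/-- The rescaled averages `b` solve the same kind of implicit recursion as `n`, now driven by the
accumulated noise. The energy estimate for this recursion is far smaller than a termwise bound on
`n`, because the accumulated noise is a martingale. -/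
theorem noise_average_energy (hH : ∀ x y, ⟪H x, y⟫ = ⟪x, H y⟫) {c h₂ : ℝ}
    (hη : 0 < η) (hc : 0 < c) (hh : 0 < h₂) (hHp : ∀ x, 0 ≤ ⟪x, H x⟫)
    (hHu : ∀ x, ⟪x, H x⟫ ≤ h₂ * ‖x‖ ^ 2) (hS : ∀ x, c * ‖x‖ ^ 2 ≤ ⟪x, S x⟫)
    (hn0 : n 0 = 0) (ha0 : a 0 = 0)
    (hn : ∀ j : ℕ, (2 / (((j : ℝ) + 1) * η)) • H (n (j + 1) - n j) + S (n (j + 1)) = δ j)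
    (ha : ∀ j : ℕ, a (j + 1) = (2 / ((j : ℝ) + 2)) • n (j + 1) + (1 - 2 / ((j : ℝ) + 2)) • a j)
    {b : ℕ → E} (hb : ∀ j : ℕ, b j = (((j : ℝ) * ((j : ℝ) + 1)) / 2) • a j) :
    ∀ j, ⟪b j, H (b j)⟫ ≤ noiseMajorant η c (c / h₂) (weightedSum δ) j
  | 0 => by simp [hb, noiseMajorant]
  | j + 1 => by
    have ih := noise_average_energy hH hη hc hh hHp hHu hS hn0 ha0 hn ha hb j
    have h1 := noise_average_eq hη.ne' hn0 ha0 hn ha (j + 1)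
    have h2 := noise_average_succ ha j
    rw [← hb, ← hb] at h2
    rw [← hb] at h1
    have h3 : (2 / (((j : ℝ) + 1) * η)) • H (b (j + 1) - b j) + S (b (j + 1))
        = weightedSum δ (j + 1) := by
      rw [← h2, ← h1, map_smul, smul_smul]
      congr 2
      have : (j : ℝ) + 1 ≠ 0 := by positivity
      field_simp
    have h4 := resolvent_energy hH (by positivity) hc hh hHp hHu hS h3
    rw [noiseMajorant, le_div_iff₀ (by positivity), mul_comm]
    refine h4.trans ?_
    gcongr

/-- The noise part of `x̂_j`. -/
theorem noise_hat_sq_le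
    (ha : ∀ j : ℕ, a (j + 1) = (2 / ((j : ℝ) + 2)) • n (j + 1) + (1 - 2 / ((j : ℝ) + 2)) • a j)
    {b : ℕ → E} (hb : ∀ j : ℕ, b j = (((j : ℝ) * ((j : ℝ) + 1)) / 2) • a j) (i : ℕ) :
    ((i : ℝ) + 2) * ‖(2 / ((i : ℝ) + 3)) • n (i + 1) + (1 - 2 / ((i : ℝ) + 3)) • a (i + 1)‖ ^ 2
      ≤ 64 * (‖b (i + 1)‖ ^ 2 + ‖b i‖ ^ 2) / ((i : ℝ) + 1) ^ 3 := by
  have h2 := noise_average_succ ha i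
  rw [← hb, ← hb] at h2
  have hi : (0 : ℝ) ≤ i := Nat.cast_nonneg i
  have hi1 : (i : ℝ) + 1 ≠ 0 := by positivity
  have hi2 : (i : ℝ) + 2 ≠ 0 := by positivity
  have hi3 : (i : ℝ) + 3 ≠ 0 := by positivity
  have hn : n (i + 1) = ((i : ℝ) + 1)⁻¹ • (b (i + 1) - b i) := by
    rw [← h2, smul_smul, inv_mul_cancel₀ hi1, one_smul]
  have haa : a (i + 1) = (2 / (((i : ℝ) + 1) * ((i : ℝ) + 2))) • b (i + 1) := by
    rw [hb, smul_smul]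
    push_cast
    rw [show (2 / (((i : ℝ) + 1) * ((i : ℝ) + 2))) * (((i : ℝ) + 1) * ((i : ℝ) + 1 + 1) / 2) = 1 by
      field_simp; ring, one_smul]
  -- In terms of `b`, both coefficients are of order `i⁻²`; squaring and multiplying by `i + 2`
  -- gives the cube in the denominator.
  have hx : ‖(2 / ((i : ℝ) + 3)) • n (i + 1) + (1 - 2 / ((i : ℝ) + 3)) • a (i + 1)‖
      ≤ 2 / (((i : ℝ) + 1) * ((i : ℝ) + 2)) * (2 * ‖b (i + 1)‖ + ‖b i‖) := by
    have e : (2 / ((i : ℝ) + 3)) • n (i + 1) + (1 - 2 / ((i : ℝ) + 3)) • a (i + 1)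
        = (2 / (((i : ℝ) + 3) * ((i : ℝ) + 1))) • (b (i + 1) - b i)
          + (2 / (((i : ℝ) + 3) * ((i : ℝ) + 2))) • b (i + 1) := by
      rw [hn, haa]
      match_scalars <;> field_simp
      ring
    rw [e]
    refine (norm_add_le _ _).trans ?_
    rw [norm_smul, norm_smul, Real.norm_of_nonneg (by positivity),
      Real.norm_of_nonneg (by positivity)]
    have k1 : 2 / (((i : ℝ) + 3) * ((i : ℝ) + 1)) ≤ 2 / (((i : ℝ) + 1) * ((i : ℝ) + 2)) := by
      rw [mul_comm ((i : ℝ) + 1)]; gcongr; norm_num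
    have k2 : 2 / (((i : ℝ) + 3) * ((i : ℝ) + 2)) ≤ 2 / (((i : ℝ) + 1) * ((i : ℝ) + 2)) := by
      gcongr; norm_num
    have k3 := norm_sub_le (b (i + 1)) (b i)
    calc _ ≤ 2 / (((i : ℝ) + 1) * ((i : ℝ) + 2)) * (‖b (i + 1)‖ + ‖b i‖)
          + 2 / (((i : ℝ) + 1) * ((i : ℝ) + 2)) * ‖b (i + 1)‖ := by gcongr
      _ = _ := by ring
  have hsq : (2 * ‖b (i + 1)‖ + ‖b i‖) ^ 2 ≤ 8 * (‖b (i + 1)‖ ^ 2 + ‖b i‖ ^ 2) := by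
    nlinarith [sq_nonneg (2 * ‖b (i + 1)‖ - ‖b i‖), sq_nonneg (‖b i‖)]
  calc _ ≤ ((i : ℝ) + 2) * (2 / (((i : ℝ) + 1) * ((i : ℝ) + 2))
          * (2 * ‖b (i + 1)‖ + ‖b i‖)) ^ 2 := by gcongr
    _ = 4 / (((i : ℝ) + 1) ^ 2 * ((i : ℝ) + 2)) * (2 * ‖b (i + 1)‖ + ‖b i‖) ^ 2 := by
      field_simp; ring
    _ ≤ 4 / (((i : ℝ) + 1) ^ 2 * ((i : ℝ) + 1)) * (8 * (‖b (i + 1)‖ ^ 2 + ‖b i‖ ^ 2)) := by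
      gcongr; norm_num
    _ = 32 * (‖b (i + 1)‖ ^ 2 + ‖b i‖ ^ 2) / ((i : ℝ) + 1) ^ 3 := by field_simp; ring
    _ ≤ _ := by gcongr; norm_num

end NoiseProcess

/-- One step of the accelerated proximal gradient method with a perturbed gradient. -/
theorem accelerated_step {f : E → ℝ} {grad : E → E}
    (hconv : ∀ x y, f x + ⟪grad x, y - x⟫ ≤ f y) {ν : ℝ}
    (hlip : ∀ x y, ‖grad x - grad y‖ ≤ ν * ‖x - y‖) {H S : E →ₗ[ℝ] E}
    (hH : ∀ x y, ⟪H x, y⟫ = ⟪x, H y⟫) (hS : ∀ x y, ⟪S x, y⟫ = ⟪x, S y⟫) {c h₁ β γ : ℝ}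
    (hc : 0 < c) (hHl : ∀ x, h₁ * ‖x‖ ^ 2 ≤ ⟪x, H x⟫) (hSl : ∀ x, c * ‖x‖ ^ 2 ≤ ⟪x, S x⟫)
    (hβ0 : 0 ≤ β) (hβ1 : β ≤ 1) (hγ0 : 0 ≤ γ) (hγ : 2 * ν * β ≤ γ * h₁) {Φ : E → ℝ} {h p : E}
    (hΦ : ∀ u, Φ u = f u + ⟪h, u⟫ + 1 / 2 * ⟪u - p, S (u - p)⟫) {z z' w G : E}
    (hz : G + h + γ • H (z' - z) + S (z' - p) = 0) (x : E) :
    Φ (β • z' + (1 - β) • w) - Φ x ≤ (1 - β) * (Φ w - Φ x)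
      + β * γ / 2 * (⟪z - x, H (z - x)⟫ - ⟪z' - x, H (z' - x)⟫)
      + β * ‖G - grad (β • z + (1 - β) • w)‖ ^ 2 / (2 * c) := by
  set wh := β • z + (1 - β) • w with hwh
  set w' := β • z' + (1 - β) • w with hw'
  set ε := G - grad wh with hε
  have hd : w' - wh = β • (z' - z) := by rw [hw', hwh]; module
  -- Only convexity and the Lipschitz bound are used, which gives `ν` instead of `ν / 2`; this is
  -- the origin of the factor 2 in `hγ`.
  have hdesc : f w' ≤ f wh + ⟪grad wh, w' - wh⟫ + ν * (β ^ 2 * ‖z' - z‖ ^ 2) := by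
    have h1 := hconv w' wh
    have h2 : ⟪grad w', wh - w'⟫ = -⟪grad wh, w' - wh⟫ - ⟪grad w' - grad wh, w' - wh⟫ := by
      rw [← neg_sub w' wh, inner_neg_right, inner_sub_left]; ring
    have h3 := real_inner_le_norm (grad w' - grad wh) (w' - wh)
    have h4 := mul_le_mul_of_nonneg_right (hlip w' wh) (norm_nonneg (w' - wh))
    have h5 : ν * ‖w' - wh‖ * ‖w' - wh‖ = ν * (β ^ 2 * ‖z' - z‖ ^ 2) := by
      rw [hd, norm_smul, Real.norm_of_nonneg hβ0]; ring
    linarith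
  have hsplit : ⟪grad wh, w' - wh⟫ = β * ⟪grad wh, x - wh⟫ + β * ⟪grad wh, z' - x⟫
      + (1 - β) * ⟪grad wh, w - wh⟫ := by
    have e : w' - wh = β • (x - wh) + β • (z' - x) + (1 - β) • (w - wh) := by rw [hw']; module
    rw [e]
    simp only [inner_add_right, real_inner_smul_right]
  have hx := mul_le_mul_of_nonneg_left (hconv wh x) hβ0
  have hw := mul_le_mul_of_nonneg_left (hconv wh w) (sub_nonneg.2 hβ1)
  have hh : ⟪h, w'⟫ = β * ⟪h, z'⟫ + (1 - β) * ⟪h, w⟫ := by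
    rw [hw', inner_add_right, real_inner_smul_right, real_inner_smul_right]
  have hψ : ⟪w' - p, S (w' - p)⟫ ≤ β * ⟪z' - p, S (z' - p)⟫ + (1 - β) * ⟪w - p, S (w - p)⟫ := by
    have e : w' - p = β • (z' - p) + (1 - β) • (w - p) := by rw [hw']; module
    have hpos : 0 ≤ ⟪z' - w, S (z' - w)⟫ := le_trans (by positivity) (hSl (z' - w))
    have e2 : z' - w = (z' - p) - (w - p) := by abel
    rw [e2] at hpos
    rw [e]
    generalize z' - p = u at hpos ⊢
    generalize w - p = v at hpos ⊢
    have e3 : ⟪v, S u⟫ = ⟪u, S v⟫ := by rw [← hS, real_inner_comm]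
    simp only [map_add, map_sub, map_smul, inner_add_left, inner_add_right, inner_sub_left,
      inner_sub_right, real_inner_smul_left, real_inner_smul_right] at hpos ⊢
    rw [e3] at hpos ⊢
    have := mul_nonneg (mul_nonneg hβ0 (sub_nonneg.2 hβ1)) hpos
    nlinarith
  have hopt : ⟪grad wh, z' - x⟫ = -⟪ε, z' - x⟫ - ⟪h, z'⟫ + ⟪h, x⟫ - γ * ⟪H (z' - z), z' - x⟫
      - ⟪S (z' - p), z' - x⟫ := by
    have e : grad wh = -ε - h - γ • H (z' - z) - S (z' - p) := by
      rw [hε, ← sub_eq_zero, ← hz]; abel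
    rw [e]
    simp only [inner_sub_left, inner_neg_left, real_inner_smul_left]
    rw [inner_sub_right h]
    ring
  have hpH := two_mul_inner_map_sub hH z' z x
  have hpS := two_mul_inner_map_sub hS z' p x
  have hpx : ⟪p - x, S (p - x)⟫ = ⟪x - p, S (x - p)⟫ := by
    rw [← neg_sub x p, map_neg, inner_neg_neg]
  -- The quadratic term produced here is paid for by the coercivity of `S`, so the gradient error
  -- enters without any stepsize factor.
  have hεb : -⟪ε, z' - x⟫ ≤ ‖ε‖ ^ 2 / (2 * c) + c / 2 * ‖z' - x‖ ^ 2 :=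
    (neg_le_abs _).trans ((abs_real_inner_le_norm _ _).trans (mul_le_sq_div_add hc))
  have hSz := hSl (z' - x)
  have hHz := hHl (z' - z)
  have hgain : ν * (β ^ 2 * ‖z' - z‖ ^ 2) ≤ β * γ / 2 * ⟪z' - z, H (z' - z)⟫ := by
    calc ν * (β ^ 2 * ‖z' - z‖ ^ 2) = (2 * ν * β) * (β / 2 * ‖z' - z‖ ^ 2) := by ring
      _ ≤ (γ * h₁) * (β / 2 * ‖z' - z‖ ^ 2) :=
          mul_le_mul_of_nonneg_right hγ (by positivity)
      _ = β * γ / 2 * (h₁ * ‖z' - z‖ ^ 2) := by ring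
      _ ≤ _ := mul_le_mul_of_nonneg_left hHz (by positivity)
  have hopt2 : ⟪grad wh, z' - x⟫ ≤ ‖ε‖ ^ 2 / (2 * c) - ⟪h, z'⟫ + ⟪h, x⟫
      - γ / 2 * (⟪z' - x, H (z' - x)⟫ - ⟪z - x, H (z - x)⟫ + ⟪z' - z, H (z' - z)⟫)
      - 1 / 2 * (⟪z' - p, S (z' - p)⟫ - ⟪x - p, S (x - p)⟫) := by
    rw [hpx] at hpS
    have : γ * (2 * ⟪H (z' - z), z' - x⟫) = γ * (⟪z' - x, H (z' - x)⟫ - ⟪z - x, H (z - x)⟫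
      + ⟪z' - z, H (z' - z)⟫) := by rw [hpH]
    linarith
  have hopt3 := mul_le_mul_of_nonneg_left hopt2 hβ0
  rw [hΦ, hΦ, hΦ, hh]
  have e4 : β * ‖ε‖ ^ 2 / (2 * c) = β * (‖ε‖ ^ 2 / (2 * c)) := by ring
  rw [e4]
  linarith


/-- The sum that bounds the effect of the noise on the inner iterations. -/
def noiseSum (η c μ : ℝ) (δ : ℕ → E) (M : ℕ) : ℝ :=
  (∑ i ∈ Finset.range M, (noiseMajorant η c μ (weightedSum δ) (i + 1)
    + noiseMajorant η c μ (weightedSum δ) i) / ((i : ℝ) + 1) ^ 3) / (M : ℝ) ^ 2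
    + noiseMajorant η c μ (weightedSum δ) M / (M : ℝ) ^ 4

-- The index `j` is `t - 1`, so `β_t = 2 / (j + 2)` and `γ_t = 2 / ((j + 1) η)`. The first term is
-- the `1 / (η M²)` rate of acceleration, applied to the iterates with the noise process removed;
-- `noiseSum` collects the gradient shifts and the final noise average.
set_option maxHeartbeats 1000000 in
theorem sq_norm_sub_le_of_small_step [FiniteDimensional ℝ E] {f : E → ℝ} {grad : E → E}
    (hconv : ∀ x y, f x + ⟪grad x, y - x⟫ ≤ f y) {ν : ℝ}
    (hlip : ∀ x y, ‖grad x - grad y‖ ≤ ν * ‖x - y‖) {H S : E →ₗ[ℝ] E}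
    (hH : ∀ x y, ⟪H x, y⟫ = ⟪x, H y⟫) (hS : ∀ x y, ⟪S x, y⟫ = ⟪x, S y⟫) {c h₁ h₂ η : ℝ}
    (hc : 0 < c) (hh₁ : 0 < h₁) (hh₂ : 0 < h₂) (hHl : ∀ x, h₁ * ‖x‖ ^ 2 ≤ ⟪x, H x⟫)
    (hHu : ∀ x, ⟪x, H x⟫ ≤ h₂ * ‖x‖ ^ 2) (hSl : ∀ x, c * ‖x‖ ^ 2 ≤ ⟪x, S x⟫)
    (hη : 0 < η) (hηs : 2 * ν * η ≤ h₁) {h p x : E} {P X δ : ℕ → E} {M : ℕ} (hM : 0 < M)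
    (hstep : ∀ j < M, grad ((2 / ((j : ℝ) + 2)) • P j + (1 - 2 / ((j : ℝ) + 2)) • X j) - δ j
      + h + (2 / (((j : ℝ) + 1) * η)) • H (P (j + 1) - P j) + S (P (j + 1) - p) = 0)
    (hX : ∀ j < M, X (j + 1) = (2 / ((j : ℝ) + 2)) • P (j + 1) + (1 - 2 / ((j : ℝ) + 2)) • X j)
    (hx : grad x + h + S (x - p) = 0) :
    ‖X M - x‖ ^ 2 ≤ 8 * h₂ / (c * η * (M : ℝ) ^ 2) * ‖P 0 - x‖ ^ 2
      + (256 * ν ^ 2 / (c ^ 2 * h₁) + 8 / h₁) * noiseSum η c (c / h₂) δ M := by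
  have hHp : ∀ x, 0 ≤ ⟪x, H x⟫ := fun x => le_trans (by positivity) (hHl x)
  obtain ⟨n, a, hn0, ha0, hn, ha⟩ := exists_noise_process hη hc hHp hSl δ
  set mj := noiseMajorant η c (c / h₂) (weightedSum δ) with hmj
  have hmj0 : ∀ j, 0 ≤ mj j := noiseMajorant_nonneg hη hc (by positivity) _
  set b : ℕ → E := fun j => (((j : ℝ) * ((j : ℝ) + 1)) / 2) • a j with hb
  have hbm : ∀ j, h₁ * ‖b j‖ ^ 2 ≤ mj j := fun j => (hHl _).trans
    (noise_average_energy hH hη hc hh₂ hHp hHu hSl hn0 ha0 hn ha (b := b) (fun _ => rfl) j)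
  set Φ : E → ℝ := fun u => f u + ⟪h, u⟫ + 1 / 2 * ⟪u - p, S (u - p)⟫ with hΦ
  set z : ℕ → E := fun j => P j - n j with hz
  set w : ℕ → E := fun j => X j - a j with hw
  -- After subtracting the noise process, the only remaining perturbation is that the gradient is
  -- still taken at the noisy point.
  set ε : ℕ → E := fun j => grad ((2 / ((j : ℝ) + 2)) • P j + (1 - 2 / ((j : ℝ) + 2)) • X j)
    - grad ((2 / ((j : ℝ) + 2)) • z j + (1 - 2 / ((j : ℝ) + 2)) • w j) with hε
  have hstep' : ∀ j < M, Φ (w (j + 1)) - Φ x ≤ (1 - 2 / ((j : ℝ) + 2)) * (Φ (w j) - Φ x)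
      + 2 / ((j : ℝ) + 2) * (2 / (((j : ℝ) + 1) * η)) / 2
        * (⟪z j - x, H (z j - x)⟫ - ⟪z (j + 1) - x, H (z (j + 1) - x)⟫)
      + 2 / ((j : ℝ) + 2) * ‖ε j‖ ^ 2 / (2 * c) := by
    intro j hj
    have e : w (j + 1) = (2 / ((j : ℝ) + 2)) • z (j + 1) + (1 - 2 / ((j : ℝ) + 2)) • w j := by
      simp only [hw, hz, hX j hj, ha j]; module
    rw [e]
    refine accelerated_step hconv hlip hH hS hc hHl hSl (by positivity) ?_ (by positivity) ?_
      (fun _ => rfl) ?_ x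
    · rw [div_le_one (by positivity)]; linarith [(Nat.cast_nonneg j : (0 : ℝ) ≤ j)]
    · calc 2 * ν * (2 / ((j : ℝ) + 2)) = 2 / (((j : ℝ) + 2) * η) * (2 * ν * η) := by field_simp
        _ ≤ 2 / (((j : ℝ) + 2) * η) * h₁ := by gcongr
        _ ≤ 2 / (((j : ℝ) + 1) * η) * h₁ := by gcongr; norm_num
    · have h1 := hstep j hj
      rw [← hn j] at h1
      rw [← h1]
      simp only [hz, map_sub, smul_sub]
      abel
  have htel : ∀ j ≤ M, (j : ℝ) * ((j : ℝ) + 1) / 2 * (Φ (w j) - Φ x)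
      + 1 / η * ⟪z j - x, H (z j - x)⟫ ≤ 1 / η * ⟪P 0 - x, H (P 0 - x)⟫
        + ∑ i ∈ Finset.range j, ((i : ℝ) + 1) * ‖ε i‖ ^ 2 / (2 * c) := by
    intro j
    induction j with
    | zero => intro _; simp [hz, hn0]
    | succ j ih =>
      intro hj
      have h1 := ih (by omega)
      -- This weight turns the factor `1 - 2 / (j + 2)` into the preceding weight `j (j + 1) / 2`
      -- and the coefficient of the distances into the constant `1 / η`.
      have h2 := mul_le_mul_of_nonneg_left (hstep' j (by omega))
        (show (0 : ℝ) ≤ ((j : ℝ) + 1) * ((j : ℝ) + 2) / 2 by positivity)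
      have e : ((j : ℝ) + 1) * ((j : ℝ) + 2) / 2 * ((1 - 2 / ((j : ℝ) + 2)) * (Φ (w j) - Φ x)
          + 2 / ((j : ℝ) + 2) * (2 / (((j : ℝ) + 1) * η)) / 2
            * (⟪z j - x, H (z j - x)⟫ - ⟪z (j + 1) - x, H (z (j + 1) - x)⟫)
          + 2 / ((j : ℝ) + 2) * ‖ε j‖ ^ 2 / (2 * c))
          = (j : ℝ) * ((j : ℝ) + 1) / 2 * (Φ (w j) - Φ x)
            + 1 / η * (⟪z j - x, H (z j - x)⟫ - ⟪z (j + 1) - x, H (z (j + 1) - x)⟫)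
            + ((j : ℝ) + 1) * ‖ε j‖ ^ 2 / (2 * c) := by
        have : (j : ℝ) + 1 ≠ 0 := by positivity
        have : (j : ℝ) + 2 ≠ 0 := by positivity
        field_simp
        ring
      rw [e] at h2
      rw [Finset.sum_range_succ]
      push_cast
      rw [show ((j : ℝ) + 1 + 1) = (j : ℝ) + 2 by ring]
      linarith
  have hεb : ∀ i : ℕ, ((i : ℝ) + 2) * ‖ε (i + 1)‖ ^ 2
      ≤ 64 * ν ^ 2 / h₁ * ((mj (i + 1) + mj i) / ((i : ℝ) + 1) ^ 3) := by
    intro i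
    have h1 : ‖ε (i + 1)‖ ≤ ν * ‖(2 / ((i : ℝ) + 3)) • n (i + 1)
        + (1 - 2 / ((i : ℝ) + 3)) • a (i + 1)‖ := by
      refine (hlip _ _).trans (le_of_eq ?_)
      congr 2
      simp only [hz, hw]
      push_cast
      rw [show ((i : ℝ) + 1 + 2) = (i : ℝ) + 3 by ring]
      module
    have h2 := noise_hat_sq_le ha (b := b) (fun _ => rfl) i
    have h3 := hbm (i + 1)
    have h4 := hbm i
    have h5 : ‖b (i + 1)‖ ^ 2 + ‖b i‖ ^ 2 ≤ (mj (i + 1) + mj i) / h₁ := by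
      rw [le_div_iff₀ hh₁]; linarith
    calc ((i : ℝ) + 2) * ‖ε (i + 1)‖ ^ 2
        ≤ ((i : ℝ) + 2) * (ν * ‖(2 / ((i : ℝ) + 3)) • n (i + 1)
        + (1 - 2 / ((i : ℝ) + 3)) • a (i + 1)‖) ^ 2 := by gcongr
      _ = ν ^ 2 * (((i : ℝ) + 2) * ‖(2 / ((i : ℝ) + 3)) • n (i + 1)
        + (1 - 2 / ((i : ℝ) + 3)) • a (i + 1)‖ ^ 2) := by ring
      _ ≤ ν ^ 2 * (64 * (‖b (i + 1)‖ ^ 2 + ‖b i‖ ^ 2) / ((i : ℝ) + 1) ^ 3) := by gcongr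
      _ ≤ ν ^ 2 * (64 * ((mj (i + 1) + mj i) / h₁) / ((i : ℝ) + 1) ^ 3) := by gcongr
      _ = _ := by field_simp
  -- At `j = 0` the noise process vanishes, so the error sum starts one index later and matches the
  -- shifted bound `hεb`.
  have hε0 : ε 0 = 0 := by simp [hε, hz, hw, hn0]
  have hεsum : ∑ i ∈ Finset.range M, ((i : ℝ) + 1) * ‖ε i‖ ^ 2 / (2 * c)
      ≤ 32 * ν ^ 2 / (c * h₁) * ∑ i ∈ Finset.range M, (mj (i + 1) + mj i) / ((i : ℝ) + 1) ^ 3 := by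
    obtain ⟨m, rfl⟩ : ∃ m, M = m + 1 := ⟨M - 1, by omega⟩
    rw [Finset.sum_range_succ', hε0, Finset.sum_range_succ]
    have h1 : ∑ i ∈ Finset.range m, (((i + 1 : ℕ) : ℝ) + 1) * ‖ε (i + 1)‖ ^ 2 / (2 * c)
        ≤ 32 * ν ^ 2 / (c * h₁) * ∑ i ∈ Finset.range m, (mj (i + 1) + mj i) / ((i : ℝ) + 1) ^ 3 := by
      rw [Finset.mul_sum]
      refine Finset.sum_le_sum fun i _ => ?_
      have := hεb i
      push_cast
      rw [show ((i : ℝ) + 1 + 1) = (i : ℝ) + 2 by ring, div_le_iff₀ (by positivity)]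
      refine this.trans (le_of_eq ?_)
      field_simp
      ring
    have h2 : 0 ≤ (mj (m + 1) + mj m) / ((m : ℝ) + 1) ^ 3 := by
      have := hmj0 (m + 1); have := hmj0 m; positivity
    have h3 : 0 ≤ 32 * ν ^ 2 / (c * h₁) * ((mj (m + 1) + mj m) / ((m : ℝ) + 1) ^ 3) := by
      positivity
    rw [mul_add]
    simpa using h1.trans (le_add_of_nonneg_right h3)
  -- Here `x` is critical for `Φ`: the function `f` lies above its tangent at `x`, and the quadratic
  -- part supplies the modulus `c`.
  have hsc : c / 2 * ‖w M - x‖ ^ 2 ≤ Φ (w M) - Φ x := by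
    have h1 := hconv x (w M)
    have h2 := two_mul_inner_map_sub hS x p (w M)
    have h3 := hSl (w M - x)
    have e1 : ⟪x - w M, S (x - w M)⟫ = ⟪w M - x, S (w M - x)⟫ := by
      rw [← neg_sub, map_neg, inner_neg_neg]
    have e2 : ⟪p - w M, S (p - w M)⟫ = ⟪w M - p, S (w M - p)⟫ := by
      rw [← neg_sub, map_neg, inner_neg_neg]
    have e3 : ⟪grad x + h + S (x - p), w M - x⟫ = 0 := by rw [hx, inner_zero_left]
    have e4 : ⟪S (x - p), x - w M⟫ = -⟪S (x - p), w M - x⟫ := by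
      rw [← neg_sub (w M) x, inner_neg_right]
    rw [inner_add_left, inner_add_left, inner_sub_right h] at e3
    rw [e1, e2, e4] at h2
    simp only [hΦ]
    linarith
  have hM0 : (0 : ℝ) < M := by exact_mod_cast hM
  have hmain : (M : ℝ) ^ 2 * (c / 4 * ‖w M - x‖ ^ 2) ≤ h₂ / η * ‖P 0 - x‖ ^ 2
      + 32 * ν ^ 2 / (c * h₁) * ∑ i ∈ Finset.range M, (mj (i + 1) + mj i) / ((i : ℝ) + 1) ^ 3 := by
    have h1 := htel M le_rfl
    have h2 : 0 ≤ 1 / η * ⟪z M - x, H (z M - x)⟫ := mul_nonneg (by positivity) (hHp _)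
    have h3 : 1 / η * ⟪P 0 - x, H (P 0 - x)⟫ ≤ h₂ / η * ‖P 0 - x‖ ^ 2 := by
      calc _ ≤ 1 / η * (h₂ * ‖P 0 - x‖ ^ 2) :=
            mul_le_mul_of_nonneg_left (hHu _) (by positivity)
        _ = _ := by ring
    have h4 : (M : ℝ) ^ 2 / 2 * (c / 2 * ‖w M - x‖ ^ 2)
        ≤ (M : ℝ) * ((M : ℝ) + 1) / 2 * (Φ (w M) - Φ x) := by
      refine mul_le_mul ?_ hsc (by positivity) (by positivity)
      nlinarith
    nlinarith
  have haM : ‖a M‖ ^ 2 ≤ 4 / h₁ * (mj M / (M : ℝ) ^ 4) := by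
    have h1 := hbm M
    have h2 : ‖b M‖ ^ 2 = ((M : ℝ) * ((M : ℝ) + 1) / 2) ^ 2 * ‖a M‖ ^ 2 := by
      simp only [hb]
      rw [norm_smul, Real.norm_of_nonneg (by positivity)]
      ring
    have h3 : (M : ℝ) ^ 4 / 4 ≤ ((M : ℝ) * ((M : ℝ) + 1) / 2) ^ 2 := by
      rw [div_pow, mul_pow]
      have : (M : ℝ) ^ 2 ≤ ((M : ℝ) + 1) ^ 2 := by gcongr; linarith
      calc (M : ℝ) ^ 4 / 4 = (M : ℝ) ^ 2 * (M : ℝ) ^ 2 / 2 ^ 2 := by ring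
        _ ≤ _ := by gcongr
    have h4 : h₁ * ((M : ℝ) ^ 4 / 4 * ‖a M‖ ^ 2) ≤ mj M := by
      refine le_trans ?_ h1
      rw [h2]
      gcongr
    have e : 4 / h₁ * (mj M / (M : ℝ) ^ 4) = mj M / (h₁ * (M : ℝ) ^ 4 / 4) := by field_simp
    rw [e, le_div_iff₀ (by positivity)]
    linarith
  have htri : ‖X M - x‖ ^ 2 ≤ 2 * ‖w M - x‖ ^ 2 + 2 * ‖a M‖ ^ 2 := by
    have e : X M - x = (w M - x) + a M := by simp only [hw]; abel
    have h1 : ‖X M - x‖ ≤ ‖w M - x‖ + ‖a M‖ := e ▸ norm_add_le _ _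
    calc ‖X M - x‖ ^ 2 ≤ (‖w M - x‖ + ‖a M‖) ^ 2 := by gcongr
      _ ≤ _ := by nlinarith [sq_nonneg (‖w M - x‖ - ‖a M‖)]
  have hwM : ‖w M - x‖ ^ 2 ≤ 4 * h₂ / (c * η * (M : ℝ) ^ 2) * ‖P 0 - x‖ ^ 2
      + 128 * ν ^ 2 / (c ^ 2 * h₁) * ((∑ i ∈ Finset.range M, (mj (i + 1) + mj i)
        / ((i : ℝ) + 1) ^ 3) / (M : ℝ) ^ 2) := by
    generalize (∑ i ∈ Finset.range M, (mj (i + 1) + mj i) / ((i : ℝ) + 1) ^ 3) = sm at hmain ⊢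
    have e : 4 * h₂ / (c * η * (M : ℝ) ^ 2) * ‖P 0 - x‖ ^ 2
        + 128 * ν ^ 2 / (c ^ 2 * h₁) * (sm / (M : ℝ) ^ 2)
        = (h₂ / η * ‖P 0 - x‖ ^ 2 + 32 * ν ^ 2 / (c * h₁) * sm) / ((M : ℝ) ^ 2 * (c / 4)) := by
      field_simp
      ring
    rw [e, le_div_iff₀ (by positivity)]
    linarith
  rw [noiseSum, ← hmj]
  have hs0 : 0 ≤ (∑ i ∈ Finset.range M, (mj (i + 1) + mj i) / ((i : ℝ) + 1) ^ 3) / (M : ℝ) ^ 2 := by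
    refine div_nonneg (Finset.sum_nonneg fun i _ => ?_) (by positivity)
    have := hmj0 (i + 1); have := hmj0 i; positivity
  have hs1 : 0 ≤ mj M / (M : ℝ) ^ 4 := by have := hmj0 M; positivity
  generalize (∑ i ∈ Finset.range M, (mj (i + 1) + mj i) / ((i : ℝ) + 1) ^ 3) / (M : ℝ) ^ 2 = s0
    at hs0 hwM ⊢
  generalize mj M / (M : ℝ) ^ 4 = s1 at hs1 haM ⊢
  have k1 : 0 ≤ ν ^ 2 / (c ^ 2 * h₁) := by positivity
  have k2 : 0 ≤ 1 / h₁ := by positivity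
  have e1 : 256 * ν ^ 2 / (c ^ 2 * h₁) = 256 * (ν ^ 2 / (c ^ 2 * h₁)) := by ring
  have e2 : 128 * ν ^ 2 / (c ^ 2 * h₁) = 128 * (ν ^ 2 / (c ^ 2 * h₁)) := by ring
  have e3 : 8 / h₁ = 8 * (1 / h₁) := by ring
  have e4 : 4 / h₁ = 4 * (1 / h₁) := by ring
  have e5 : 8 * h₂ / (c * η * (M : ℝ) ^ 2) * ‖P 0 - x‖ ^ 2
    = 2 * (4 * h₂ / (c * η * (M : ℝ) ^ 2) * ‖P 0 - x‖ ^ 2) := by ring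
  rw [e1, e3, e5]
  rw [e2] at hwM
  rw [e4] at haM
  nlinarith [mul_nonneg k1 hs1, mul_nonneg k2 hs0]

end

end ASADMM

namespace ASADMM

open scoped RealInnerProductSpace

/-! ### A crude inner estimate for boundedly many steps. -/

section FewSteps

variable {E : Type*} [NormedAddCommGroup E] [InnerProductSpace ℝ E]

theorem norm_add_sq_le_two_mul {V : Type*} [NormedAddCommGroup V] (x y : V) :
    ‖x + y‖ ^ 2 ≤ 2 * ‖x‖ ^ 2 + 2 * ‖y‖ ^ 2 := by
  have h := norm_add_le x y
  calc ‖x + y‖ ^ 2 ≤ (‖x‖ + ‖y‖) ^ 2 := by gcongr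
    _ ≤ _ := by nlinarith [sq_nonneg (‖x‖ - ‖y‖)]

theorem norm_sub_sq_le_two_mul {V : Type*} [NormedAddCommGroup V] (x y : V) :
    ‖x - y‖ ^ 2 ≤ 2 * ‖x‖ ^ 2 + 2 * ‖y‖ ^ 2 := by
  simpa [sub_eq_add_neg] using norm_add_sq_le_two_mul x (-y)

theorem norm_convex_sq_le {β : ℝ} (h0 : 0 ≤ β) (h1 : β ≤ 1) (x y : E) :
    ‖β • x + (1 - β) • y‖ ^ 2 ≤ ‖x‖ ^ 2 + ‖y‖ ^ 2 := by
  have h : ‖β • x + (1 - β) • y‖ ≤ β * ‖x‖ + (1 - β) * ‖y‖ := by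
    refine (norm_add_le _ _).trans (le_of_eq ?_)
    rw [norm_smul, norm_smul, Real.norm_of_nonneg h0, Real.norm_of_nonneg (sub_nonneg.2 h1)]
  have hm : β * ‖x‖ + (1 - β) * ‖y‖ ≤ max ‖x‖ ‖y‖ := by
    have := mul_le_mul_of_nonneg_left (le_max_left ‖x‖ ‖y‖) h0
    have := mul_le_mul_of_nonneg_left (le_max_right ‖x‖ ‖y‖) (sub_nonneg.2 h1)
    linarith
  calc ‖β • x + (1 - β) • y‖ ^ 2 ≤ (max ‖x‖ ‖y‖) ^ 2 := by
        gcongr; exact h.trans hm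
    _ ≤ _ := by
      rcases max_choice ‖x‖ ‖y‖ with h | h <;> rw [h] <;> nlinarith [sq_nonneg ‖x‖, sq_nonneg ‖y‖]

/-- When the stepsize is too large for acceleration, each step still multiplies the squared errors
by at most a fixed factor. This is used only for a bounded number of steps. -/
theorem sq_norm_sub_le_of_few_steps {grad : E → E} {ν : ℝ}
    (hlip : ∀ x y, ‖grad x - grad y‖ ≤ ν * ‖x - y‖) {H S : E →ₗ[ℝ] E}
    (hH : ∀ x y, ⟪H x, y⟫ = ⟪x, H y⟫) {c h₁ h₂ η : ℝ}
    (hc : 0 < c) (hh₁ : 0 < h₁) (hh₂ : 0 < h₂) (hHl : ∀ x, h₁ * ‖x‖ ^ 2 ≤ ⟪x, H x⟫)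
    (hHu : ∀ x, ⟪x, H x⟫ ≤ h₂ * ‖x‖ ^ 2) (hSl : ∀ x, c * ‖x‖ ^ 2 ≤ ⟪x, S x⟫)
    (hη : 0 < η) {h p x : E} {P X δ : ℕ → E} {M : ℕ} (hηM : (M : ℝ) * η ≤ 1)
    (hstep : ∀ j < M, grad ((2 / ((j : ℝ) + 2)) • P j + (1 - 2 / ((j : ℝ) + 2)) • X j) - δ j
      + h + (2 / (((j : ℝ) + 1) * η)) • H (P (j + 1) - P j) + S (P (j + 1) - p) = 0)
    (hX : ∀ j < M, X (j + 1) = (2 / ((j : ℝ) + 2)) • P (j + 1) + (1 - 2 / ((j : ℝ) + 2)) • X j)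
    (hx : grad x + h + S (x - p) = 0) :
    ‖X M - x‖ ^ 2 ≤ (1 + 2 * (h₂ + 2 / c + 2 * ν ^ 2 / c) / h₁) ^ M
      * (‖P 0 - x‖ ^ 2 + ‖X 0 - x‖ ^ 2 + ∑ s ∈ Finset.range M, ‖δ s‖ ^ 2) := by
  have hHp : ∀ x, 0 ≤ ⟪x, H x⟫ := fun x => le_trans (by positivity) (hHl x)
  set C := 1 + 2 * (h₂ + 2 / c + 2 * ν ^ 2 / c) / h₁ with hC
  have hC1 : 1 ≤ C := by rw [hC]; exact le_add_of_nonneg_right (by positivity)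
  have key : ∀ j < M, ‖P (j + 1) - x‖ ^ 2 + ‖X (j + 1) - x‖ ^ 2
      ≤ C * (‖P j - x‖ ^ 2 + ‖X j - x‖ ^ 2 + ‖δ j‖ ^ 2) := by
    intro j hj
    have hβ0 : 0 ≤ 2 / ((j : ℝ) + 2) := by positivity
    have hβ1 : 2 / ((j : ℝ) + 2) ≤ 1 := by
      rw [div_le_one (by positivity)]; linarith [(Nat.cast_nonneg j : (0 : ℝ) ≤ j)]
    set β := 2 / ((j : ℝ) + 2)
    -- Since `M * η ≤ 1`, the coefficient `γ` can be divided out without increasing the noise term.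
    have hγ : 1 ≤ 2 / (((j : ℝ) + 1) * η) := by
      rw [le_div_iff₀ (by positivity)]
      have : (j : ℝ) + 1 ≤ M := by exact_mod_cast hj
      nlinarith
    set γ := 2 / (((j : ℝ) + 1) * η)
    set xh := β • P j + (1 - β) • X j with hxh
    have h1 : γ • H ((P (j + 1) - x) - (P j - x)) + S (P (j + 1) - x)
        = δ j - (grad xh - grad x) := by
      have e := hstep j hj
      rw [← hx] at e
      rw [sub_sub_sub_cancel_right]
      have e2 : S (P (j + 1) - p) = S (P (j + 1) - x) + S (x - p) := by
        rw [← map_add]; congr 1; abel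
      rw [e2] at e
      rw [← sub_eq_zero] at e ⊢
      rw [← e]
      abel
    have h2 := resolvent_energy hH (by positivity) hc hh₂ hHp hHu hSl h1
    have h3 : ‖xh - x‖ ^ 2 ≤ ‖P j - x‖ ^ 2 + ‖X j - x‖ ^ 2 := by
      have e : xh - x = β • (P j - x) + (1 - β) • (X j - x) := by rw [hxh]; module
      rw [e]
      exact norm_convex_sq_le hβ0 hβ1 _ _
    have h4 : ‖X (j + 1) - x‖ ^ 2 ≤ ‖P (j + 1) - x‖ ^ 2 + ‖X j - x‖ ^ 2 := by
      have e : X (j + 1) - x = β • (P (j + 1) - x) + (1 - β) • (X j - x) := by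
        rw [hX j hj]; module
      rw [e]
      exact norm_convex_sq_le hβ0 hβ1 _ _
    have h5 : ‖δ j - (grad xh - grad x)‖ ^ 2 ≤ 2 * ‖δ j‖ ^ 2
        + 2 * (ν ^ 2 * (‖P j - x‖ ^ 2 + ‖X j - x‖ ^ 2)) := by
      refine (norm_sub_sq_le_two_mul _ _).trans ?_
      have : ‖grad xh - grad x‖ ^ 2 ≤ ν ^ 2 * ‖xh - x‖ ^ 2 := by
        rw [← mul_pow]; gcongr; exact hlip _ _
      have := mul_le_mul_of_nonneg_left h3 (sq_nonneg ν)
      linarith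
    have h6 : h₁ * ‖P (j + 1) - x‖ ^ 2 ≤ h₂ * ‖P j - x‖ ^ 2
        + ‖δ j - (grad xh - grad x)‖ ^ 2 / c := by
      have k1 := hHl (P (j + 1) - x)
      have k2 := hHu (P j - x)
      have k3 : 0 ≤ c / h₂ * ⟪P (j + 1) - x, H (P (j + 1) - x)⟫ :=
        mul_nonneg (by positivity) (hHp _)
      have k4 : 0 ≤ ‖δ j - (grad xh - grad x)‖ ^ 2 / c := by positivity
      have k5 : γ * ⟪P (j + 1) - x, H (P (j + 1) - x)⟫
          ≤ γ * (⟪P j - x, H (P j - x)⟫ + ‖δ j - (grad xh - grad x)‖ ^ 2 / c) := by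
        nlinarith
      have k6 := le_of_mul_le_mul_left k5 (by linarith)
      linarith
    have h7 : ‖P (j + 1) - x‖ ^ 2 ≤ (h₂ + 2 / c + 2 * ν ^ 2 / c) / h₁
        * (‖P j - x‖ ^ 2 + ‖X j - x‖ ^ 2 + ‖δ j‖ ^ 2) := by
      have e : (h₂ + 2 / c + 2 * ν ^ 2 / c) / h₁ * (‖P j - x‖ ^ 2 + ‖X j - x‖ ^ 2 + ‖δ j‖ ^ 2)
        = ((h₂ + 2 / c + 2 * ν ^ 2 / c) * (‖P j - x‖ ^ 2 + ‖X j - x‖ ^ 2 + ‖δ j‖ ^ 2)) / h₁ := by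
        ring
      rw [e, le_div_iff₀ hh₁, mul_comm]
      refine h6.trans ?_
      have k1 := div_le_div_of_nonneg_right h5 hc.le
      refine (add_le_add_right k1 _).trans ?_
      have k2 : 0 ≤ 2 / c * (‖P j - x‖ ^ 2 + ‖X j - x‖ ^ 2) := by positivity
      have k3 : 0 ≤ 2 * ν ^ 2 / c * ‖δ j‖ ^ 2 := by positivity
      have k4 : 0 ≤ h₂ * (‖X j - x‖ ^ 2 + ‖δ j‖ ^ 2) := by positivity
      have k5 : (2 * ‖δ j‖ ^ 2 + 2 * (ν ^ 2 * (‖P j - x‖ ^ 2 + ‖X j - x‖ ^ 2))) / c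
        = 2 / c * ‖δ j‖ ^ 2 + 2 * ν ^ 2 / c * (‖P j - x‖ ^ 2 + ‖X j - x‖ ^ 2) := by ring
      rw [k5]
      linarith
    have e : C * (‖P j - x‖ ^ 2 + ‖X j - x‖ ^ 2 + ‖δ j‖ ^ 2)
      = (‖P j - x‖ ^ 2 + ‖X j - x‖ ^ 2 + ‖δ j‖ ^ 2) + 2 * ((h₂ + 2 / c + 2 * ν ^ 2 / c) / h₁
        * (‖P j - x‖ ^ 2 + ‖X j - x‖ ^ 2 + ‖δ j‖ ^ 2)) := by rw [hC]; ring
    rw [e]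
    nlinarith [sq_nonneg ‖P j - x‖, sq_nonneg ‖δ j‖]
  have hind : ∀ j ≤ M, ‖P j - x‖ ^ 2 + ‖X j - x‖ ^ 2 ≤ C ^ j * (‖P 0 - x‖ ^ 2 + ‖X 0 - x‖ ^ 2
      + ∑ s ∈ Finset.range j, ‖δ s‖ ^ 2) := by
    intro j
    induction j with
    | zero => intro _; simp
    | succ j ih =>
      intro hj
      refine (key j (by omega)).trans ?_
      have h1 : 1 ≤ C ^ j := one_le_pow₀ hC1
      have h2 := ih (by omega)
      have h3 := le_mul_of_one_le_left (sq_nonneg ‖δ j‖) h1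
      rw [pow_succ' C, mul_assoc C, Finset.sum_range_succ]
      refine mul_le_mul_of_nonneg_left ?_ (by linarith)
      linarith
  exact le_trans (le_add_of_nonneg_left (by positivity)) (hind M le_rfl)

end FewSteps

/-! ### The Lyapunov function of the outer iteration and its descent. -/

noncomputable section

variable {E₁ E₂ G : Type*} [NormedAddCommGroup E₁] [InnerProductSpace ℝ E₁]
  [NormedAddCommGroup E₂] [InnerProductSpace ℝ E₂] [NormedAddCommGroup G] [InnerProductSpace ℝ G]

/-- The weight of the constraint residual in the Lyapunov function. -/
def residualWeight (s : ℝ) : ℝ := ((1 - s) ^ 2 + (2 - s)) / 2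

/-- The Lyapunov function of the outer iteration, in terms of the errors `u`, `v`, `l` of `x`, `y`
and the multiplier. -/
def lyapunov (A : E₁ →ₗ[ℝ] G) (B : E₂ →ₗ[ℝ] G) (β s : ℝ) (D : E₁ →ₗ[ℝ] E₁) (u : E₁) (v : E₂)
    (l : G) : ℝ :=
  ‖l‖ ^ 2 / (s * β) + β * ‖B v‖ ^ 2 + ⟪u, D u⟫ + β * residualWeight s * ‖A u + B v‖ ^ 2

variable {A : E₁ →ₗ[ℝ] G} {B : E₂ →ₗ[ℝ] G} {At : G →ₗ[ℝ] E₁} {Bt : G →ₗ[ℝ] E₂}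

/-- The conditions `h1`, `h2` and `h3` are optimality for `x'` up to a residual `r`, for `y'`, and
for `y` from the preceding iteration. Monotonicity of the gradient of `g` between the last two
controls the cross term in `B v' - B v`. As `residualWeight` is the midpoint of `(1 - s)^2` and `2 -
s`, both residuals receive the same negative coefficient, half of the gap. -/
theorem lyapunov_descent (hA : ∀ l x, ⟪At l, x⟫ = ⟪l, A x⟫) (hB : ∀ l y, ⟪Bt l, y⟫ = ⟪l, B y⟫)
    {β s α : ℝ} (hβ : 0 < β) (hs : 0 < s) (hα : 0 < α) {D : E₁ →ₗ[ℝ] E₁}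
    (hD : ∀ x y, ⟪D x, y⟫ = ⟪x, D y⟫) {u u' gf r : E₁} {v v' gg gg' : E₂} {l : G}
    (h1 : gf - At (l - β • (A u' + B v)) + D (u' - u) = r)
    (h2 : gg' = Bt (l - β • (A u' + B v')))
    (h3 : gg = Bt (l + ((s - 1) * β) • (A u + B v)))
    (hgf : α * ‖u'‖ ^ 2 ≤ ⟪gf, u'⟫) (hgg : α * ‖v'‖ ^ 2 ≤ ⟪gg', v'⟫)
    (hmono : 0 ≤ ⟪gg' - gg, v' - v⟫) :
    lyapunov A B β s D u' v' (l - (s * β) • (A u' + B v')) ≤ lyapunov A B β s D u v l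
      - α * ‖u'‖ ^ 2 - 2 * α * ‖v'‖ ^ 2 - ⟪u' - u, D (u' - u)⟫
      - β * ((2 - s - (1 - s) ^ 2) / 2) * (‖A u' + B v'‖ ^ 2 + ‖A u + B v‖ ^ 2)
      + ‖r‖ ^ 2 / α := by
  have e1 : ⟪gf, u'⟫ - ⟪l - β • (A u' + B v), A u'⟫ + ⟪D (u' - u), u'⟫ = ⟪r, u'⟫ := by
    rw [← h1, inner_add_left, inner_sub_left (x := gf), hA]
  have e2 : ⟪gg', v'⟫ = ⟪l - β • (A u' + B v'), B v'⟫ := by rw [h2, hB]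
  have e3 : 0 ≤ ⟪-(β • (A u' + B v')) - ((s - 1) * β) • (A u + B v), B v' - B v⟫ := by
    rw [h2, h3, ← map_sub, hB, map_sub] at hmono
    convert hmono using 2
    abel
  have e4 := two_mul_inner_map_sub hD u' u 0
  simp only [sub_zero] at e4
  have e5 : ⟪r, u'⟫ ≤ ‖r‖ ^ 2 / (2 * α) + α / 2 * ‖u'‖ ^ 2 :=
    (real_inner_le_norm _ _).trans (mul_le_sq_div_add hα)
  have e6 : ‖r‖ ^ 2 / α = 2 * (‖r‖ ^ 2 / (2 * α)) := by field_simp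
  have e7 : ‖l - (s * β) • (A u' + B v')‖ ^ 2 / (s * β) = ‖l‖ ^ 2 / (s * β)
      - 2 * ⟪l, A u' + B v'⟫ + s * β * ‖A u' + B v'‖ ^ 2 := by
    rw [norm_sub_sq_real, norm_smul, inner_smul_right, Real.norm_of_nonneg (by positivity)]
    field_simp
  unfold lyapunov residualWeight
  rw [e6, e7]
  obtain ⟨p', hp'⟩ : ∃ p', p' = A u' + B v' := ⟨_, rfl⟩
  obtain ⟨p, hp⟩ : ∃ p, p = A u + B v := ⟨_, rfl⟩
  have eA : A u' = p' - B v' := by rw [hp']; abel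
  rw [← hp'] at e2 e3 ⊢
  rw [← hp] at e3 ⊢
  rw [eA] at e1
  obtain ⟨d, hd⟩ : ∃ d, d = B v - B v' := ⟨_, rfl⟩
  have hm : B v = B v' + d := by rw [hd]; abel
  rw [hm] at e1 e3 ⊢
  generalize B v' = m' at *
  -- By `e3` the inner product of `d` with `p'` is at least `1 - s` times that with `p`; this square
  -- bounds the latter from below, at the cost of `‖d‖²`, which the change of `‖B v‖²` supplies, and
  -- `(1 - s)^2 ‖p‖²`.
  have e8 : 0 ≤ ‖d + (1 - s) • p‖ ^ 2 := by positivity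
  have e10 : -(β • p') - ((s - 1) * β) • p = -(β • (p' + (s - 1) • p)) := by module
  have e11 : p' - m' + (m' + d) = p' + d := by abel
  rw [norm_add_sq_real, norm_smul, mul_pow, Real.norm_eq_abs, sq_abs, inner_smul_right] at e8
  rw [sub_add_cancel_left, e10, inner_neg_neg, real_inner_smul_left, inner_add_left,
    real_inner_smul_left] at e3
  rw [e11] at e1
  rw [norm_add_sq_real m' d]
  have k1 : ⟪l - β • (p' + d), p' - m'⟫ = ⟪l, p'⟫ - ⟪l, m'⟫ - β * ‖p'‖ ^ 2 + β * ⟪m', p'⟫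
      - β * ⟪d, p'⟫ + β * ⟪m', d⟫ := by
    simp only [inner_sub_left, inner_sub_right, inner_add_left, real_inner_smul_left,
      real_inner_self_eq_norm_sq]
    rw [real_inner_comm m' p', real_inner_comm m' d]
    ring
  have k2 : ⟪l - β • p', m'⟫ = ⟪l, m'⟫ - β * ⟪m', p'⟫ := by
    rw [inner_sub_left, real_inner_smul_left, real_inner_comm m' p']
  rw [k1] at e1
  rw [k2] at e2
  rw [real_inner_comm d p', real_inner_comm d p] at e3
  have e9 := mul_nonneg hβ.le e8
  nlinarith only [e1, e2, e3, e4, e5, e9, hgf, hgg]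

end

end ASADMM

namespace ASADMM

open scoped RealInnerProductSpace

/-! ### Contraction and growth of the Lyapunov function; the exact subproblem. -/

section Outer

/-- Nonnegativity of the form at `x - c⁻¹ • D x` yields `‖D x‖² ≤ c ⟪x, D x⟫`. -/
theorem norm_map_le_of_form_le {E : Type*} [NormedAddCommGroup E] [InnerProductSpace ℝ E]
    {D : E →ₗ[ℝ] E} (hD : ∀ x y, ⟪D x, y⟫ = ⟪x, D y⟫) {c : ℝ} (hc : 0 < c)
    (h0 : ∀ x, 0 ≤ ⟪x, D x⟫) (h1 : ∀ x, ⟪x, D x⟫ ≤ c * ‖x‖ ^ 2) (x : E) : ‖D x‖ ≤ c * ‖x‖ := by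
  have h2 := h0 (x - c⁻¹ • D x)
  have h3 := h1 (D x)
  have h4 := h1 x
  have e : ⟪x - c⁻¹ • D x, D (x - c⁻¹ • D x)⟫
      = ⟪x, D x⟫ - 2 * (c⁻¹ * ‖D x‖ ^ 2) + c⁻¹ * (c⁻¹ * ⟪D x, D (D x)⟫) := by
    simp only [map_sub, map_smul, inner_sub_left, inner_sub_right, real_inner_smul_left,
      real_inner_smul_right, real_inner_self_eq_norm_sq]
    rw [← hD x (D x), real_inner_self_eq_norm_sq]
    ring
  rw [e] at h2
  have h5 : c⁻¹ * (c⁻¹ * ⟪D x, D (D x)⟫) ≤ c⁻¹ * ‖D x‖ ^ 2 := by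
    refine mul_le_mul_of_nonneg_left ?_ (by positivity)
    rw [inv_mul_le_iff₀ hc]
    exact h3
  have h6 : c⁻¹ * ‖D x‖ ^ 2 ≤ c * ‖x‖ ^ 2 := by linarith
  rw [inv_mul_le_iff₀ hc] at h6
  have h7 : ‖D x‖ ^ 2 ≤ (c * ‖x‖) ^ 2 := by linarith [mul_pow c ‖x‖ 2]
  exact le_of_sq_le_sq h7 (by positivity)

variable {E₁ E₂ G : Type*} [NormedAddCommGroup E₁] [InnerProductSpace ℝ E₁]
  [NormedAddCommGroup E₂] [InnerProductSpace ℝ E₂] [NormedAddCommGroup G] [InnerProductSpace ℝ G]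
  {A : E₁ →ₗ[ℝ] G} {B : E₂ →ₗ[ℝ] G} {At : G →ₗ[ℝ] E₁} {Bt : G →ₗ[ℝ] E₂}

theorem residualWeight_pos {s : ℝ} (hg : (1 - s) ^ 2 < 2 - s) : 0 < residualWeight s := by
  have := sq_nonneg (1 - s)
  unfold residualWeight
  linarith

theorem lyapunov_bounds {β s : ℝ} (hβ : 0 < β) (hs : 0 < s) (hg : (1 - s) ^ 2 < 2 - s) {c : ℝ}
    (hc : 0 < c) {D : E₁ →ₗ[ℝ] E₁} (hDl : ∀ x, c * ‖x‖ ^ 2 ≤ ⟪x, D x⟫) (u : E₁) (v : E₂) (l : G) :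
    0 ≤ lyapunov A B β s D u v l ∧ ‖l‖ ^ 2 ≤ s * β * lyapunov A B β s D u v l
      ∧ ‖u‖ ^ 2 ≤ c⁻¹ * lyapunov A B β s D u v l
      ∧ ‖A u + B v‖ ^ 2 ≤ (β * residualWeight s)⁻¹ * lyapunov A B β s D u v l := by
  have hκ := residualWeight_pos hg
  have h1 : 0 ≤ ‖l‖ ^ 2 / (s * β) := by positivity
  have h2 : 0 ≤ β * ‖B v‖ ^ 2 := by positivity
  have h3 := hDl u
  have h3' : 0 ≤ c * ‖u‖ ^ 2 := by positivity
  have h4 : 0 ≤ β * residualWeight s * ‖A u + B v‖ ^ 2 := by positivity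
  unfold lyapunov
  refine ⟨by linarith, ?_, ?_, ?_⟩
  · rw [← div_le_iff₀' (by positivity)]; linarith
  · rw [le_inv_mul_iff₀ hc]; linarith
  · rw [le_inv_mul_iff₀ (by positivity)]; linarith

-- All parts of the Lyapunov function are bounded by the quantities dissipated in the descent and by
-- `‖r‖`. For the multiplier this rests on reading `At l` and `Bt l` off the optimality conditions
-- and on the last hypothesis, a Hoffman-type bound with constant `κ`.
set_option maxHeartbeats 800000 in
theorem lyapunov_contraction (hA : ∀ l x, ⟪At l, x⟫ = ⟪l, A x⟫)
    (hB : ∀ l y, ⟪Bt l, y⟫ = ⟪l, B y⟫) {β s α ν c₁ c₂ a κ : ℝ} (hβ : 0 < β) (hs : 0 < s)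
    (hg : (1 - s) ^ 2 < 2 - s) (hα : 0 < α) (hν : 0 < ν) (hc₁ : 0 < c₁) (hc₂ : 0 < c₂)
    (ha : 0 < a) (hκ : 0 < κ) (hAn : ∀ x, ‖A x‖ ≤ a * ‖x‖) (hAtn : ∀ l, ‖At l‖ ≤ a * ‖l‖)
    (hBtn : ∀ l, ‖Bt l‖ ≤ a * ‖l‖) :
    ∃ q K : ℝ, 0 < q ∧ q < 1 ∧ 0 < K ∧ ∀ (D : E₁ →ₗ[ℝ] E₁), (∀ x y, ⟪D x, y⟫ = ⟪x, D y⟫) →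
      (∀ x, c₁ * ‖x‖ ^ 2 ≤ ⟪x, D x⟫) → (∀ x, ⟪x, D x⟫ ≤ c₂ * ‖x‖ ^ 2) →
      ∀ (u u' gf r : E₁) (v v' gg gg' : E₂) (l : G),
      gf - At (l - β • (A u' + B v)) + D (u' - u) = r →
      gg' = Bt (l - β • (A u' + B v')) →
      gg = Bt (l + ((s - 1) * β) • (A u + B v)) →
      α * ‖u'‖ ^ 2 ≤ ⟪gf, u'⟫ → α * ‖v'‖ ^ 2 ≤ ⟪gg', v'⟫ → 0 ≤ ⟪gg' - gg, v' - v⟫ →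
      ‖gf‖ ≤ ν * ‖u'‖ → ‖gg'‖ ≤ ν * ‖v'‖ → ‖l‖ ^ 2 ≤ κ * (‖At l‖ ^ 2 + ‖Bt l‖ ^ 2) →
      lyapunov A B β s D u' v' (l - (s * β) • (A u' + B v'))
        ≤ q * lyapunov A B β s D u v l + K * ‖r‖ ^ 2 := by
  have hκ' := residualWeight_pos hg
  obtain ⟨ζ, hζ⟩ : ∃ ζ, ζ = β * ((2 - s - (1 - s) ^ 2) / 2) := ⟨_, rfl⟩
  have hζ0 : 0 < ζ := by rw [hζ]; exact mul_pos hβ (by linarith)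
  obtain ⟨k₁, hk₁⟩ : ∃ k, k = ν + β * a * (1 + 2 * a) + c₂ + 1 := ⟨_, rfl⟩
  obtain ⟨k₂, hk₂⟩ : ∃ k, k = ν + β * a := ⟨_, rfl⟩
  obtain ⟨k, hk⟩ : ∃ k, k = κ * (k₁ ^ 2 + k₂ ^ 2) / (s * β) + β * (1 + a) ^ 2 + c₂
    + β * residualWeight s := ⟨_, rfl⟩
  have hk0 : 0 < k := by rw [hk]; positivity
  obtain ⟨m, hm⟩ : ∃ m, m = min α (min c₁ ζ) := ⟨_, rfl⟩
  have hm0 : 0 < m := by rw [hm]; exact lt_min hα (lt_min hc₁ hζ0)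
  have hmα : m ≤ α := hm ▸ min_le_left _ _
  have hmc : m ≤ c₁ := hm ▸ (min_le_right _ _).trans (min_le_left _ _)
  have hmζ : m ≤ ζ := hm ▸ (min_le_right _ _).trans (min_le_right _ _)
  -- Here `m` is the dissipation rate and `6 * k` bounds the Lyapunov function by `S + ‖r‖²`, the 6
  -- counting the summands of `t`; adding `m` to the denominator keeps the factor positive.
  refine ⟨1 - m / (6 * k + m), m + 1 / α, ?_, ?_, by positivity, ?_⟩
  · rw [sub_pos, div_lt_one (by positivity)]; linarith
  · have : 0 < m / (6 * k + m) := by positivity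
    linarith
  intro D hD hDl hDu u u' gf r v v' gg gg' l h1 h2 h3 hgf hgg hmono hfn hgn hl
  have hdes := lyapunov_descent hA hB hβ hs hα hD h1 h2 h3 hgf hgg hmono
  have hV0 := (lyapunov_bounds (A := A) (B := B) hβ hs hg hc₁ hDl u v l).1
  have hDn := norm_map_le_of_form_le hD hc₂ (fun x => le_trans (by positivity) (hDl x)) hDu
  rw [← hζ] at hdes
  obtain ⟨S, hS⟩ : ∃ S, S = ‖u'‖ ^ 2 + ‖v'‖ ^ 2 + ‖u' - u‖ ^ 2 + ‖A u' + B v'‖ ^ 2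
    + ‖A u + B v‖ ^ 2 := ⟨_, rfl⟩
  have hdiss : lyapunov A B β s D u' v' (l - (s * β) • (A u' + B v'))
      ≤ lyapunov A B β s D u v l - m * S + ‖r‖ ^ 2 / α := by
    have := hDl (u' - u)
    have := mul_le_mul_of_nonneg_right hmα (sq_nonneg ‖u'‖)
    have := mul_le_mul_of_nonneg_right hmα (sq_nonneg ‖v'‖)
    have := mul_le_mul_of_nonneg_right hmc (sq_nonneg ‖u' - u‖)
    have := mul_le_mul_of_nonneg_right hmζ (sq_nonneg ‖A u' + B v'‖)
    have := mul_le_mul_of_nonneg_right hmζ (sq_nonneg ‖A u + B v‖)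
    have : 0 ≤ α * ‖v'‖ ^ 2 := by positivity
    rw [hS]
    linarith
  obtain ⟨t, ht⟩ : ∃ t, t = ‖u'‖ + ‖v'‖ + ‖u' - u‖ + ‖A u' + B v'‖ + ‖A u + B v‖ + ‖r‖ :=
    ⟨_, rfl⟩
  have n1 := norm_nonneg u'
  have n2 := norm_nonneg v'
  have n3 := norm_nonneg (u' - u)
  have n4 := norm_nonneg (A u' + B v')
  have n5 := norm_nonneg (A u + B v)
  have n6 := norm_nonneg r
  have ht0 : 0 ≤ t := by rw [ht]; positivity
  have ht2 : t ^ 2 ≤ 6 * (S + ‖r‖ ^ 2) := by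
    rw [ht, hS]
    nlinarith only [sq_nonneg (‖u'‖ - ‖v'‖), sq_nonneg (‖u'‖ - ‖u' - u‖),
      sq_nonneg (‖u'‖ - ‖A u' + B v'‖), sq_nonneg (‖u'‖ - ‖A u + B v‖), sq_nonneg (‖u'‖ - ‖r‖),
      sq_nonneg (‖v'‖ - ‖u' - u‖), sq_nonneg (‖v'‖ - ‖A u' + B v'‖),
      sq_nonneg (‖v'‖ - ‖A u + B v‖), sq_nonneg (‖v'‖ - ‖r‖),
      sq_nonneg (‖u' - u‖ - ‖A u' + B v'‖), sq_nonneg (‖u' - u‖ - ‖A u + B v‖),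
      sq_nonneg (‖u' - u‖ - ‖r‖), sq_nonneg (‖A u' + B v'‖ - ‖A u + B v‖),
      sq_nonneg (‖A u' + B v'‖ - ‖r‖), sq_nonneg (‖A u + B v‖ - ‖r‖)]
  have hu : ‖u‖ ≤ t := by
    have : ‖u‖ ≤ ‖u'‖ + ‖u' - u‖ := by
      have e : u = u' - (u' - u) := by abel
      calc ‖u‖ = ‖u' - (u' - u)‖ := by rw [← e]
        _ ≤ _ := norm_sub_le _ _
    linarith
  have hAu := mul_le_mul_of_nonneg_left hu ha.le
  have hBv : ‖B v‖ ≤ (1 + a) * t := by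
    have : ‖B v‖ ≤ ‖A u + B v‖ + ‖A u‖ := by
      have e : B v = (A u + B v) - A u := by abel
      calc ‖B v‖ = ‖(A u + B v) - A u‖ := by rw [← e]
        _ ≤ _ := norm_sub_le _ _
    have := hAn u
    linarith
  have hAt : ‖At l‖ ≤ k₁ * t := by
    have e : At l = gf + β • At (A u' + B v) + D (u' - u) - r := by
      have e0 : At (l - β • (A u' + B v)) = At l - β • At (A u' + B v) := by
        rw [map_sub, map_smul]
      rw [← h1, e0]; abel
    have g1 : ‖A u' + B v‖ ≤ (1 + 2 * a) * t := by
      have := norm_add_le (A u') (B v)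
      have := hAn u'
      have := mul_le_mul_of_nonneg_left (show ‖u'‖ ≤ t by linarith) ha.le
      linarith
    have g2 : ‖β • At (A u' + B v)‖ ≤ β * a * ((1 + 2 * a) * t) := by
      rw [norm_smul, Real.norm_of_nonneg hβ.le, mul_assoc]
      refine mul_le_mul_of_nonneg_left ((hAtn _).trans ?_) hβ.le
      exact mul_le_mul_of_nonneg_left g1 ha.le
    have g3 := hDn (u' - u)
    have g4 := mul_le_mul_of_nonneg_left (show ‖u' - u‖ ≤ t by linarith) hc₂.le
    have g5 := mul_le_mul_of_nonneg_left (show ‖u'‖ ≤ t by linarith) hν.le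
    rw [e, hk₁]
    have g6 := norm_sub_le (gf + β • At (A u' + B v) + D (u' - u)) r
    have g7 := norm_add₃_le (a := gf) (b := β • At (A u' + B v)) (c := D (u' - u))
    linarith
  have hBt : ‖Bt l‖ ≤ k₂ * t := by
    have e : Bt l = gg' + β • Bt (A u' + B v') := by
      rw [h2, map_sub, map_smul]; abel
    have g2 : ‖β • Bt (A u' + B v')‖ ≤ β * a * t := by
      rw [norm_smul, Real.norm_of_nonneg hβ.le, mul_assoc]
      refine mul_le_mul_of_nonneg_left ((hBtn _).trans ?_) hβ.le
      exact mul_le_mul_of_nonneg_left (by linarith) ha.le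
    have g5 := mul_le_mul_of_nonneg_left (show ‖v'‖ ≤ t by linarith) hν.le
    rw [e, hk₂]
    have := norm_add_le gg' (β • Bt (A u' + B v'))
    linarith
  have hVk : lyapunov A B β s D u v l ≤ k * t ^ 2 := by
    have g1 : ‖l‖ ^ 2 / (s * β) ≤ κ * (k₁ ^ 2 + k₂ ^ 2) / (s * β) * t ^ 2 := by
      rw [div_mul_eq_mul_div]
      refine div_le_div_of_nonneg_right (hl.trans ?_) (by positivity)
      rw [mul_assoc]
      refine mul_le_mul_of_nonneg_left ?_ hκ.le
      have := pow_le_pow_left₀ (norm_nonneg _) hAt 2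
      have := pow_le_pow_left₀ (norm_nonneg _) hBt 2
      rw [mul_pow] at *
      linarith
    have g2 : β * ‖B v‖ ^ 2 ≤ β * (1 + a) ^ 2 * t ^ 2 := by
      rw [mul_assoc, ← mul_pow]; gcongr
    have g3 : ⟪u, D u⟫ ≤ c₂ * t ^ 2 := (hDu u).trans (by gcongr)
    have g4 : β * residualWeight s * ‖A u + B v‖ ^ 2 ≤ β * residualWeight s * t ^ 2 := by
      gcongr; linarith
    unfold lyapunov
    rw [hk]
    linarith
  have hS0 : 0 ≤ S := by rw [hS]; positivity
  have hfin : m / (6 * k + m) * lyapunov A B β s D u v l ≤ m * (S + ‖r‖ ^ 2) := by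
    have g1 : lyapunov A B β s D u v l ≤ (6 * k + m) * (S + ‖r‖ ^ 2) := by
      have : k * t ^ 2 ≤ k * (6 * (S + ‖r‖ ^ 2)) := by gcongr
      have : 0 ≤ m * (S + ‖r‖ ^ 2) := by positivity
      linarith
    calc _ ≤ m / (6 * k + m) * ((6 * k + m) * (S + ‖r‖ ^ 2)) := by gcongr
      _ = _ := by field_simp
  have e : (m + 1 / α) * ‖r‖ ^ 2 = m * ‖r‖ ^ 2 + ‖r‖ ^ 2 / α := by ring
  rw [e]
  linarith

/-- Growth of the errors over an outer iteration, in terms of the new error of `x`. -/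
theorem lyapunov_growth (hB : ∀ l y, ⟪Bt l, y⟫ = ⟪l, B y⟫) {β s α c₁ c₂ a : ℝ} (hβ : 0 < β)
    (hs : 0 < s) (hg : (1 - s) ^ 2 < 2 - s) (hα : 0 < α) (hc₁ : 0 < c₁) (hc₂ : 0 < c₂)
    (ha : 0 < a) (hAn : ∀ x, ‖A x‖ ≤ a * ‖x‖) (hBn : ∀ y, ‖B y‖ ≤ a * ‖y‖) :
    ∃ K : ℝ, 0 < K ∧ ∀ (D : E₁ →ₗ[ℝ] E₁),
      (∀ x, c₁ * ‖x‖ ^ 2 ≤ ⟪x, D x⟫) → (∀ x, ⟪x, D x⟫ ≤ c₂ * ‖x‖ ^ 2) →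
      ∀ (u u' : E₁) (v v' gg' : E₂) (l : G),
      gg' = Bt (l - β • (A u' + B v')) → α * ‖v'‖ ^ 2 ≤ ⟪gg', v'⟫ →
      ‖v'‖ ^ 2 ≤ K * (lyapunov A B β s D u v l + ‖u'‖ ^ 2) ∧
      lyapunov A B β s D u' v' (l - (s * β) • (A u' + B v'))
        ≤ K * (lyapunov A B β s D u v l + ‖u'‖ ^ 2) := by
  have hκ' := residualWeight_pos hg
  obtain ⟨b₁, hb₁⟩ : ∃ b, b = a / α * (1 + β * a) := ⟨_, rfl⟩
  have hb₁0 : 0 < b₁ := by rw [hb₁]; positivity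
  obtain ⟨b₂, hb₂⟩ : ∃ b, b = a * (1 + b₁) := ⟨_, rfl⟩
  have hb₂0 : 0 < b₂ := by rw [hb₂]; positivity
  obtain ⟨k, hk⟩ : ∃ k, k = (1 + s * β * b₂) ^ 2 / (s * β) + β * (a * b₁) ^ 2 + c₂
    + β * residualWeight s * b₂ ^ 2 := ⟨_, rfl⟩
  have hk0 : 0 < k := by rw [hk]; positivity
  refine ⟨(b₁ ^ 2 + k) * (2 * (s * β + 1)), by positivity, ?_⟩
  intro D hDl hDu u u' v v' gg' l h2 hgg
  obtain ⟨hV0, hVl, -, -⟩ := lyapunov_bounds (A := A) (B := B) hβ hs hg hc₁ hDl u v l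
  obtain ⟨V, hV⟩ : ∃ V, V = lyapunov A B β s D u v l := ⟨_, rfl⟩
  rw [← hV] at hV0 hVl ⊢
  obtain ⟨t, ht⟩ : ∃ t, t = ‖l‖ + ‖u'‖ := ⟨_, rfl⟩
  have ht0 : 0 ≤ t := by rw [ht]; positivity
  have n1 := norm_nonneg u'
  have n2 := norm_nonneg l
  have ht2 : t ^ 2 ≤ 2 * (s * β + 1) * (V + ‖u'‖ ^ 2) := by
    have : t ^ 2 ≤ 2 * (‖l‖ ^ 2 + ‖u'‖ ^ 2) := by
      rw [ht]; nlinarith [sq_nonneg (‖l‖ - ‖u'‖)]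
    have : 0 ≤ s * β * ‖u'‖ ^ 2 := by positivity
    nlinarith
  -- Optimality for `y'` is tested with `v'`; the term `-β ‖B v'‖²` has the good sign, and strong
  -- monotonicity leaves a bound by `l` and `u'` alone.
  have hv : ‖v'‖ ≤ b₁ * t := by
    rw [h2, hB] at hgg
    have e : ⟪l - β • (A u' + B v'), B v'⟫ = ⟪l - β • A u', B v'⟫ - β * ‖B v'‖ ^ 2 := by
      rw [smul_add, ← sub_sub, inner_sub_left _ (β • B v'), real_inner_smul_left,
        real_inner_self_eq_norm_sq]
    have g1 := real_inner_le_norm (l - β • A u') (B v')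
    have g2 : ‖l - β • A u'‖ ≤ (1 + β * a) * t := by
      have := norm_sub_le l (β • A u')
      rw [norm_smul, Real.norm_of_nonneg hβ.le] at this
      have := mul_le_mul_of_nonneg_left (hAn u') hβ.le
      have : 0 ≤ β * a * ‖l‖ := by positivity
      rw [ht]
      linarith
    have g3 : ‖l - β • A u'‖ * ‖B v'‖ ≤ ((1 + β * a) * t) * (a * ‖v'‖) := by
      gcongr; exact hBn v'
    have g4 : 0 ≤ β * ‖B v'‖ ^ 2 := by positivity
    have g5 : α * ‖v'‖ ^ 2 ≤ (a * (1 + β * a) * t) * ‖v'‖ := by linarith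
    rcases (norm_nonneg v').eq_or_lt with h0 | h0
    · rw [← h0]; positivity
    · have g6 : α * ‖v'‖ ≤ a * (1 + β * a) * t := by
        refine le_of_mul_le_mul_right ?_ h0
        linarith
      have e2 : b₁ * t = (a * (1 + β * a) * t) / α := by rw [hb₁]; ring
      rw [e2, le_div_iff₀ hα]
      linarith
  have hBv : ‖B v'‖ ≤ a * b₁ * t := by
    have := hBn v'
    have := mul_le_mul_of_nonneg_left hv ha.le
    linarith
  have hp : ‖A u' + B v'‖ ≤ b₂ * t := by
    have := norm_add_le (A u') (B v')
    have := hAn u'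
    have := mul_le_mul_of_nonneg_left (show ‖u'‖ ≤ t by linarith) ha.le
    rw [hb₂]
    linarith
  have hl : ‖l - (s * β) • (A u' + B v')‖ ≤ (1 + s * β * b₂) * t := by
    have := norm_sub_le l ((s * β) • (A u' + B v'))
    rw [norm_smul, Real.norm_of_nonneg (by positivity)] at this
    have := mul_le_mul_of_nonneg_left hp (show 0 ≤ s * β by positivity)
    linarith
  have hk1 : lyapunov A B β s D u' v' (l - (s * β) • (A u' + B v')) ≤ k * t ^ 2 := by
    have g1 : ‖l - (s * β) • (A u' + B v')‖ ^ 2 / (s * β)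
        ≤ (1 + s * β * b₂) ^ 2 / (s * β) * t ^ 2 := by
      rw [div_mul_eq_mul_div, ← mul_pow]; gcongr
    have g2 : β * ‖B v'‖ ^ 2 ≤ β * (a * b₁) ^ 2 * t ^ 2 := by
      rw [mul_assoc, ← mul_pow]; gcongr
    have g3 : ⟪u', D u'⟫ ≤ c₂ * t ^ 2 := (hDu u').trans (by gcongr; linarith)
    have g4 : β * residualWeight s * ‖A u' + B v'‖ ^ 2
        ≤ β * residualWeight s * b₂ ^ 2 * t ^ 2 := by
      rw [mul_assoc _ (b₂ ^ 2), ← mul_pow]; gcongr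
    unfold lyapunov
    rw [hk]
    linarith
  have hv2 : ‖v'‖ ^ 2 ≤ b₁ ^ 2 * t ^ 2 := by rw [← mul_pow]; gcongr
  have g1 := mul_le_mul_of_nonneg_left ht2 (sq_nonneg b₁)
  have g2 := mul_le_mul_of_nonneg_left ht2 hk0.le
  have g3 : 0 ≤ b₁ ^ 2 * t ^ 2 := by positivity
  have g4 : 0 ≤ k * t ^ 2 := by positivity
  constructor <;> linarith

/-- The error of the exact solution `xt` of the `x`-subproblem. -/
theorem subproblem_error (hA : ∀ l x, ⟪At l, x⟫ = ⟪l, A x⟫) {β s c₁ c₂ a : ℝ}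
    (hβ : 0 < β) (hs : 0 < s) (hg : (1 - s) ^ 2 < 2 - s) (hc₁ : 0 < c₁) (hc₂ : 0 < c₂)
    (ha : 0 < a) (hAn : ∀ x, ‖A x‖ ≤ a * ‖x‖) (hAtn : ∀ l, ‖At l‖ ≤ a * ‖l‖) :
    ∃ K : ℝ, 0 < K ∧ ∀ (D : E₁ →ₗ[ℝ] E₁), (∀ x y, ⟪D x, y⟫ = ⟪x, D y⟫) →
      (∀ x, c₁ * ‖x‖ ^ 2 ≤ ⟪x, D x⟫) → (∀ x, ⟪x, D x⟫ ≤ c₂ * ‖x‖ ^ 2) →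
      ∀ (u ut gf : E₁) (v : E₂) (l : G),
      gf - At (l - β • (A u + B v)) + (D (ut - u) + β • At (A (ut - u))) = 0 →
      0 ≤ ⟪gf, ut⟫ → ‖ut‖ ^ 2 ≤ K * lyapunov A B β s D u v l := by
  have hκ' := residualWeight_pos hg
  refine ⟨3 * (((c₂ + β * a ^ 2) / c₁) ^ 2 * c₁⁻¹ + (a / c₁) ^ 2 * (s * β)
    + (β * a / c₁) ^ 2 * (β * residualWeight s)⁻¹), by positivity, ?_⟩
  intro D hD hDl hDu u ut gf v l h hmono
  obtain ⟨hV0, hVl, hVu, hVp⟩ := lyapunov_bounds (A := A) (B := B) hβ hs hg hc₁ hDl u v l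
  have hDn := norm_map_le_of_form_le hD hc₂ (fun x => le_trans (by positivity) (hDl x)) hDu
  have e1 : gf + (D ut + β • At (A ut)) = D u + β • At (A u) + At l - β • At (A u + B v) := by
    rw [map_sub, map_sub, map_sub, map_sub, map_smul] at h
    rw [← sub_eq_zero, ← h, smul_sub]
    abel
  -- Testing with `ut`: every term on the left is nonnegative, and the middle one is coercive.
  have e2 : ⟪gf, ut⟫ + ⟪ut, D ut⟫ + β * ‖A ut‖ ^ 2
      = ⟪D u + β • At (A u) + At l - β • At (A u + B v), ut⟫ := by
    rw [← e1, inner_add_left, inner_add_left, real_inner_smul_left, hA, real_inner_self_eq_norm_sq,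
      real_inner_comm ut (D ut)]
    ring
  have g1 := real_inner_le_norm (D u + β • At (A u) + At l - β • At (A u + B v)) ut
  have g2 : ‖D u + β • At (A u) + At l - β • At (A u + B v)‖
      ≤ (c₂ + β * a ^ 2) * ‖u‖ + a * ‖l‖ + β * a * ‖A u + B v‖ := by
    have k1 := norm_sub_le (D u + β • At (A u) + At l) (β • At (A u + B v))
    have k2 := norm_add₃_le (a := D u) (b := β • At (A u)) (c := At l)
    rw [norm_smul, Real.norm_of_nonneg hβ.le] at k1
    rw [norm_smul, Real.norm_of_nonneg hβ.le] at k2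
    have k3 := hDn u
    have k4 : β * ‖At (A u)‖ ≤ β * (a * (a * ‖u‖)) := by
      gcongr; exact (hAtn _).trans (by gcongr; exact hAn u)
    have k5 := hAtn l
    have k6 : β * ‖At (A u + B v)‖ ≤ β * (a * ‖A u + B v‖) := by gcongr; exact hAtn _
    linarith
  have g3 : 0 ≤ β * ‖A ut‖ ^ 2 := by positivity
  have g4 := hDl ut
  have g5 : ‖ut‖ ≤ (c₂ + β * a ^ 2) / c₁ * ‖u‖ + a / c₁ * ‖l‖ + β * a / c₁ * ‖A u + B v‖ := by
    have e3 : (c₂ + β * a ^ 2) / c₁ * ‖u‖ + a / c₁ * ‖l‖ + β * a / c₁ * ‖A u + B v‖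
      = ((c₂ + β * a ^ 2) * ‖u‖ + a * ‖l‖ + β * a * ‖A u + B v‖) / c₁ := by ring
    rcases (norm_nonneg ut).eq_or_lt with h0 | h0
    · rw [← h0]; positivity
    · rw [e3, le_div_iff₀ hc₁]
      refine le_of_mul_le_mul_right ?_ h0
      have := mul_le_mul_of_nonneg_right g2 h0.le
      nlinarith
  obtain ⟨x, hx⟩ : ∃ x, x = (c₂ + β * a ^ 2) / c₁ := ⟨_, rfl⟩
  obtain ⟨y, hy⟩ : ∃ y, y = a / c₁ := ⟨_, rfl⟩
  obtain ⟨z, hz⟩ : ∃ z, z = β * a / c₁ := ⟨_, rfl⟩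
  rw [← hx, ← hy, ← hz] at g5 ⊢
  have g6 := pow_le_pow_left₀ (norm_nonneg ut) g5 2
  have g7 : (x * ‖u‖ + y * ‖l‖ + z * ‖A u + B v‖) ^ 2 ≤ 3 * (x ^ 2 * ‖u‖ ^ 2 + y ^ 2 * ‖l‖ ^ 2
      + z ^ 2 * ‖A u + B v‖ ^ 2) := by
    nlinarith only [sq_nonneg (x * ‖u‖ - y * ‖l‖), sq_nonneg (x * ‖u‖ - z * ‖A u + B v‖),
      sq_nonneg (y * ‖l‖ - z * ‖A u + B v‖)]
  have k1 := mul_le_mul_of_nonneg_left hVl (sq_nonneg y)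
  have k2 := mul_le_mul_of_nonneg_left hVu (sq_nonneg x)
  have k3 := mul_le_mul_of_nonneg_left hVp (sq_nonneg z)
  linarith

end Outer

end ASADMM

namespace ASADMM

open scoped RealInnerProductSpace

/-! ### From matrices to linear maps; a Hoffman-type bound. -/

section Matrices

open Matrix

theorem inner_toEuclideanLin_transpose {m n : ℕ} (A : Matrix (Fin m) (Fin n) ℝ) (l : Vec m)
    (x : Vec n) : ⟪toEuclideanLin Aᵀ l, x⟫ = ⟪l, toEuclideanLin A x⟫ := by
  rw [← Matrix.conjTranspose_eq_transpose_of_trivial,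
    Matrix.toEuclideanLin_conjTranspose_eq_adjoint, LinearMap.adjoint_inner_left]

theorem exists_norm_toEuclideanLin_le {m n : ℕ} (A : Matrix (Fin m) (Fin n) ℝ) :
    ∃ a : ℝ, 0 < a ∧ ∀ x, ‖toEuclideanLin A x‖ ≤ a * ‖x‖ := by
  refine ⟨‖LinearMap.toContinuousLinearMap (toEuclideanLin A)‖ + 1, by positivity, fun x => ?_⟩
  have h := (LinearMap.toContinuousLinearMap (toEuclideanLin A)).le_opNorm x
  rw [LinearMap.coe_toContinuousLinearMap'] at h
  have := norm_nonneg x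
  linarith

theorem posSemidef_symm {n : ℕ} {D : Matrix (Fin n) (Fin n) ℝ} (hD : D.PosSemidef) (x y : Vec n) :
    ⟪toEuclideanLin D x, y⟫ = ⟪x, toEuclideanLin D y⟫ := by
  rw [← inner_toEuclideanLin_transpose, ← Matrix.conjTranspose_eq_transpose_of_trivial,
    hD.isHermitian.eq]

theorem posSemidef_inner_nonneg {n : ℕ} {D : Matrix (Fin n) (Fin n) ℝ} (hD : D.PosSemidef)
    (x : Vec n) : 0 ≤ ⟪x, toEuclideanLin D x⟫ := by
  have h := (Matrix.isPositive_toEuclideanLin_iff.2 hD).2 x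
  rw [real_inner_comm]
  exact h

theorem inner_toEuclideanLin_smul_one {n : ℕ} (c : ℝ) (x : Vec n) :
    ⟪x, toEuclideanLin (c • (1 : Matrix (Fin n) (Fin n) ℝ)) x⟫ = c * ‖x‖ ^ 2 := by
  have e : toEuclideanLin (c • (1 : Matrix (Fin n) (Fin n) ℝ)) x = c • x := by
    rw [map_smul, LinearMap.smul_apply]
    congr 1
    exact congrArg (fun T : Vec n →ₗ[ℝ] Vec n => T x) (Matrix.toLpLin_one (p := 2))
  rw [e, real_inner_smul_right, real_inner_self_eq_norm_sq]

/-- For the lower bound, `‖x‖ ≤ b ‖H x‖` because `H` is invertible, and `‖H x‖² ≤ a ⟪x, H x⟫` by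
testing the form at `x - a⁻¹ • H x`. -/
theorem posDef_exists_bounds {n : ℕ} {H : Matrix (Fin n) (Fin n) ℝ} (hH : H.PosDef) :
    ∃ h₁ h₂ : ℝ, 0 < h₁ ∧ 0 < h₂ ∧ (∀ x, h₁ * ‖x‖ ^ 2 ≤ ⟪x, toEuclideanLin H x⟫) ∧
      ∀ x, ⟪x, toEuclideanLin H x⟫ ≤ h₂ * ‖x‖ ^ 2 := by
  obtain ⟨a, ha, hau⟩ := exists_norm_toEuclideanLin_le H
  obtain ⟨b, hb, hbu⟩ := exists_norm_toEuclideanLin_le H⁻¹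
  have hup : ∀ x, ⟪x, toEuclideanLin H x⟫ ≤ a * ‖x‖ ^ 2 := by
    intro x
    have h1 := real_inner_le_norm x (toEuclideanLin H x)
    have h2 := mul_le_mul_of_nonneg_left (hau x) (norm_nonneg x)
    nlinarith
  have hnn := posSemidef_inner_nonneg hH.posSemidef
  have hsym := posSemidef_symm hH.posSemidef
  have hinv : ∀ x, toEuclideanLin H⁻¹ (toEuclideanLin H x) = x := by
    intro x
    have h1 := congrArg (fun T : Vec n →ₗ[ℝ] Vec n => T x)
      (Matrix.toLpLin_mul_same 2 H⁻¹ H)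
    rw [Matrix.nonsing_inv_mul H ((Matrix.isUnit_iff_isUnit_det _).1 hH.isUnit),
      Matrix.toLpLin_one] at h1
    exact h1.symm
  refine ⟨1 / (a * b ^ 2), a, by positivity, ha, fun x => ?_, hup⟩
  have h1 := hbu (toEuclideanLin H x)
  rw [hinv] at h1
  have h2 : ‖toEuclideanLin H x‖ ^ 2 ≤ a * ⟪x, toEuclideanLin H x⟫ := by
    have h3 := hnn (x - a⁻¹ • toEuclideanLin H x)
    have h4 := hup (toEuclideanLin H x)
    have e : ⟪x - a⁻¹ • toEuclideanLin H x, toEuclideanLin H (x - a⁻¹ • toEuclideanLin H x)⟫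
        = ⟪x, toEuclideanLin H x⟫ - 2 * (a⁻¹ * ‖toEuclideanLin H x‖ ^ 2)
          + a⁻¹ * (a⁻¹ * ⟪toEuclideanLin H x, toEuclideanLin H (toEuclideanLin H x)⟫) := by
      simp only [map_sub, map_smul, inner_sub_left, inner_sub_right, real_inner_smul_left,
        real_inner_smul_right, real_inner_self_eq_norm_sq]
      rw [← hsym x (toEuclideanLin H x), real_inner_self_eq_norm_sq]
      ring
    rw [e] at h3
    have h5 : a⁻¹ * (a⁻¹ * ⟪toEuclideanLin H x, toEuclideanLin H (toEuclideanLin H x)⟫)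
        ≤ a⁻¹ * ‖toEuclideanLin H x‖ ^ 2 := by
      refine mul_le_mul_of_nonneg_left ?_ (by positivity)
      rw [inv_mul_le_iff₀ ha]
      exact h4
    have h6 : a⁻¹ * ‖toEuclideanLin H x‖ ^ 2 ≤ ⟪x, toEuclideanLin H x⟫ := by linarith
    rwa [inv_mul_le_iff₀ ha] at h6
  rw [div_mul_eq_mul_div, one_mul, div_le_iff₀ (by positivity)]
  calc ‖x‖ ^ 2 ≤ (b * ‖toEuclideanLin H x‖) ^ 2 := by gcongr
    _ = b ^ 2 * ‖toEuclideanLin H x‖ ^ 2 := by ring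
    _ ≤ b ^ 2 * (a * ⟪x, toEuclideanLin H x⟫) := by gcongr
    _ = _ := by ring

/-- A Hoffman-type bound: on the orthogonal complement of the common kernel of two linear maps,
the norm is controlled by the images. -/
theorem exists_norm_sq_le_of_orthogonal {G E₁ E₂ : Type*} [NormedAddCommGroup G]
    [InnerProductSpace ℝ G] [FiniteDimensional ℝ G] [NormedAddCommGroup E₁] [NormedSpace ℝ E₁]
    [NormedAddCommGroup E₂] [NormedSpace ℝ E₂] (S : G →ₗ[ℝ] E₁) (T : G →ₗ[ℝ] E₂) :
    ∃ κ : ℝ, 0 < κ ∧ ∀ l, (∀ v, S v = 0 → T v = 0 → ⟪l, v⟫ = 0) →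
      ‖l‖ ^ 2 ≤ κ * (‖S l‖ ^ 2 + ‖T l‖ ^ 2) := by
  let K : Submodule ℝ G := LinearMap.ker (S.prod T)
  -- On the orthogonal complement of the common kernel the joint map is injective, hence bounded
  -- below in finite dimension.
  have hker : LinearMap.ker ((S.prod T).domRestrict Kᗮ) = ⊥ := by
    rw [LinearMap.ker_eq_bot']
    rintro ⟨x, hx⟩ h0
    have h1 : x ∈ K := by
      have h0' : S x = 0 ∧ T x = 0 := by simpa using h0
      simpa [K] using h0'
    have h2 := Submodule.inner_right_of_mem_orthogonal h1 hx
    rw [inner_self_eq_zero] at h2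
    exact Subtype.ext h2
  obtain ⟨κ, hκ, hal⟩ := LinearMap.exists_antilipschitzWith _ hker
  refine ⟨(κ : ℝ) ^ 2, by positivity, fun l hl => ?_⟩
  have hlK : l ∈ Kᗮ := by
    rw [Submodule.mem_orthogonal']
    intro v hv
    have hv' : S v = 0 ∧ T v = 0 := by simpa [K] using hv
    exact hl v hv'.1 hv'.2
  have h1 := hal.le_mul_dist ⟨l, hlK⟩ 0
  rw [dist_zero_right, map_zero, dist_zero_right] at h1
  have h2 : ‖((S.prod T).domRestrict Kᗮ) ⟨l, hlK⟩‖ ^ 2 ≤ ‖S l‖ ^ 2 + ‖T l‖ ^ 2 := by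
    have e : ((S.prod T).domRestrict Kᗮ) ⟨l, hlK⟩ = (S l, T l) := rfl
    rw [e, Prod.norm_def]
    rcases max_choice ‖S l‖ ‖T l‖ with h | h <;> simp only [h] <;>
      nlinarith [sq_nonneg ‖S l‖, sq_nonneg ‖T l‖]
  have h3 : ‖l‖ ≤ κ * ‖((S.prod T).domRestrict Kᗮ) ⟨l, hlK⟩‖ := h1
  calc ‖l‖ ^ 2 ≤ (κ * ‖((S.prod T).domRestrict Kᗮ) ⟨l, hlK⟩‖) ^ 2 := by gcongr
    _ = (κ : ℝ) ^ 2 * ‖((S.prod T).domRestrict Kᗮ) ⟨l, hlK⟩‖ ^ 2 := by ring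
    _ ≤ _ := by gcongr

end Matrices

/-! ### Primal-dual solutions and the multiplier set. -/

section ProblemFacts

variable {n₁ n₂ n N : ℕ} {Q : Problem n₁ n₂ n N}

theorem hasGradientAt_half_norm_sq {E F : Type*} [NormedAddCommGroup E] [InnerProductSpace ℝ E]
    [FiniteDimensional ℝ E] [NormedAddCommGroup F] [InnerProductSpace ℝ F] {B : E →ₗ[ℝ] F}
    {Bt : F →ₗ[ℝ] E} [CompleteSpace E] (hB : ∀ l x, ⟪Bt l, x⟫ = ⟪l, B x⟫) (c : F) (p : E) :
    HasGradientAt (fun v => 1 / 2 * ‖B v + c‖ ^ 2) (Bt (B p + c)) p := by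
  rw [hasGradientAt_iff_hasFDerivAt]
  have h2 : HasFDerivAt (fun u : E => B u + c) (LinearMap.toContinuousLinearMap B) p :=
    ((LinearMap.toContinuousLinearMap B).hasFDerivAt (x := p)).add_const c
  refine (h2.norm_sq.const_mul (1 / 2)).congr_fderiv ?_
  ext v
  simp [hB]

/-- With the multiplier moved against the residual, the variational inequality reads `0 ≤
-‖residual‖²`. -/
theorem Problem.residual_eq_zero {w : Vec n₁ × Vec n₂ × Vec n} (hw : w ∈ Q.primalDual) :
    Q.residual w.1 w.2.1 = 0 := by
  have h := hw w.1 w.2.1 (w.2.2 - Q.residual w.1 w.2.1)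
  simp only [sub_self, inner_zero_left, zero_add, sub_sub_cancel_left, inner_neg_left,
    real_inner_self_eq_norm_sq] at h
  have : ‖Q.residual w.1 w.2.1‖ = 0 := by nlinarith [norm_nonneg (Q.residual w.1 w.2.1)]
  simpa using this

theorem Problem.gradient_eq_of_primalDual {w : Vec n₁ × Vec n₂ × Vec n} (hw : w ∈ Q.primalDual)
    {a : Vec n₁} {b : Vec n₂} (hf : HasGradientAt Q.f a w.1) (hg : HasGradientAt Q.g b w.2.1) :
    a = mulV Q.A.transpose w.2.2 ∧ b = mulV Q.B.transpose w.2.2 := by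
  constructor
  · have h1 := hasGradientAt_add hf (hasGradientAt_inner_left (-(mulV Q.A.transpose w.2.2)) w.1)
    have h2 := hasGradientAt_eq_zero_of_forall_le h1 (fun u => by
      have h := hw u w.2.1 w.2.2
      simp only [sub_self, inner_zero_left, add_zero, inner_sub_left] at h
      rw [real_inner_comm _ w.1, real_inner_comm _ u] at *
      linarith)
    rwa [← sub_eq_add_neg, sub_eq_zero] at h2
  · have h1 := hasGradientAt_add hg (hasGradientAt_inner_left (-(mulV Q.B.transpose w.2.2)) w.2.1)
    have h2 := hasGradientAt_eq_zero_of_forall_le h1 (fun u => by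
      have h := hw w.1 u w.2.2
      simp only [sub_self, inner_zero_left, zero_add, add_zero, inner_sub_left] at h
      rw [real_inner_comm _ w.2.1, real_inner_comm _ u] at *
      linarith)
    rwa [← sub_eq_add_neg, sub_eq_zero] at h2

/-- The multiplier error is orthogonal to the common kernel of `Aᵀ` and `Bᵀ`. -/
theorem Problem.inner_sub_projection_eq_zero {xs : Vec n₁} {ys : Vec n₂} {z p v : Vec n}
    (hp : IsProjection (Q.multipliers xs ys) z p) (hA : mulV Q.A.transpose v = 0)
    (hB : mulV Q.B.transpose v = 0) : ⟪z - p, v⟫ = 0 := by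
  have hres := Q.residual_eq_zero hp.1
  -- The multiplier enters the variational inequality only through `Aᵀ`, `Bᵀ` and a term that
  -- vanishes with the residual, so the multiplier set contains the whole line.
  have hmem : ∀ t : ℝ, p + t • v ∈ Q.multipliers xs ys := by
    intro t x y l
    have h := hp.1 x y l
    have e1 : mulV Q.A.transpose (p + t • v) = mulV Q.A.transpose p := by
      unfold mulV at *; rw [map_add, map_smul, hA, smul_zero, add_zero]
    have e2 : mulV Q.B.transpose (p + t • v) = mulV Q.B.transpose p := by
      unfold mulV at *; rw [map_add, map_smul, hB, smul_zero, add_zero]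
    simp only at h hres ⊢
    rw [e1, e2, hres]
    rw [hres] at h
    simpa using h
  by_contra hne
  have hv : 0 < ‖v‖ ^ 2 := by
    have : v ≠ 0 := by rintro rfl; simp at hne
    positivity
  -- The point of that line nearest to `z` would be strictly closer than `p`.
  have h := hp.2 _ (hmem (⟪z - p, v⟫ / ‖v‖ ^ 2))
  have h1 := pow_le_pow_left₀ (norm_nonneg _) h 2
  rw [← sub_sub, norm_sub_sq_real (z - p), norm_smul, mul_pow, Real.norm_eq_abs, sq_abs,
    inner_smul_right] at h1
  have e : (⟪z - p, v⟫ / ‖v‖ ^ 2) ^ 2 * ‖v‖ ^ 2 = ⟪z - p, v⟫ ^ 2 / ‖v‖ ^ 2 := by field_simp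
  have e2 : ⟪z - p, v⟫ / ‖v‖ ^ 2 * ⟪z - p, v⟫ = ⟪z - p, v⟫ ^ 2 / ‖v‖ ^ 2 := by ring
  rw [e, e2] at h1
  have : 0 < ⟪z - p, v⟫ ^ 2 / ‖v‖ ^ 2 := by positivity
  linarith

end ProblemFacts

/-! ### Optimality conditions of the updates. -/

section RunFacts

variable {n₁ n₂ n N : ℕ} {Q : Problem n₁ n₂ n N} {Ω : Type*} {R : Run n₁ n₂ n N Ω}
  {β s : ℝ} {H : Matrix (Fin n₁) (Fin n₁) ℝ}

open Matrix

theorem Run.toEuclideanLin_MM (k : ℕ) (ω : Ω) (x : Vec n₁) :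
    toEuclideanLin (R.MM k ω) x = toEuclideanLin (R.D Q β k ω) x
      + β • toEuclideanLin Q.Aᵀ (toEuclideanLin Q.A x) := by
  have e : R.MM k ω = R.D Q β k ω + β • (Q.Aᵀ * Q.A) := by simp [Run.D]
  have h1 := congrArg (fun T : Vec n₁ →ₗ[ℝ] Vec n₁ => T x) (Matrix.toLpLin_mul 2 2 2 Q.Aᵀ Q.A)
  conv_lhs => rw [e, map_add, map_smul]
  rw [LinearMap.add_apply, LinearMap.smul_apply]
  congr 2

theorem Run.MM_symm (hrun : R.FollowsUpdates Q β s H) (k : ℕ) (ω : Ω) (x y : Vec n₁) :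
    ⟪toEuclideanLin (R.MM k ω) x, y⟫ = ⟪x, toEuclideanLin (R.MM k ω) y⟫ := by
  have e : ∀ u v : Vec n₁, ⟪toEuclideanLin Q.Aᵀ (toEuclideanLin Q.A u), v⟫
      = ⟪u, toEuclideanLin Q.Aᵀ (toEuclideanLin Q.A v)⟫ := fun u v => by
    rw [inner_toEuclideanLin_transpose, real_inner_comm, ← inner_toEuclideanLin_transpose,
      real_inner_comm]
  rw [Run.toEuclideanLin_MM (Q := Q) (β := β), Run.toEuclideanLin_MM (Q := Q) (β := β),
    inner_add_left, inner_add_right, posSemidef_symm (hrun.D_psd k ω), real_inner_smul_left,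
    real_inner_smul_right, e]

theorem Run.inner_optimality (hrun : R.FollowsUpdates Q β s H) (hH : H.PosDef) {k t : ℕ} {ω : Ω}
    (h1 : 1 ≤ t) (ht : t ≤ R.M k ω) :
    R.d Q k t ω + R.h Q β k ω
      + R.gam k t ω • toEuclideanLin H (R.xbin k (t + 1) ω - R.xbin k t ω)
      + toEuclideanLin (R.MM k ω) (R.xbin k (t + 1) ω - R.x k ω) = 0 := by
  have hG := hasGradientAt_add (hasGradientAt_add
    (hasGradientAt_inner_left (R.d Q k t ω + R.h Q β k ω) (R.xbin k (t + 1) ω))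
    (hasGradientAt_const_mul (R.gam k t ω) (hasGradientAt_quadratic
      (posSemidef_symm hH.posSemidef) (R.xbin k t ω) (R.xbin k (t + 1) ω))))
    (hasGradientAt_quadratic (Run.MM_symm hrun k ω) (R.x k ω) (R.xbin k (t + 1) ω))
  refine hasGradientAt_eq_zero_of_forall_le hG fun u => ?_
  have h := hrun.inner_xb k t ω h1 ht u
  unfold Run.innerObjective normSq mulV at h
  linarith

theorem Run.y_optimality (hrun : R.FollowsUpdates Q β s H) (hβ : 0 < β)
    (hg : Differentiable ℝ Q.g) (k : ℕ) (ω : Ω) :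
    gradient Q.g (R.y (k + 1) ω) = toEuclideanLin Q.Bᵀ
      (R.lam k ω - β • Q.residual (R.x (k + 1) ω) (R.y (k + 1) ω)) := by
  have hG := hasGradientAt_add (hg (R.y (k + 1) ω)).hasGradientAt
    (hasGradientAt_const_mul β (hasGradientAt_half_norm_sq (inner_toEuclideanLin_transpose Q.B)
      (mulV Q.A (R.x (k + 1) ω) - Q.b - (1 / β) • R.lam k ω) (R.y (k + 1) ω)))
  have h0 := hasGradientAt_eq_zero_of_forall_le hG (fun v => by
    have h := hrun.y_step k ω v
    unfold Run.yObjective at h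
    have e : ∀ v, mulV Q.A (R.x (k + 1) ω) + mulV Q.B v - Q.b - (1 / β) • R.lam k ω
        = toEuclideanLin Q.B v + (mulV Q.A (R.x (k + 1) ω) - Q.b - (1 / β) • R.lam k ω) := by
      intro v; unfold mulV; abel
    rw [e, e] at h
    linarith)
  rw [← map_smul, add_eq_zero_iff_eq_neg, ← map_neg] at h0
  rw [h0]
  congr 1
  unfold Problem.residual mulV
  have : β • (1 / β) • R.lam k ω = R.lam k ω := by
    rw [smul_smul, mul_one_div_cancel hβ.ne', one_smul]
  rw [smul_add, smul_sub, smul_sub, this, smul_sub, smul_add]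
  abel

end RunFacts

end ASADMM

/-! ### The outer estimates along a run. -/

namespace ASADMM

open scoped RealInnerProductSpace
open Matrix

section Smooth

variable {n : ℕ} {φ : Vec n → ℝ} {α ν : ℝ}

theorem StronglyConvexSmooth.hasGradientAt (h : StronglyConvexSmooth φ α ν) (x : Vec n) :
    HasGradientAt φ (gradient φ x) x := (h.differentiable x).hasGradientAt

theorem StronglyConvexSmooth.inner_gradient_le (h : StronglyConvexSmooth φ α ν) (hα : 0 < α)
    (x y : Vec n) : φ x + ⟪gradient φ x, y - x⟫ ≤ φ y := by
  have h1 := strongConvexOn_inner_gradient_le h.strongConvex (h.hasGradientAt x) y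
  have : 0 ≤ α / 2 * ‖y - x‖ ^ 2 := by positivity
  linarith

theorem StronglyConvexSmooth.le_inner_sub (h : StronglyConvexSmooth φ α ν) (x y : Vec n) :
    α * ‖y - x‖ ^ 2 ≤ ⟪gradient φ y - gradient φ x, y - x⟫ :=
  strongConvexOn_le_inner_sub h.strongConvex (h.hasGradientAt x) (h.hasGradientAt y)

end Smooth

/-- The deterministic assumptions on a run and its comparison points. -/
structure Standing {n₁ n₂ n N : ℕ} {Ω : Type*} (Q : Problem n₁ n₂ n N) (R : Run n₁ n₂ n N Ω)
    (β s ν α c₁ c₂ : ℝ) (H : Matrix (Fin n₁) (Fin n₁) ℝ) (xs : Vec n₁) (ys : Vec n₂)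
    (lbar : ℕ → Ω → Vec n) : Prop where
  β_pos : 0 < β
  s_pos : 0 < s
  golden : (1 - s) ^ 2 < 2 - s
  ν_pos : 0 < ν
  α_pos : 0 < α
  c₁_pos : 0 < c₁
  c₂_pos : 0 < c₂
  posDef : H.PosDef
  run : R.FollowsUpdates Q β s H
  f_smooth : StronglyConvexSmooth Q.f α ν
  g_smooth : StronglyConvexSmooth Q.g α ν
  bounds : R.ProximalBounds Q β c₁ c₂
  proj : ∀ k ω, IsProjection (Q.multipliers xs ys) (R.lam k ω) (lbar k ω)

/-- `z` solves the `x`-subproblem of outer iteration `k` exactly. -/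
def IsSubsolution {n₁ n₂ n N : ℕ} {Ω : Type*} (Q : Problem n₁ n₂ n N) (R : Run n₁ n₂ n N Ω)
    (β : ℝ) (k : ℕ) (ω : Ω) (z : Vec n₁) : Prop :=
  gradient Q.f z + R.h Q β k ω + toEuclideanLin (R.MM k ω) (z - R.x k ω) = 0

/-- The Lyapunov function along a run. -/
noncomputable def potential {n₁ n₂ n N : ℕ} {Ω : Type*} (Q : Problem n₁ n₂ n N)
    (R : Run n₁ n₂ n N Ω) (β s : ℝ) (xs : Vec n₁) (ys : Vec n₂) (lbar : ℕ → Ω → Vec n) (k : ℕ)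
    (ω : Ω) : ℝ :=
  lyapunov (toEuclideanLin Q.A) (toEuclideanLin Q.B) β s (toEuclideanLin (R.D Q β k ω))
    (R.x k ω - xs) (R.y k ω - ys) (R.lam k ω - lbar k ω)

namespace Standing

variable {n₁ n₂ n N : ℕ} {Ω : Type*} {Q : Problem n₁ n₂ n N} {R : Run n₁ n₂ n N Ω}
  {β s ν α c₁ c₂ : ℝ} {H : Matrix (Fin n₁) (Fin n₁) ℝ} {xs : Vec n₁} {ys : Vec n₂}
  {lbar : ℕ → Ω → Vec n}

theorem D_lower (S : Standing Q R β s ν α c₁ c₂ H xs ys lbar) (k : ℕ) (ω : Ω) (x : Vec n₁) :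
    c₁ * ‖x‖ ^ 2 ≤ ⟪x, toEuclideanLin (R.D Q β k ω) x⟫ := by
  have h1 := posSemidef_inner_nonneg (S.bounds k ω).1 x
  have h2 := posSemidef_inner_nonneg (S.bounds k ω).2.1 x
  rw [map_sub, LinearMap.sub_apply, inner_sub_right] at h1 h2
  rw [inner_toEuclideanLin_smul_one] at h1
  linarith

theorem D_upper (S : Standing Q R β s ν α c₁ c₂ H xs ys lbar) (k : ℕ) (ω : Ω) (x : Vec n₁) :
    ⟪x, toEuclideanLin (R.D Q β k ω) x⟫ ≤ c₂ * ‖x‖ ^ 2 := by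
  have h1 := posSemidef_inner_nonneg (S.bounds k ω).2.2 x
  rw [map_sub, LinearMap.sub_apply, inner_sub_right, inner_toEuclideanLin_smul_one] at h1
  linarith

theorem D_antitone (S : Standing Q R β s ν α c₁ c₂ H xs ys lbar) (k : ℕ) (ω : Ω) (x : Vec n₁) :
    ⟪x, toEuclideanLin (R.D Q β (k + 1) ω) x⟫ ≤ ⟪x, toEuclideanLin (R.D Q β k ω) x⟫ := by
  have h2 := posSemidef_inner_nonneg (S.bounds k ω).2.1 x
  rw [map_sub, LinearMap.sub_apply, inner_sub_right] at h2
  linarith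

theorem MM_lower (S : Standing Q R β s ν α c₁ c₂ H xs ys lbar) (k : ℕ) (ω : Ω) (x : Vec n₁) :
    c₁ * ‖x‖ ^ 2 ≤ ⟪x, toEuclideanLin (R.MM k ω) x⟫ := by
  have h1 := S.D_lower k ω x
  rw [Run.toEuclideanLin_MM (Q := Q) (β := β), inner_add_right, real_inner_smul_right,
    real_inner_comm (toEuclideanLin Q.Aᵀ _), inner_toEuclideanLin_transpose,
    real_inner_self_eq_norm_sq]
  have := S.β_pos
  have : 0 ≤ β * ‖toEuclideanLin Q.A x‖ ^ 2 := by positivity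
  linarith

theorem mem_primalDual (S : Standing Q R β s ν α c₁ c₂ H xs ys lbar) (k : ℕ) (ω : Ω) :
    (xs, ys, lbar k ω) ∈ Q.primalDual := (S.proj k ω).1

/-- The sample point serves only to provide a multiplier. -/
theorem residual_star (S : Standing Q R β s ν α c₁ c₂ H xs ys lbar) (ω : Ω) :
    Q.residual xs ys = 0 :=
  Problem.residual_eq_zero (w := (xs, ys, lbar 0 ω)) (S.mem_primalDual 0 ω)

theorem residual_eq (S : Standing Q R β s ν α c₁ c₂ H xs ys lbar) (ω : Ω) (x : Vec n₁)
    (y : Vec n₂) : Q.residual x y = toEuclideanLin Q.A (x - xs) + toEuclideanLin Q.B (y - ys) := by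
  have h := S.residual_star ω
  rw [← sub_zero (Q.residual x y), ← h, map_sub, map_sub]
  unfold Problem.residual mulV
  abel

theorem gradient_f_star (S : Standing Q R β s ν α c₁ c₂ H xs ys lbar) (k : ℕ) (ω : Ω) :
    gradient Q.f xs = toEuclideanLin Q.Aᵀ (lbar k ω) :=
  (Q.gradient_eq_of_primalDual (S.proj k ω).1 (S.f_smooth.hasGradientAt _)
    (S.g_smooth.hasGradientAt _)).1

theorem gradient_g_star (S : Standing Q R β s ν α c₁ c₂ H xs ys lbar) (k : ℕ) (ω : Ω) :
    gradient Q.g ys = toEuclideanLin Q.Bᵀ (lbar k ω) :=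
  (Q.gradient_eq_of_primalDual (S.proj k ω).1 (S.f_smooth.hasGradientAt _)
    (S.g_smooth.hasGradientAt _)).2

theorem exists_subsolution (S : Standing Q R β s ν α c₁ c₂ H xs ys lbar) (k : ℕ) (ω : Ω) :
    ∃ z, IsSubsolution Q R β k ω z :=
  exists_gradient_add_eq_zero S.f_smooth.hasGradientAt
    (S.f_smooth.inner_gradient_le S.α_pos) (Run.MM_symm S.run k ω) S.c₁_pos (S.MM_lower k ω) _ _

theorem h_eq (S : Standing Q R β s ν α c₁ c₂ H xs ys lbar) (k : ℕ) (ω : Ω) :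
    gradient Q.f xs + R.h Q β k ω = -toEuclideanLin Q.Aᵀ (R.lam k ω - lbar k ω
      - β • (toEuclideanLin Q.A (R.x k ω - xs) + toEuclideanLin Q.B (R.y k ω - ys))) := by
  rw [← S.residual_eq ω, S.gradient_f_star k ω]
  unfold Run.h mulV
  rw [← sub_eq_add_neg, ← map_sub, ← map_neg]
  congr 1
  abel

/-- Replacing `D_k` by the smaller `D_{k+1}`, and `λ̄^k` by the nearest multiplier `λ̄^{k+1}`, can
only decrease the Lyapunov function. -/
theorem potential_succ_le (S : Standing Q R β s ν α c₁ c₂ H xs ys lbar) (k : ℕ) (ω : Ω) :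
    potential Q R β s xs ys lbar (k + 1) ω ≤ lyapunov (toEuclideanLin Q.A) (toEuclideanLin Q.B) β s
      (toEuclideanLin (R.D Q β k ω)) (R.x (k + 1) ω - xs) (R.y (k + 1) ω - ys)
      (R.lam k ω - lbar k ω - (s * β) • (toEuclideanLin Q.A (R.x (k + 1) ω - xs)
        + toEuclideanLin Q.B (R.y (k + 1) ω - ys))) := by
  have h1 := S.D_antitone k ω (R.x (k + 1) ω - xs)
  have h2 := (S.proj (k + 1) ω).2 _ (S.proj k ω).1
  have e : R.lam (k + 1) ω - lbar k ω = R.lam k ω - lbar k ω - (s * β) •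
      (toEuclideanLin Q.A (R.x (k + 1) ω - xs) + toEuclideanLin Q.B (R.y (k + 1) ω - ys)) := by
    rw [S.run.lam_step, S.residual_eq ω]
    abel
  rw [e] at h2
  have := S.β_pos
  have := S.s_pos
  unfold potential lyapunov
  gcongr

theorem gradient_g_succ (S : Standing Q R β s ν α c₁ c₂ H xs ys lbar) (k : ℕ) (ω : Ω) :
    gradient Q.g (R.y (k + 1) ω) - gradient Q.g ys = toEuclideanLin Q.Bᵀ (R.lam k ω - lbar k ω
      - β • (toEuclideanLin Q.A (R.x (k + 1) ω - xs)
        + toEuclideanLin Q.B (R.y (k + 1) ω - ys))) := by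
  rw [Run.y_optimality S.run S.β_pos S.g_smooth.differentiable, S.gradient_g_star k ω, ← map_sub,
    S.residual_eq ω]
  congr 1
  abel

theorem exists_mulV_bound (Q : Problem n₁ n₂ n N) : ∃ a : ℝ, 0 < a ∧
    (∀ x, ‖toEuclideanLin Q.A x‖ ≤ a * ‖x‖) ∧ (∀ l, ‖toEuclideanLin Q.Aᵀ l‖ ≤ a * ‖l‖) ∧
    (∀ y, ‖toEuclideanLin Q.B y‖ ≤ a * ‖y‖) ∧ ∀ l, ‖toEuclideanLin Q.Bᵀ l‖ ≤ a * ‖l‖ := by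
  obtain ⟨a₁, h₁, b₁⟩ := exists_norm_toEuclideanLin_le Q.A
  obtain ⟨a₂, h₂, b₂⟩ := exists_norm_toEuclideanLin_le Q.Aᵀ
  obtain ⟨a₃, h₃, b₃⟩ := exists_norm_toEuclideanLin_le Q.B
  obtain ⟨a₄, h₄, b₄⟩ := exists_norm_toEuclideanLin_le Q.Bᵀ
  refine ⟨a₁ + a₂ + a₃ + a₄, by positivity, fun x => (b₁ x).trans ?_, fun x => (b₂ x).trans ?_,
    fun x => (b₃ x).trans ?_, fun x => (b₄ x).trans ?_⟩ <;> gcongr <;> linarith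

/-- The descent needs optimality of the current `y`, which holds from outer iteration 1 onwards;
hence the index `k + 1`. -/
theorem potential_contraction (S : Standing Q R β s ν α c₁ c₂ H xs ys lbar) :
    ∃ q K : ℝ, 0 < q ∧ q < 1 ∧ 0 < K ∧ ∀ k ω z, IsSubsolution Q R β (k + 1) ω z →
      potential Q R β s xs ys lbar (k + 2) ω ≤ q * potential Q R β s xs ys lbar (k + 1) ω
        + K * ‖R.x (k + 2) ω - z‖ ^ 2 := by
  obtain ⟨a, ha, hA, hAt, hB, hBt⟩ := exists_mulV_bound Q
  obtain ⟨κ, hκ, hHof⟩ := exists_norm_sq_le_of_orthogonal (toEuclideanLin Q.Aᵀ)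
    (toEuclideanLin Q.Bᵀ)
  have hβ := S.β_pos
  have hc₂ := S.c₂_pos
  have hν := S.ν_pos
  obtain ⟨q, K, hq0, hq1, hK, hmain⟩ := lyapunov_contraction (inner_toEuclideanLin_transpose Q.A)
    (inner_toEuclideanLin_transpose Q.B) S.β_pos S.s_pos S.golden S.α_pos S.ν_pos S.c₁_pos
    S.c₂_pos ha hκ hA hAt hBt
  refine ⟨q, K * (ν + c₂ + β * a ^ 2) ^ 2, hq0, hq1, by positivity, ?_⟩
  intro k ω z hz
  refine (S.potential_succ_le (k + 1) ω).trans ?_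
  have hsymD := posSemidef_symm (S.run.D_psd (k + 1) ω)
  -- The residual of the exact optimality condition at `x^{k+2}`; subtracting the condition at `z`
  -- makes it Lipschitz in `x^{k+2} - z`.
  obtain ⟨r, hr⟩ : ∃ r, r = gradient Q.f (R.x (k + 2) ω) - gradient Q.f z
    + toEuclideanLin (R.MM (k + 1) ω) (R.x (k + 2) ω - z) := ⟨_, rfl⟩
  have hrn : ‖r‖ ≤ (ν + c₂ + β * a ^ 2) * ‖R.x (k + 2) ω - z‖ := by
    have g1 := S.f_smooth.lipschitz (R.x (k + 2) ω) z
    have g2 := norm_map_le_of_form_le hsymD S.c₂_pos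
      (posSemidef_inner_nonneg (S.run.D_psd (k + 1) ω)) (S.D_upper (k + 1) ω) (R.x (k + 2) ω - z)
    have g3 : ‖β • toEuclideanLin Q.Aᵀ (toEuclideanLin Q.A (R.x (k + 2) ω - z))‖
        ≤ β * (a * (a * ‖R.x (k + 2) ω - z‖)) := by
      rw [norm_smul, Real.norm_of_nonneg hβ.le]
      gcongr
      exact (hAt _).trans (by gcongr; exact hA _)
    rw [hr, Run.toEuclideanLin_MM (Q := Q) (β := β), ← add_assoc]
    have g4 := norm_add₃_le (a := gradient Q.f (R.x (k + 2) ω) - gradient Q.f z)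
      (b := toEuclideanLin (R.D Q β (k + 1) ω) (R.x (k + 2) ω - z))
      (c := β • toEuclideanLin Q.Aᵀ (toEuclideanLin Q.A (R.x (k + 2) ω - z)))
    linarith
  have hr2 : K * ‖r‖ ^ 2 ≤ K * (ν + c₂ + β * a ^ 2) ^ 2 * ‖R.x (k + 2) ω - z‖ ^ 2 := by
    rw [mul_assoc, ← mul_pow]; gcongr
  refine le_trans ?_ (add_le_add_right hr2 _)
  refine hmain _ hsymD (S.D_lower (k + 1) ω) (S.D_upper (k + 1) ω) _ _
    (gradient Q.f (R.x (k + 2) ω) - gradient Q.f xs) r _ _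
    (gradient Q.g (R.y (k + 1) ω) - gradient Q.g ys)
    (gradient Q.g (R.y (k + 2) ω) - gradient Q.g ys) _ ?_ (S.gradient_g_succ (k + 1) ω) ?_
    (S.f_smooth.le_inner_sub _ _) (S.g_smooth.le_inner_sub _ _) ?_ (S.f_smooth.lipschitz _ _)
    (S.g_smooth.lipschitz _ _) ?_
  · have h1 := S.h_eq (k + 1) ω
    have h2 : toEuclideanLin (R.MM (k + 1) ω) (R.x (k + 2) ω - z)
        = toEuclideanLin (R.MM (k + 1) ω) (R.x (k + 2) ω - R.x (k + 1) ω)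
          - toEuclideanLin (R.MM (k + 1) ω) (z - R.x (k + 1) ω) := by
      rw [← map_sub]; congr 1; abel
    have h3 : toEuclideanLin (R.MM (k + 1) ω) (z - R.x (k + 1) ω)
        = -(gradient Q.f z + R.h Q β (k + 1) ω) := by
      unfold IsSubsolution at hz
      rw [← sub_eq_zero, sub_neg_eq_add, add_comm]; exact hz
    rw [hr, h2, h3, Run.toEuclideanLin_MM (Q := Q) (β := β)]
    have h4 : R.h Q β (k + 1) ω = -toEuclideanLin Q.Aᵀ (R.lam (k + 1) ω - lbar (k + 1) ω
      - β • (toEuclideanLin Q.A (R.x (k + 1) ω - xs) + toEuclideanLin Q.B (R.y (k + 1) ω - ys)))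
      - gradient Q.f xs := by rw [← h1]; abel
    rw [h4]
    simp only [sub_sub_sub_cancel_right, map_sub, map_add, map_smul, smul_sub, smul_add]
    abel
  · have h1 := S.gradient_g_succ k ω
    rw [h1]
    have h2 := S.run.lam_step k ω
    rw [S.residual_eq ω] at h2
    have h3 : R.lam k ω - lbar k ω = R.lam (k + 1) ω - lbar k ω + (s * β) •
      (toEuclideanLin Q.A (R.x (k + 1) ω - xs) + toEuclideanLin Q.B (R.y (k + 1) ω - ys)) := by
      rw [h2]; abel
    -- All multipliers have the same image under `Bᵀ`, namely the gradient of `g` at `ys`, so a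
    -- change of projection does no harm.
    have h4 : toEuclideanLin Q.Bᵀ (lbar k ω) = toEuclideanLin Q.Bᵀ (lbar (k + 1) ω) := by
      rw [← S.gradient_g_star, ← S.gradient_g_star]
    rw [h3]
    generalize (toEuclideanLin Q.A (R.x (k + 1) ω - xs) + toEuclideanLin Q.B (R.y (k + 1) ω - ys))
      = p
    have e1 : R.lam (k + 1) ω - lbar k ω + (s * β) • p - β • p
      = R.lam (k + 1) ω - lbar k ω + ((s - 1) * β) • p := by module
    rw [e1, map_add, map_add, map_sub, map_sub, h4]
  · rw [sub_sub_sub_cancel_right, sub_sub_sub_cancel_right]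
    have hα := S.α_pos
    exact le_trans (by positivity) (S.g_smooth.le_inner_sub (R.y (k + 1) ω) (R.y (k + 2) ω))
  · exact hHof _ fun v hv1 hv2 => Q.inner_sub_projection_eq_zero (S.proj (k + 1) ω) hv1 hv2

theorem potential_growth (S : Standing Q R β s ν α c₁ c₂ H xs ys lbar) :
    ∃ K : ℝ, 0 < K ∧ ∀ k ω,
      ‖R.y (k + 1) ω - ys‖ ^ 2
        ≤ K * (potential Q R β s xs ys lbar k ω + ‖R.x (k + 1) ω - xs‖ ^ 2) ∧
      potential Q R β s xs ys lbar (k + 1) ω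
        ≤ K * (potential Q R β s xs ys lbar k ω + ‖R.x (k + 1) ω - xs‖ ^ 2) := by
  obtain ⟨a, ha, hA, hAt, hB, hBt⟩ := exists_mulV_bound Q
  obtain ⟨K, hK, hmain⟩ := lyapunov_growth (inner_toEuclideanLin_transpose Q.B) S.β_pos S.s_pos
    S.golden S.α_pos S.c₁_pos S.c₂_pos ha hA hB
  refine ⟨K, hK, fun k ω => ?_⟩
  have h := hmain _ (S.D_lower k ω) (S.D_upper k ω) (R.x k ω - xs) _ (R.y k ω - ys) _ _ _
    (S.gradient_g_succ k ω) (S.g_smooth.le_inner_sub ys (R.y (k + 1) ω))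
  exact ⟨h.1, (S.potential_succ_le k ω).trans h.2⟩

theorem subsolution_error (S : Standing Q R β s ν α c₁ c₂ H xs ys lbar) :
    ∃ K : ℝ, 0 < K ∧ ∀ k ω z, IsSubsolution Q R β k ω z →
      ‖z - xs‖ ^ 2 ≤ K * potential Q R β s xs ys lbar k ω := by
  obtain ⟨a, ha, hA, hAt, hB, hBt⟩ := exists_mulV_bound Q
  obtain ⟨K, hK, hmain⟩ := subproblem_error (E₂ := Vec n₂) (B := toEuclideanLin Q.B)
    (inner_toEuclideanLin_transpose Q.A)
    S.β_pos S.s_pos S.golden S.c₁_pos S.c₂_pos ha hA hAt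
  refine ⟨K, hK, fun k ω z hz => ?_⟩
  refine hmain _ (posSemidef_symm (S.run.D_psd k ω)) (S.D_lower k ω) (S.D_upper k ω)
    (R.x k ω - xs) (z - xs) (gradient Q.f z - gradient Q.f xs) (R.y k ω - ys)
    (R.lam k ω - lbar k ω) ?_ ?_
  · unfold IsSubsolution at hz
    rw [Run.toEuclideanLin_MM (Q := Q) (β := β)] at hz
    rw [sub_sub_sub_cancel_right, ← hz, sub_eq_add_neg _ (toEuclideanLin Q.Aᵀ _), ← S.h_eq]
    abel
  · have hα := S.α_pos
    exact le_trans (by positivity) (S.f_smooth.le_inner_sub xs z)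

theorem potential_bounds (S : Standing Q R β s ν α c₁ c₂ H xs ys lbar) (k : ℕ) (ω : Ω) :
    0 ≤ potential Q R β s xs ys lbar k ω ∧
    ‖R.lam k ω - lbar k ω‖ ^ 2 ≤ s * β * potential Q R β s xs ys lbar k ω ∧
    ‖R.x k ω - xs‖ ^ 2 ≤ c₁⁻¹ * potential Q R β s xs ys lbar k ω := by
  have h := lyapunov_bounds (A := toEuclideanLin Q.A) (B := toEuclideanLin Q.B) S.β_pos S.s_pos
    S.golden S.c₁_pos (S.D_lower k ω) (R.x k ω - xs) (R.y k ω - ys) (R.lam k ω - lbar k ω)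
  exact ⟨h.1, h.2.1, h.2.2.1⟩

end Standing

end ASADMM

namespace ASADMM

open scoped RealInnerProductSpace
open Matrix

/-! ### Growth of the iteration counts and the inner error along a run. -/

section Growth

variable {n₁ n₂ n N : ℕ} {Ω : Type*} {Q : Problem n₁ n₂ n N} {R : Run n₁ n₂ n N Ω}
  {β s : ℝ} {H : Matrix (Fin n₁) (Fin n₁) ℝ} {θ : ℝ}

theorem Run.GeometricGrowth.sq_pow_le_M (hM : R.GeometricGrowth θ)
    (hrun : R.FollowsUpdates Q β s H) (hθ : 0 < θ) (ω : Ω) :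
    ∀ k, ((1 + θ) ^ k) ^ 2 ≤ (R.M k ω : ℝ)
  | 0 => by
    have : 1 ≤ R.M 0 ω := hrun.M_pos 0 ω
    simpa using this
  | k + 1 => by
    have ih := Run.GeometricGrowth.sq_pow_le_M hM hrun hθ ω k
    rw [hM.1 k ω]
    refine le_trans ?_ (Nat.le_ceil _)
    calc ((1 + θ) ^ (k + 1)) ^ 2 = (1 + θ) ^ 2 * ((1 + θ) ^ k) ^ 2 * 1 := by ring
      _ ≤ (1 + θ) ^ 2 * (R.M k ω : ℝ) * (‖R.xb (k + 1) ω‖ ^ 2 + 1) := by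
        gcongr; nlinarith [sq_nonneg ‖R.xb (k + 1) ω‖]

/-- The factor `‖x̆^k‖² + 1` in the growth rule pays for the unbounded starting point of the inner
loop; the constant covers `k = 0`. -/
theorem Run.GeometricGrowth.exists_xb_bound (hM : R.GeometricGrowth θ)
    (hrun : R.FollowsUpdates Q β s H) (hθ : 0 < θ) : ∃ C : ℝ, 0 < C ∧ ∀ k ω,
      ((1 + θ) ^ k) ^ 2 * ‖R.xb k ω‖ ^ 2 ≤ C * (R.M k ω : ℝ) := by
  obtain ⟨x₀, y₀, l₀, h0⟩ := hrun.init
  refine ⟨1 + ‖x₀‖ ^ 2, by positivity, fun k ω => ?_⟩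
  have hMk : (1 : ℝ) ≤ R.M k ω := by exact_mod_cast hrun.M_pos k ω
  cases k with
  | zero =>
    rw [(h0 ω).2.1]
    nlinarith [sq_nonneg ‖x₀‖]
  | succ k =>
    have h1 := hM.sq_pow_le_M hrun hθ ω k
    have h2 : (1 + θ) ^ 2 * (R.M k ω : ℝ) * (‖R.xb (k + 1) ω‖ ^ 2 + 1) ≤ R.M (k + 1) ω := by
      rw [hM.1 k ω]; exact Nat.le_ceil _
    calc ((1 + θ) ^ (k + 1)) ^ 2 * ‖R.xb (k + 1) ω‖ ^ 2
        = (1 + θ) ^ 2 * ((1 + θ) ^ k) ^ 2 * ‖R.xb (k + 1) ω‖ ^ 2 := by ring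
      _ ≤ (1 + θ) ^ 2 * (R.M k ω : ℝ) * (‖R.xb (k + 1) ω‖ ^ 2 + 1) := by gcongr; linarith
      _ ≤ R.M (k + 1) ω := h2
      _ ≤ _ := by nlinarith [sq_nonneg ‖x₀‖]

end Growth

/-- A bound for the effect of the noise in outer iteration `k`. -/
noncomputable def noiseTerm {n₁ n₂ n N : ℕ} {Ω : Type*} (Q : Problem n₁ n₂ n N)
    (R : Run n₁ n₂ n N Ω) (c μ : ℝ) (k : ℕ) (ω : Ω) : ℝ :=
  noiseSum (R.eta k ω) c μ (fun j => R.delta Q k (j + 1) ω) (R.M k ω)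
    + (∑ j ∈ Finset.range (R.M k ω), ‖R.delta Q k (j + 1) ω‖ ^ 2) / (R.M k ω : ℝ) ^ 2

theorem noiseSum_nonneg {E : Type*} [NormedAddCommGroup E] [InnerProductSpace ℝ E] {η c μ : ℝ}
    (hη : 0 < η) (hc : 0 < c) (hμ : 0 < μ) (δ : ℕ → E) (M : ℕ) : 0 ≤ noiseSum η c μ δ M := by
  have h := noiseMajorant_nonneg hη hc hμ (weightedSum δ)
  refine add_nonneg (div_nonneg (Finset.sum_nonneg fun i _ => ?_) (by positivity))
    (div_nonneg (h M) (by positivity))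
  exact div_nonneg (add_nonneg (h _) (h _)) (by positivity)

namespace Standing

variable {n₁ n₂ n N : ℕ} {Ω : Type*} {Q : Problem n₁ n₂ n N} {R : Run n₁ n₂ n N Ω}
  {β s ν α c₁ c₂ : ℝ} {H : Matrix (Fin n₁) (Fin n₁) ℝ} {xs : Vec n₁} {ys : Vec n₂}
  {lbar : ℕ → Ω → Vec n}

-- If the stepsize is small enough, the accelerated rate applies, and `1 / (η M²)` equals `g / M`
-- with `g = (1 + θ)^k`, which the growth rule bounds. Otherwise both `g` and `M` are bounded by the
-- constant `L`, and the crude estimate suffices.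
set_option maxHeartbeats 1600000 in
theorem inner_error (S : Standing Q R β s ν α c₁ c₂ H xs ys lbar) {θ : ℝ} (hθ : 0 < θ)
    (hM : R.GeometricGrowth θ) {h₁ h₂ : ℝ} (hh₁ : 0 < h₁) (hh₂ : 0 < h₂)
    (hHl : ∀ x, h₁ * ‖x‖ ^ 2 ≤ ⟪x, toEuclideanLin H x⟫)
    (hHu : ∀ x, ⟪x, toEuclideanLin H x⟫ ≤ h₂ * ‖x‖ ^ 2) :
    ∃ K : ℝ, 0 < K ∧ ∀ k ω z, IsSubsolution Q R β k ω z → ‖R.x (k + 1) ω - z‖ ^ 2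
      ≤ K * (((1 + θ) ^ k)⁻¹ * (1 + potential Q R β s xs ys lbar k ω)
        + noiseTerm Q R c₁ (c₁ / h₂) k ω) := by
  obtain ⟨C, hC, hxb⟩ := hM.exists_xb_bound S.run hθ
  obtain ⟨K₃, hK₃, hz3⟩ := S.subsolution_error
  have hc₁ := S.c₁_pos
  have hν := S.ν_pos
  obtain ⟨Cz, hCz⟩ : ∃ c, c = 2 * ‖xs‖ ^ 2 + 2 * K₃ := ⟨_, rfl⟩
  have hCz0 : 0 < Cz := by rw [hCz]; positivity
  obtain ⟨b, hb⟩ : ∃ b, b = 1 + 2 * (h₂ + 2 / c₁ + 2 * ν ^ 2 / c₁) / h₁ := ⟨_, rfl⟩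
  have hb1 : 1 ≤ b := by rw [hb]; exact le_add_of_nonneg_right (by positivity)
  obtain ⟨L, hL⟩ : ∃ L, L = 2 * ν / h₁ := ⟨_, rfl⟩
  have hL0 : 0 < L := by rw [hL]; positivity
  obtain ⟨a₁, ha₁⟩ : ∃ a, a = 8 * h₂ / c₁ * (2 * C + 2 * Cz) := ⟨_, rfl⟩
  obtain ⟨a₂, ha₂⟩ : ∃ a, a = 256 * ν ^ 2 / (c₁ ^ 2 * h₁) + 8 / h₁ := ⟨_, rfl⟩
  obtain ⟨a₃, ha₃⟩ : ∃ a, a = b ^ ⌈L⌉₊ * (2 * (C * L) + 2 * Cz + 2 * c₁⁻¹ + 2 * K₃) * L := ⟨_, rfl⟩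
  obtain ⟨a₄, ha₄⟩ : ∃ a, a = b ^ ⌈L⌉₊ * L ^ 2 := ⟨_, rfl⟩
  have hb0 : 0 < b := by linarith
  have ha₁0 : 0 < a₁ := by rw [ha₁]; positivity
  have ha₂0 : 0 < a₂ := by rw [ha₂]; positivity
  have ha₃0 : 0 < a₃ := by rw [ha₃]; positivity
  have ha₄0 : 0 < a₄ := by rw [ha₄]; positivity
  refine ⟨a₁ + a₂ + a₃ + a₄, by positivity, fun k ω z hz => ?_⟩
  obtain ⟨hV0, -, hVx⟩ := S.potential_bounds k ω
  have hzs := hz3 k ω z hz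
  have hxbk := hxb k ω
  have hMg := hM.sq_pow_le_M S.run hθ ω k
  have hη := S.run.eta_pos k ω
  have hηe := hM.2 k ω
  have hMpos := S.run.M_pos k ω
  obtain ⟨V, hVe⟩ : ∃ V, V = potential Q R β s xs ys lbar k ω := ⟨_, rfl⟩
  rw [← hVe] at hV0 hVx hzs ⊢
  obtain ⟨g, hg⟩ : ∃ g, g = (1 + θ) ^ k := ⟨_, rfl⟩
  have hg1 : 1 ≤ g := by rw [hg]; exact one_le_pow₀ (by linarith)
  rw [← hg] at hxbk hMg hηe ⊢
  have hg0 : 0 < g := by linarith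
  have hns := noiseSum_nonneg hη hc₁ (div_pos hc₁ hh₂) (fun j => R.delta Q k (j + 1) ω) (R.M k ω)
  have hsd : 0 ≤ (∑ j ∈ Finset.range (R.M k ω), ‖R.delta Q k (j + 1) ω‖ ^ 2)
    / (R.M k ω : ℝ) ^ 2 := by positivity
  have hM0 : (0 : ℝ) < R.M k ω := by exact_mod_cast hMpos
  have hM1 : (1 : ℝ) ≤ R.M k ω := by exact_mod_cast hMpos
  have hznorm : ‖z‖ ^ 2 ≤ Cz * (1 + V) := by
    have h1 := norm_add_sq_le_two_mul (z - xs) xs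
    rw [sub_add_cancel] at h1
    have : 0 ≤ ‖xs‖ ^ 2 * V := by positivity
    rw [hCz]
    linarith
  have hxbz := norm_sub_sq_le_two_mul (R.xb k ω) z
  have hstep : ∀ j < R.M k ω, gradient Q.f ((2 / ((j : ℝ) + 2)) • R.xbin k (j + 1) ω
      + (1 - 2 / ((j : ℝ) + 2)) • R.xin k (j + 1) ω) - R.delta Q k (j + 1) ω + R.h Q β k ω
      + (2 / (((j : ℝ) + 1) * R.eta k ω)) • toEuclideanLin H
        (R.xbin k (j + 1 + 1) ω - R.xbin k (j + 1) ω)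
      + toEuclideanLin (R.MM k ω) (R.xbin k (j + 1 + 1) ω - R.x k ω) = 0 := by
    intro j hj
    have h1 := Run.inner_optimality S.run S.posDef (k := k) (ω := ω) (t := j + 1) (by omega) hj
    have e1 : R.d Q k (j + 1) ω = gradient Q.f (R.xhat k (j + 1) ω) - R.delta Q k (j + 1) ω := by
      unfold Run.delta; abel
    have e2 : Run.bt (j + 1) = 2 / ((j : ℝ) + 2) := by
      unfold Run.bt; push_cast; rw [add_assoc, one_add_one_eq_two]
    have e3 : R.gam k (j + 1) ω = 2 / (((j : ℝ) + 1) * R.eta k ω) := by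
      unfold Run.gam; push_cast; rfl
    rw [e1, e3, Run.xhat, e2] at h1
    exact h1
  have hX : ∀ j < R.M k ω, R.xin k (j + 1 + 1) ω = (2 / ((j : ℝ) + 2)) • R.xbin k (j + 1 + 1) ω
      + (1 - 2 / ((j : ℝ) + 2)) • R.xin k (j + 1) ω := by
    intro j hj
    have h1 := S.run.inner_x k (j + 1) ω (by omega) hj
    have e2 : Run.bt (j + 1) = 2 / ((j : ℝ) + 2) := by
      unfold Run.bt; push_cast; rw [add_assoc, one_add_one_eq_two]
    rwa [e2] at h1
  have hstart := S.run.inner_start k ω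
  have hret := (S.run.inner_return k ω).1
  rw [hret]
  unfold noiseTerm
  have hgV : 0 ≤ g⁻¹ * (1 + V) := by positivity
  by_cases hsmall : 2 * ν * R.eta k ω ≤ h₁
  · have hmain := sq_norm_sub_le_of_small_step (S.f_smooth.inner_gradient_le S.α_pos)
      S.f_smooth.lipschitz (posSemidef_symm S.posDef.posSemidef) (Run.MM_symm S.run k ω) hc₁ hh₁ hh₂
      hHl hHu (S.MM_lower k ω) hη hsmall (P := fun j => R.xbin k (j + 1) ω)
      (X := fun j => R.xin k (j + 1) ω) (δ := fun j => R.delta Q k (j + 1) ω) hMpos hstep hX hz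
    simp only [zero_add] at hmain
    rw [hstart.2, ← ha₂] at hmain
    have h1 : 8 * h₂ / (c₁ * R.eta k ω * (R.M k ω : ℝ) ^ 2) * ‖R.xb k ω - z‖ ^ 2
        ≤ a₁ * (g⁻¹ * (1 + V)) := by
      have e : 8 * h₂ / (c₁ * R.eta k ω * (R.M k ω : ℝ) ^ 2) * ‖R.xb k ω - z‖ ^ 2
          = 8 * h₂ / c₁ * (g / R.M k ω * ‖R.xb k ω - z‖ ^ 2) := by
        rw [hηe]; field_simp
      have h2 : g / R.M k ω * ‖R.xb k ω‖ ^ 2 ≤ g⁻¹ * C := by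
        rw [div_mul_eq_mul_div, div_le_iff₀ hM0, mul_assoc, le_inv_mul_iff₀ hg0]
        linarith
      have h3 : g / R.M k ω ≤ g⁻¹ := by
        rw [div_le_iff₀ hM0, le_inv_mul_iff₀ hg0]; linarith
      have h4 : g / R.M k ω * ‖R.xb k ω - z‖ ^ 2 ≤ (2 * C + 2 * Cz) * (g⁻¹ * (1 + V)) := by
        calc g / R.M k ω * ‖R.xb k ω - z‖ ^ 2
            ≤ g / R.M k ω * (2 * ‖R.xb k ω‖ ^ 2 + 2 * ‖z‖ ^ 2) := by gcongr
          _ = 2 * (g / R.M k ω * ‖R.xb k ω‖ ^ 2) + 2 * (g / R.M k ω * ‖z‖ ^ 2) := by ring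
          _ ≤ 2 * (g⁻¹ * C) + 2 * (g⁻¹ * (Cz * (1 + V))) := by gcongr
          _ ≤ _ := by
            have : 0 ≤ g⁻¹ * C * V := by positivity
            linarith
      rw [e, ha₁, mul_assoc]
      gcongr
    refine hmain.trans ?_
    have := mul_nonneg (show 0 ≤ a₁ + a₃ + a₄ by positivity) hns
    have := mul_nonneg (show 0 ≤ a₂ + a₃ + a₄ by positivity) hgV
    have := mul_nonneg (show 0 ≤ a₁ + a₂ + a₃ + a₄ by positivity) hsd
    linarith
  -- Large stepsize: since `η = 1 / (g M)`, the product `g M` is below `L`.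
  · have hlt : g * R.M k ω < L := by
      rw [not_le, hηe] at hsmall
      rw [hL, lt_div_iff₀ hh₁]
      have e : 2 * ν * (g⁻¹ / R.M k ω) = 2 * ν / (g * R.M k ω) := by field_simp
      rw [e, lt_div_iff₀ (by positivity)] at hsmall
      linarith
    have hML : (R.M k ω : ℝ) < L := by nlinarith
    have hgL : g < L := by nlinarith
    have hηM : (R.M k ω : ℝ) * R.eta k ω ≤ 1 := by
      rw [hηe, mul_div_cancel₀ _ hM0.ne']
      exact inv_le_one_of_one_le₀ hg1
    have hmain := sq_norm_sub_le_of_few_steps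
      S.f_smooth.lipschitz (posSemidef_symm S.posDef.posSemidef) hc₁ hh₁ hh₂
      hHl hHu (S.MM_lower k ω) hη (P := fun j => R.xbin k (j + 1) ω)
      (X := fun j => R.xin k (j + 1) ω) (δ := fun j => R.delta Q k (j + 1) ω) hηM hstep hX hz
    simp only [zero_add] at hmain
    rw [hstart.1, hstart.2, ← hb] at hmain
    have hbM : b ^ R.M k ω ≤ b ^ ⌈L⌉₊ := by
      refine pow_le_pow_right₀ hb1 ?_
      have : (R.M k ω : ℝ) ≤ (⌈L⌉₊ : ℝ) := hML.le.trans (Nat.le_ceil L)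
      exact_mod_cast this
    have hxb2 : ‖R.xb k ω‖ ^ 2 ≤ C * L := by
      have h1 : 1 * ‖R.xb k ω‖ ^ 2 ≤ g ^ 2 * ‖R.xb k ω‖ ^ 2 := by
        gcongr; exact one_le_pow₀ hg1
      have : C * (R.M k ω : ℝ) ≤ C * L := by gcongr
      linarith
    have hxz : ‖R.x k ω - z‖ ^ 2 ≤ (2 * c₁⁻¹ + 2 * K₃) * V := by
      have h1 := norm_sub_sq_le_two_mul (R.x k ω - xs) (z - xs)
      rw [sub_sub_sub_cancel_right] at h1
      linarith
    have hinit : ‖R.xb k ω - z‖ ^ 2 + ‖R.x k ω - z‖ ^ 2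
        ≤ (2 * (C * L) + 2 * Cz + 2 * c₁⁻¹ + 2 * K₃) * (1 + V) := by
      have : 0 ≤ C * L * V := by positivity
      have : 0 ≤ c₁⁻¹ := by positivity
      linarith
    -- As `g < L`, constants may be multiplied by `L * g⁻¹`, so this case also fits the decaying
    -- form of the bound.
    have hgLi : 1 ≤ L * g⁻¹ := by
      rw [le_mul_inv_iff₀ hg0]; linarith
    have h1 : b ^ ⌈L⌉₊ * (‖R.xb k ω - z‖ ^ 2 + ‖R.x k ω - z‖ ^ 2) ≤ a₃ * (g⁻¹ * (1 + V)) := by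
      have hc : 0 ≤ (2 * (C * L) + 2 * Cz + 2 * c₁⁻¹ + 2 * K₃) * (1 + V) := by positivity
      calc _ ≤ b ^ ⌈L⌉₊ * ((2 * (C * L) + 2 * Cz + 2 * c₁⁻¹ + 2 * K₃) * (1 + V)) := by gcongr
        _ ≤ b ^ ⌈L⌉₊ * (((2 * (C * L) + 2 * Cz + 2 * c₁⁻¹ + 2 * K₃) * (1 + V)) * (L * g⁻¹)) := by
          exact mul_le_mul_of_nonneg_left (le_mul_of_one_le_right hc hgLi) (by positivity)
        _ = _ := by rw [ha₃]; ring
    have h2 : b ^ ⌈L⌉₊ * ∑ j ∈ Finset.range (R.M k ω), ‖R.delta Q k (j + 1) ω‖ ^ 2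
        ≤ a₄ * ((∑ j ∈ Finset.range (R.M k ω), ‖R.delta Q k (j + 1) ω‖ ^ 2)
          / (R.M k ω : ℝ) ^ 2) := by
      rw [ha₄, mul_assoc]
      refine mul_le_mul_of_nonneg_left ?_ (by positivity)
      rw [mul_div_assoc', le_div_iff₀ (by positivity), mul_comm]
      refine mul_le_mul_of_nonneg_right ?_ (Finset.sum_nonneg fun _ _ => by positivity)
      gcongr
    have h3 : b ^ R.M k ω * (‖R.xb k ω - z‖ ^ 2 + ‖R.x k ω - z‖ ^ 2
        + ∑ j ∈ Finset.range (R.M k ω), ‖R.delta Q k (j + 1) ω‖ ^ 2)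
        ≤ b ^ ⌈L⌉₊ * (‖R.xb k ω - z‖ ^ 2 + ‖R.x k ω - z‖ ^ 2
        + ∑ j ∈ Finset.range (R.M k ω), ‖R.delta Q k (j + 1) ω‖ ^ 2) :=
      mul_le_mul_of_nonneg_right hbM (by positivity)
    refine (hmain.trans h3).trans ?_
    rw [mul_add]
    have := mul_nonneg (show 0 ≤ a₁ + a₂ + a₃ + a₄ by positivity) hns
    have := mul_nonneg (show 0 ≤ a₁ + a₂ + a₄ by positivity) hgV
    have := mul_nonneg (show 0 ≤ a₁ + a₂ + a₃ by positivity) hsd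
    linarith

end Standing

end ASADMM

namespace ASADMM

open scoped RealInnerProductSpace

/-! ### Conditional expectations, and moments of the accumulated noise. -/

section Probability

variable {Ω : Type*} {m mΩ : MeasurableSpace Ω} {P : Measure Ω} [IsProbabilityMeasure P] {n : ℕ}

/-- Sampling uniformly and independently of the past from a centred family gives a centred
variable. -/
theorem condExp_sample_eq_zero {N : ℕ} (hm : m ≤ mΩ) {ξ : Ω → Fin N}
    (hξ : Measurable ξ) (hind : Indep (MeasurableSpace.comap ξ ⊤) m P)
    (hunif : ∀ j, P (ξ ⁻¹' {j}) = 1 / (N : ENNReal)) {Y : Fin N → Ω → Vec n}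
    (hY : ∀ j, StronglyMeasurable[m] (Y j)) (hsum : ∀ ω, ∑ j, Y j ω = 0)
    (hint : Integrable (fun ω => Y (ξ ω) ω) P) :
    P[fun ω => Y (ξ ω) ω | m] =ᵐ[P] 0 := by
  let I : Fin N → Ω → ℝ := fun j => (ξ ⁻¹' {j}).indicator 1
  have hset : ∀ j, MeasurableSet (ξ ⁻¹' {j}) := fun j => hξ (measurableSet_singleton j)
  have hI : ∀ j, Integrable (I j) P := fun j => (integrable_const (1 : ℝ)).indicator (hset j)
  have hIY : ∀ j, I j • Y j = (ξ ⁻¹' {j}).indicator (fun ω => Y (ξ ω) ω) := by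
    intro j
    funext ω
    by_cases h : ξ ω = j
    · simp [I, h]
    · simp [I, h]
  have hdec : (fun ω => Y (ξ ω) ω) = ∑ j, I j • Y j := by
    funext ω
    rw [Finset.sum_apply, Finset.sum_eq_single (ξ ω)]
    · simp [I]
    · intro j _ hj; simp [I, hj.symm]
    · simp
  have hIYint : ∀ j, Integrable (I j • Y j) P := fun j => by
    rw [hIY]; exact hint.indicator (hset j)
  -- The factor `Y j` is known to the past and comes out; the event that `j` is drawn is independent
  -- of the past and has probability `1 / N`.
  have hcond : ∀ j, P[I j • Y j | m] =ᵐ[P] fun ω => (1 / (N : ℝ)) • Y j ω := by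
    intro j
    have h1 := condExp_smul_of_aestronglyMeasurable_right (hI j) (hIYint j)
      (hY j).aestronglyMeasurable
    have hIm : StronglyMeasurable[MeasurableSpace.comap ξ ⊤] (I j) := by
      refine Measurable.stronglyMeasurable ?_
      exact Measurable.indicator measurable_const ⟨{j}, trivial, rfl⟩
    have h2 := condExp_indep_eq (μ := P) (hξ.comap_le) hm hIm hind
    have h3 : P[I j] = 1 / (N : ℝ) := by
      simp only [I]
      rw [integral_indicator_one (hset j), measureReal_def, hunif j]
      simp
    filter_upwards [h1, h2] with ω h1 h2
    rw [h1, Pi.smul_apply', h2, h3]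
  rw [hdec]
  refine (condExp_finsetSum (fun j _ => hIYint j) m).trans ?_
  have hall : ∀ᵐ ω ∂P, ∀ j, (P[I j • Y j | m]) ω = (1 / (N : ℝ)) • Y j ω := ae_all_iff.2 hcond
  filter_upwards [hall] with ω hω
  rw [Finset.sum_apply, Finset.sum_congr rfl (fun j _ => hω j), ← Finset.smul_sum, hsum, smul_zero]
  rfl

theorem integral_inner_eq_zero_of_condExp (hm : m ≤ mΩ)
    {X D : Ω → Vec n} (hXm : StronglyMeasurable[m] X) (hX : MemLp X 2 P) (hD : MemLp D 2 P)
    (h0 : P[D | m] =ᵐ[P] 0) : Integrable (fun ω => ⟪X ω, D ω⟫) P ∧ ∫ ω, ⟪X ω, D ω⟫ ∂P = 0 := by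
  have hint : Integrable (fun ω => ⟪X ω, D ω⟫) P := by
    refine Integrable.mono' ((hX.norm.integrable_mul hD.norm)) ?_ ?_
    · exact hX.1.inner hD.1
    · exact Filter.Eventually.of_forall fun ω => norm_inner_le_norm (𝕜 := ℝ) (X ω) (D ω)
  refine ⟨hint, ?_⟩
  have h1 := condExp_bilin_of_stronglyMeasurable_left (μ := P) (innerSL ℝ) hXm hint
    (hD.integrable one_le_two)
  have h2 : P[fun ω => ⟪X ω, D ω⟫ | m] =ᵐ[P] fun _ => (0 : ℝ) := by
    refine h1.trans ?_
    filter_upwards [h0] with ω h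
    rw [h]
    simp
  rw [← integral_condExp hm, integral_congr_ae h2, integral_zero]

/-- Orthogonality of the weighted sums of martingale differences. -/
theorem integral_norm_sq_weightedSum {D : ℕ → Ω → Vec n} {𝒢 : ℕ → MeasurableSpace Ω} {m : ℕ}
    (hle : ∀ j, 𝒢 j ≤ mΩ) (hmono : Monotone 𝒢) (hD : ∀ s < m, StronglyMeasurable[𝒢 (s + 1)] (D s))
    (hL : ∀ s < m, MemLp (D s) 2 P) (h0 : ∀ s < m, P[D s | 𝒢 s] =ᵐ[P] 0) :
    ∀ j ≤ m, StronglyMeasurable[𝒢 j] (fun ω => weightedSum (fun s => D s ω) j) ∧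
      MemLp (fun ω => weightedSum (fun s => D s ω) j) 2 P ∧
      ∫ ω, ‖weightedSum (fun s => D s ω) j‖ ^ 2 ∂P
        = ∑ s ∈ Finset.range j, ((s : ℝ) + 1) ^ 2 * ∫ ω, ‖D s ω‖ ^ 2 ∂P := by
  intro j
  induction j with
  | zero =>
    intro _
    have e : (fun ω => weightedSum (fun s => D s ω) 0) = fun _ => (0 : Vec n) := by
      funext ω; simp [weightedSum]
    rw [e]
    refine ⟨stronglyMeasurable_const, MemLp.zero', ?_⟩
    simp [weightedSum]
  | succ j ih =>
    intro hj
    obtain ⟨h1, h2, h3⟩ := ih (by omega)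
    have e : ∀ ω, weightedSum (fun s => D s ω) (j + 1)
        = weightedSum (fun s => D s ω) j + ((j : ℝ) + 1) • D j ω := fun ω => by
      rw [weightedSum, Finset.sum_range_succ, ← weightedSum]
    have hDj := hL j (by omega)
    obtain ⟨hi, hz⟩ := integral_inner_eq_zero_of_condExp (hle j) h1 h2 hDj (h0 j (by omega))
    simp only [e]
    refine ⟨(h1.mono (hmono (Nat.le_succ j))).add ((hD j (by omega)).const_smul ((j : ℝ) + 1) :),
      h2.add (hDj.const_smul ((j : ℝ) + 1) :), ?_⟩
    have e2 : ∀ ω, ‖weightedSum (fun s => D s ω) j + ((j : ℝ) + 1) • D j ω‖ ^ 2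
        = ‖weightedSum (fun s => D s ω) j‖ ^ 2
          + (2 * ((j : ℝ) + 1)) * ⟪weightedSum (fun s => D s ω) j, D j ω⟫
          + ((j : ℝ) + 1) ^ 2 * ‖D j ω‖ ^ 2 := fun ω => by
      rw [norm_add_sq_real, inner_smul_right, norm_smul, mul_pow, Real.norm_eq_abs, sq_abs]
      ring
    have i1 : Integrable (fun ω => ‖weightedSum (fun s => D s ω) j‖ ^ 2) P :=
      h2.integrable_norm_pow (by norm_num)
    have i2 : Integrable (fun ω => ‖D j ω‖ ^ 2) P := hDj.integrable_norm_pow (by norm_num)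
    simp only [e2]
    rw [integral_add (f := fun ω => ‖weightedSum (fun s => D s ω) j‖ ^ 2
        + (2 * ((j : ℝ) + 1)) * ⟪weightedSum (fun s => D s ω) j, D j ω⟫)
        (i1.add (hi.const_mul _)) (i2.const_mul _), integral_add i1 (hi.const_mul _),
      integral_const_mul, integral_const_mul, hz, h3, Finset.sum_range_succ]
    ring

/-- For a constant bound `A`, the value `A / (c * μ)` is a fixed point of the recursion whatever the
coefficient `2 / ((j + 1) η)`; the stepsize therefore drops out. -/
theorem integral_noiseMajorant_le {ρ : Measure Ω} {v : ℕ → Ω → Vec n} {η c μ : ℝ} (hη : 0 < η)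
    (hc : 0 < c) (hμ : 0 < μ) {m : ℕ} (hv : ∀ j ≤ m, MemLp (v j) 2 ρ) {A : ℕ → ℝ} (hA0 : 0 ≤ A 0)
    (hA : ∀ j ≤ m, ∫ ω, ‖v j ω‖ ^ 2 ∂ρ ≤ A j) (hAm : Monotone A) :
    ∀ j ≤ m, Integrable (fun ω => noiseMajorant η c μ (fun i => v i ω) j) ρ ∧
      ∫ ω, noiseMajorant η c μ (fun i => v i ω) j ∂ρ ≤ A j / (c * μ) := by
  intro j
  induction j with
  | zero =>
    intro _
    simp only [noiseMajorant, integral_zero]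
    exact ⟨integrable_zero _ _ _, by positivity⟩
  | succ j ih =>
    intro hj
    obtain ⟨h1, h2⟩ := ih (by omega)
    have i1 : Integrable (fun ω => ‖v (j + 1) ω‖ ^ 2) ρ :=
      (hv (j + 1) hj).integrable_norm_pow (by norm_num)
    simp only [noiseMajorant]
    have hγ : 0 < 2 / (((j : ℝ) + 1) * η) := by positivity
    generalize 2 / (((j : ℝ) + 1) * η) = γ at hγ
    refine ⟨((h1.const_mul _).add (i1.div_const _)).div_const _, ?_⟩
    rw [integral_div, integral_add (h1.const_mul _) (i1.div_const _), integral_const_mul,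
      integral_div, div_le_iff₀ (by positivity)]
    have h3 := hA (j + 1) hj
    have h4 := hAm (Nat.le_succ j)
    have h5 : ∫ ω, noiseMajorant η c μ (fun i => v i ω) j ∂ρ ≤ A (j + 1) / (c * μ) :=
      h2.trans (by gcongr)
    calc γ * ∫ ω, noiseMajorant η c μ (fun i => v i ω) j ∂ρ + (∫ ω, ‖v (j + 1) ω‖ ^ 2 ∂ρ) / c
        ≤ γ * (A (j + 1) / (c * μ)) + A (j + 1) / c := by gcongr
      _ = A (j + 1) / (c * μ) * (γ + μ) := by field_simp

/-- The subtracted last term makes the induction close; for `m = 0` it is a division by zero with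
value zero. Up to a constant, the cubic weights undo the squares in the martingale variance. -/
theorem sum_weighted_le {d : ℕ → ℝ} (hd : ∀ s, 0 ≤ d s) (m : ℕ) :
    ∑ i ∈ Finset.range m, (∑ s ∈ Finset.range (i + 1), ((s : ℝ) + 1) ^ 2 * d s) / ((i : ℝ) + 1) ^ 3
      ≤ 2 * ∑ s ∈ Finset.range m, d s
        - (∑ s ∈ Finset.range m, ((s : ℝ) + 1) ^ 2 * d s) / (m : ℝ) ^ 2 := by
  induction m with
  | zero => simp
  | succ m ih =>
    rw [Finset.sum_range_succ]
    have hA0 : 0 ≤ ∑ s ∈ Finset.range m, ((s : ℝ) + 1) ^ 2 * d s :=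
      Finset.sum_nonneg fun s _ => mul_nonneg (by positivity) (hd s)
    have hAz : m = 0 → ∑ s ∈ Finset.range m, ((s : ℝ) + 1) ^ 2 * d s = 0 := by
      rintro rfl; simp
    rw [Finset.sum_range_succ (fun s => ((s : ℝ) + 1) ^ 2 * d s) m, Finset.sum_range_succ d m]
    generalize ∑ s ∈ Finset.range m, ((s : ℝ) + 1) ^ 2 * d s = A at *
    have hdm := hd m
    have hm0 : (0 : ℝ) ≤ m := Nat.cast_nonneg m
    have key : A / ((m : ℝ) + 1) ^ 3 + A / ((m : ℝ) + 1) ^ 2 ≤ A / (m : ℝ) ^ 2 := by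
      rcases Nat.eq_zero_or_pos m with h | h
      · rw [hAz h]; simp
      · have hmp : (0 : ℝ) < m := by exact_mod_cast h
        have e : 1 / ((m : ℝ) + 1) ^ 3 + 1 / ((m : ℝ) + 1) ^ 2 ≤ 1 / (m : ℝ) ^ 2 := by
          rw [div_add_div _ _ (by positivity) (by positivity), div_le_div_iff₀ (by positivity)
            (by positivity)]
          have h3 : 0 < (m : ℝ) ^ 3 := by positivity
          have h4 : 0 < (m : ℝ) ^ 4 := by positivity
          have h2 : 0 < (m : ℝ) ^ 2 := by positivity
          nlinarith
        calc _ = A * (1 / ((m : ℝ) + 1) ^ 3 + 1 / ((m : ℝ) + 1) ^ 2) := by ring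
          _ ≤ A * (1 / (m : ℝ) ^ 2) := by gcongr
          _ = _ := by ring
    have k1 : ((m : ℝ) + 1) ^ 2 * d m / ((m : ℝ) + 1) ^ 3 ≤ d m := by
      have e : ((m : ℝ) + 1) ^ 2 * d m / ((m : ℝ) + 1) ^ 3 = d m / ((m : ℝ) + 1) := by
        field_simp
      rw [e]
      exact div_le_self hdm (by linarith)
    have k2 : ((m : ℝ) + 1) ^ 2 * d m / ((m : ℝ) + 1) ^ 2 = d m := by field_simp
    push_cast
    rw [add_div, add_div, k2]
    linarith

/-- The constant is `4 + 1`: twice the 2 of `sum_weighted_le` for the sum, since both neighbouring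
majorants are bounded alike, plus 1 for the final term. -/
theorem integral_noiseSum_le {D : ℕ → Ω → Vec n} {𝒢 : ℕ → MeasurableSpace Ω} {m : ℕ}
    (hle : ∀ j, 𝒢 j ≤ mΩ) (hmono : Monotone 𝒢) (hD : ∀ s < m, StronglyMeasurable[𝒢 (s + 1)] (D s))
    (hL : ∀ s < m, MemLp (D s) 2 P) (h0 : ∀ s < m, P[D s | 𝒢 s] =ᵐ[P] 0) {η c μ : ℝ} (hη : 0 < η)
    (hc : 0 < c) (hμ : 0 < μ) :
    Integrable (fun ω => noiseSum η c μ (fun s => D s ω) m) P ∧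
    ∫ ω, noiseSum η c μ (fun s => D s ω) m ∂P
      ≤ 5 / (c * μ) * ((∑ s ∈ Finset.range m, ∫ ω, ‖D s ω‖ ^ 2 ∂P) / (m : ℝ) ^ 2) := by
  have hw := integral_norm_sq_weightedSum hle hmono hD hL h0
  set d : ℕ → ℝ := fun s => ∫ ω, ‖D s ω‖ ^ 2 ∂P with hd
  have hd0 : ∀ s, 0 ≤ d s := fun s => integral_nonneg fun ω => by positivity
  set A : ℕ → ℝ := fun j => ∑ s ∈ Finset.range j, ((s : ℝ) + 1) ^ 2 * d s with hA
  have hAm : Monotone A := by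
    refine monotone_nat_of_le_succ fun j => ?_
    simp only [hA]
    rw [Finset.sum_range_succ]
    exact le_add_of_nonneg_right (mul_nonneg (by positivity) (hd0 j))
  have hmaj := integral_noiseMajorant_le (ρ := P)
    (v := fun j ω => weightedSum (fun s => D s ω) j) hη hc hμ (m := m)
    (fun j hj => (hw j hj).2.1) (A := A) (by simp [hA]) (fun j hj => (hw j hj).2.2.le) hAm
  have hint : ∀ j ≤ m, Integrable
      (fun ω => noiseMajorant η c μ (weightedSum (fun s => D s ω)) j) P := fun j hj => (hmaj j hj).1
  have hbd : ∀ j ≤ m, ∫ ω, noiseMajorant η c μ (weightedSum (fun s => D s ω)) j ∂P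
      ≤ A j / (c * μ) := fun j hj => (hmaj j hj).2
  have hterm : ∀ i ∈ Finset.range m, Integrable (fun ω =>
      (noiseMajorant η c μ (weightedSum (fun s => D s ω)) (i + 1)
        + noiseMajorant η c μ (weightedSum (fun s => D s ω)) i) / ((i : ℝ) + 1) ^ 3) P :=
    fun i hi => by
      rw [Finset.mem_range] at hi
      exact ((hint _ (by omega)).add (hint _ (by omega))).div_const _
  have hsum := integrable_finsetSum _ hterm
  unfold noiseSum
  refine ⟨(hsum.div_const _).add ((hint m le_rfl).div_const _), ?_⟩
  rw [integral_add (hsum.div_const _) ((hint m le_rfl).div_const _), integral_div, integral_div,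
    integral_finsetSum _ hterm]
  have h1 : ∑ i ∈ Finset.range m, ∫ ω, (noiseMajorant η c μ (weightedSum (fun s => D s ω)) (i + 1)
        + noiseMajorant η c μ (weightedSum (fun s => D s ω)) i) / ((i : ℝ) + 1) ^ 3 ∂P
      ≤ 2 / (c * μ) * ∑ i ∈ Finset.range m, A (i + 1) / ((i : ℝ) + 1) ^ 3 := by
    rw [Finset.mul_sum]
    refine Finset.sum_le_sum fun i hi => ?_
    rw [Finset.mem_range] at hi
    rw [integral_div, integral_add (hint _ (by omega)) (hint _ (by omega))]
    have k1 := hbd (i + 1) (by omega)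
    have k2 := hbd i (by omega)
    have k3 : A i / (c * μ) ≤ A (i + 1) / (c * μ) := by gcongr; exact hAm (Nat.le_succ i)
    calc _ ≤ (A (i + 1) / (c * μ) + A (i + 1) / (c * μ)) / ((i : ℝ) + 1) ^ 3 := by
          gcongr; exact k2.trans k3
      _ = _ := by ring
  have h2 := sum_weighted_le hd0 m
  have h3 : 0 ≤ (∑ s ∈ Finset.range m, ((s : ℝ) + 1) ^ 2 * d s) / (m : ℝ) ^ 2 :=
    div_nonneg (Finset.sum_nonneg fun s _ => mul_nonneg (by positivity) (hd0 s)) (by positivity)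
  have h4 : A m ≤ (m : ℝ) ^ 2 * ∑ s ∈ Finset.range m, d s := by
    rw [Finset.mul_sum]
    refine Finset.sum_le_sum fun s hs => ?_
    rw [Finset.mem_range] at hs
    have : (s : ℝ) + 1 ≤ m := by exact_mod_cast hs
    exact mul_le_mul_of_nonneg_right (by gcongr) (hd0 s)
  have h5 := hbd m le_rfl
  have hs0 : 0 ≤ ∑ s ∈ Finset.range m, d s := Finset.sum_nonneg fun s _ => hd0 s
  generalize ∑ s ∈ Finset.range m, d s = T at *
  have h6 : ∑ i ∈ Finset.range m, A (i + 1) / ((i : ℝ) + 1) ^ 3 ≤ 2 * T := h2.trans (by linarith)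
  rcases Nat.eq_zero_or_pos m with hm | hm
  · subst hm; simp
  have hmp : (0 : ℝ) < m := by exact_mod_cast hm
  calc _ ≤ (2 / (c * μ) * (2 * T)) / (m : ℝ) ^ 2
        + (((m : ℝ) ^ 2 * T) / (c * μ)) / (m : ℝ) ^ 4 := by
        gcongr
        · exact h1.trans (by gcongr)
        · exact h5.trans (by gcongr)
    _ = _ := by field_simp; ring

end Probability

end ASADMM

/-! ### The expected effect of the noise in one outer iteration. -/

namespace ASADMM

open scoped RealInnerProductSpace
open Matrix

theorem measurable_gradient {n : ℕ} (φ : Vec n → ℝ) : Measurable (gradient φ) :=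
  (InnerProductSpace.toDual ℝ (Vec n)).symm.continuous.measurable.comp (measurable_fderiv ℝ φ)

theorem Problem.sum_gradient_sub {n₁ n₂ n N : ℕ} (Q : Problem n₁ n₂ n N)
    (hd : ∀ j, Differentiable ℝ (Q.comp j)) (x : Vec n₁) :
    ∑ j, (gradient Q.f x - gradient (Q.comp j) x) = 0 := by
  have h1 : HasFDerivAt Q.f ((1 / (N : ℝ)) • ∑ j, fderiv ℝ (Q.comp j) x) x :=
    (HasFDerivAt.fun_sum fun j _ => (hd j x).hasFDerivAt).const_mul (1 / (N : ℝ))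
  have h2 : gradient Q.f x = (1 / (N : ℝ)) • ∑ j, gradient (Q.comp j) x := by
    unfold gradient
    rw [h1.fderiv, map_smul, map_sum]
  rw [Finset.sum_sub_distrib, h2, Finset.sum_const, Finset.card_univ, Fintype.card_fin,
    ← Nat.cast_smul_eq_nsmul ℝ, smul_smul]
  rcases Nat.eq_zero_or_pos N with h | h
  · subst h; simp
  · rw [mul_one_div_cancel (by positivity), one_smul, sub_self]

namespace Run

variable {n₁ n₂ n N : ℕ} {Q : Problem n₁ n₂ n N} {Ω : Type*} [mΩ : MeasurableSpace Ω]
  {P : Measure Ω} {𝓕 : Filtration (ℕ ×ₗ ℕ) mΩ} {R : Run n₁ n₂ n N Ω}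

theorem monotone_stage (𝓕 : Filtration (ℕ ×ₗ ℕ) mΩ) (k : ℕ) :
    Monotone fun t => 𝓕 (toLex (k, t)) := fun _ _ h =>
  𝓕.mono (Prod.Lex.toLex_le_toLex.2 (Or.inr ⟨rfl, h⟩))

namespace IsStochastic

theorem measurable_xhat (hst : R.IsStochastic P 𝓕) (k t : ℕ) :
    Measurable[𝓕 (toLex (k, t))] (R.xhat k (t + 1)) :=
  ((hst.meas_xbin k t).const_smul (bt (t + 1))).add
    ((hst.meas_xin k t).const_smul (1 - bt (t + 1)))

theorem measurable_delta (hst : R.IsStochastic P 𝓕) (k t : ℕ) :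
    Measurable[𝓕 (toLex (k, t + 1))] (R.delta Q k (t + 1)) := by
  have hx := (hst.measurable_xhat k t).mono (monotone_stage 𝓕 k (Nat.le_succ t)) le_rfl
  have hu : Measurable fun p : Fin N × Vec n₁ => gradient (Q.comp p.1) p.2 :=
    measurable_from_prod_countable_right fun j => measurable_gradient (Q.comp j)
  have h1 : Measurable[𝓕 (toLex (k, t + 1))] fun ω =>
      gradient (Q.comp (R.xi k (t + 1) ω)) (R.xhat k (t + 1) ω) :=
    hu.comp ((hst.meas_xi k t).prodMk hx)
  exact ((measurable_gradient Q.f).comp hx).sub (h1.add (hst.meas_e k t))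

theorem measurableSet_M (hst : R.IsStochastic P 𝓕) (k t m : ℕ) :
    MeasurableSet[𝓕 (toLex (k, t))] (R.M k ⁻¹' {m}) :=
  monotone_stage 𝓕 k (Nat.zero_le t) _ (hst.meas_M k (measurableSet_singleton m))

/-- On the event, `δ + e` is the centred family `∇f - ∇f_j` sampled at `ξ`, and `e` is centred
separately; dependence of `e` on `ξ` is harmless. The event belongs to the past, since `M_k` is
chosen before the inner loop. -/
theorem condExp_delta (hst : R.IsStochastic P 𝓕) [IsProbabilityMeasure P]
    (hd : ∀ j, Differentiable ℝ (Q.comp j)) (k t m : ℕ)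
    (hint : Integrable ((R.M k ⁻¹' {m}).indicator (R.delta Q k (t + 1))) P) :
    P[(R.M k ⁻¹' {m}).indicator (R.delta Q k (t + 1)) | 𝓕 (toLex (k, t))] =ᵐ[P] 0 := by
  set G := R.M k ⁻¹' {m} with hG
  have hGm : MeasurableSet[𝓕 (toLex (k, t))] G := hst.measurableSet_M k t m
  have hle := 𝓕.le (toLex (k, t))
  let Y : Fin N → Ω → Vec n₁ := fun j => G.indicator fun ω =>
    gradient Q.f (R.xhat k (t + 1) ω) - gradient (Q.comp j) (R.xhat k (t + 1) ω)
  have hY : ∀ j, StronglyMeasurable[𝓕 (toLex (k, t))] (Y j) := fun j => by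
    have hx := hst.measurable_xhat k t
    exact (Measurable.indicator (((measurable_gradient Q.f).comp hx).sub
      ((measurable_gradient (Q.comp j)).comp hx)) hGm).stronglyMeasurable
  have hsum : ∀ ω, ∑ j, Y j ω = 0 := fun ω => by
    by_cases h : ω ∈ G
    · simp only [Y, Set.indicator_of_mem h]
      exact Q.sum_gradient_sub hd _
    · simp [Y, Set.indicator_of_notMem h]
  have hei : Integrable (G.indicator (R.e k (t + 1))) P :=
    (hst.e_integrable k t).indicator (hle _ hGm)
  have hdec : (fun ω => Y (R.xi k (t + 1) ω) ω)
      = G.indicator (R.delta Q k (t + 1)) + G.indicator (R.e k (t + 1)) := by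
    funext ω
    by_cases h : ω ∈ G
    · simp only [Y, Pi.add_apply, Set.indicator_of_mem h, delta, d]
      abel
    · simp [Y, Set.indicator_of_notMem h]
  have hYi : Integrable (fun ω => Y (R.xi k (t + 1) ω) ω) P := hdec ▸ hint.add hei
  have h1 := condExp_sample_eq_zero (P := P) hle ((hst.meas_xi k t).mono (𝓕.le _) le_rfl)
    (hst.xi_indep k t) (hst.xi_uniform k t) hY hsum hYi
  have h2 : G.indicator (R.delta Q k (t + 1))
      = (fun ω => Y (R.xi k (t + 1) ω) ω) - G.indicator (R.e k (t + 1)) := by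
    rw [hdec, add_sub_cancel_right]
  rw [h2]
  have h3 := condExp_indicator (hst.e_integrable k t) hGm
  filter_upwards [condExp_sub hYi hei (𝓕 (toLex (k, t))), h1, h3, hst.e_mean k t] with ω a b c d
  rw [a, Pi.sub_apply, b, c]
  by_cases h : ω ∈ G
  · rw [Set.indicator_of_mem h, d]; simp
  · rw [Set.indicator_of_notMem h]; simp

end IsStochastic

theorem NoiseBound.exists_lintegral_norm_le {H : Matrix (Fin n₁) (Fin n₁) ℝ} {σ : ℝ}
    (hn : R.NoiseBound Q P H σ) (hH : H.PosDef) : ∃ C : ℝ, 0 ≤ C ∧ ∀ k t, 1 ≤ t →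
      ∫⁻ ω in {ω | t ≤ R.M k ω}, ENNReal.ofReal (‖R.delta Q k t ω‖ ^ 2) ∂P ≤ ENNReal.ofReal C := by
  obtain ⟨h₁, -, hh₁, -, hl, -⟩ := posDef_exists_bounds hH.inv
  refine ⟨h₁⁻¹ * σ ^ 2, by positivity, fun k t ht => ?_⟩
  calc _ ≤ ∫⁻ ω in {ω | t ≤ R.M k ω},
        ENNReal.ofReal h₁⁻¹ * ENNReal.ofReal (normSq H⁻¹ (R.delta Q k t ω)) ∂P := by
        refine lintegral_mono fun ω => ?_
        rw [← ENNReal.ofReal_mul (by positivity)]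
        refine ENNReal.ofReal_le_ofReal ?_
        rw [le_inv_mul_iff₀ hh₁]
        exact hl _
    _ = ENNReal.ofReal h₁⁻¹ * ∫⁻ ω in {ω | t ≤ R.M k ω},
        ENNReal.ofReal (normSq H⁻¹ (R.delta Q k t ω)) ∂P := lintegral_const_mul' _ _ (by simp)
    _ ≤ _ := by
        rw [ENNReal.ofReal_mul (by positivity)]
        gcongr
        exact hn k t ht

/-- On `M_k = m` the bound is `K' m⁻²` times the noise energy of the first `m` steps. The weight is
made independent of `m`, so that summing over `m` recombines the events into `s + 1 ≤ M_k`, where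
the noise assumption applies. -/
theorem exists_lintegral_noiseTerm_le {H : Matrix (Fin n₁) (Fin n₁) ℝ} {β s σ θ : ℝ}
    [IsProbabilityMeasure P] (hst : R.IsStochastic P 𝓕) (hrun : R.FollowsUpdates Q β s H)
    (hd : ∀ j, Differentiable ℝ (Q.comp j)) (hn : R.NoiseBound Q P H σ) (hH : H.PosDef)
    (hθ : 0 < θ) (hM : R.GeometricGrowth θ) {c μ : ℝ} (hc : 0 < c) (hμ : 0 < μ) :
    ∃ K : ℝ, 0 ≤ K ∧ ∀ k, ∫⁻ ω, ENNReal.ofReal (noiseTerm Q R c μ k ω) ∂P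
      ≤ ENNReal.ofReal (K * ((1 + θ) ^ k)⁻¹) := by
  obtain ⟨C, hC, hδ⟩ := hn.exists_lintegral_norm_le hH
  let w : ℕ → ℝ := fun s => 1 / ((s : ℝ) + 1) ^ (3 / 2 : ℝ)
  have hw : Summable w := by
    have h1 := (summable_nat_add_iff 1).2
      (Real.summable_one_div_nat_rpow.2 (by norm_num : (1 : ℝ) < 3 / 2))
    simpa [w] using h1
  have hw0 : ∀ s, 0 ≤ w s := fun s => by positivity
  -- The 5 is for `noiseSum`, the 1 for the plain sum of squares in `noiseTerm`.
  obtain ⟨K', hK'⟩ : ∃ K', K' = 5 / (c * μ) + 1 := ⟨_, rfl⟩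
  have hK'0 : 0 < K' := by rw [hK']; positivity
  refine ⟨K' * (∑' s, w s) * C, mul_nonneg (mul_nonneg hK'0.le (tsum_nonneg hw0)) hC, fun k => ?_⟩
  obtain ⟨g, hg⟩ : ∃ g, g = (1 + θ) ^ k := ⟨_, rfl⟩
  have hg0 : 0 < g := by rw [hg]; positivity
  rw [← hg]
  have hle := fun t => 𝓕.le (toLex (k, t))
  have hGm : ∀ m, MeasurableSet (R.M k ⁻¹' {m}) := fun m => hle 0 _ (hst.measurableSet_M k 0 m)
  let F : ℕ → Ω → ENNReal := fun s =>
    {ω | s + 1 ≤ R.M k ω}.indicator fun ω => ENNReal.ofReal (‖R.delta Q k (s + 1) ω‖ ^ 2)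
  have hpart : ∀ f : Ω → ENNReal, ∫⁻ ω, f ω ∂P = ∑' m, ∫⁻ ω in R.M k ⁻¹' {m}, f ω ∂P := by
    intro f
    have hU : ⋃ m, R.M k ⁻¹' {m} = Set.univ := by ext; simp
    rw [← lintegral_iUnion hGm, hU, Measure.restrict_univ]
    intro i j hij
    exact Disjoint.preimage _ (by simpa using hij)
  have hMm : Measurable (R.M k) := (hst.meas_M k).mono (hle 0) le_rfl
  have hset : ∀ s, MeasurableSet {ω | s + 1 ≤ R.M k ω} := fun s => hMm measurableSet_Ici
  have hF : ∀ s, ∫⁻ ω, F s ω ∂P ≤ ENNReal.ofReal C := fun s => by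
    rw [lintegral_indicator (hset s)]
    exact hδ k (s + 1) (by omega)
  have hdm : ∀ s, Measurable (R.delta Q k (s + 1)) := fun s =>
    (hst.measurable_delta k s).mono (hle _) le_rfl
  have hmain : ∀ m, ∫⁻ ω in R.M k ⁻¹' {m}, ENNReal.ofReal (noiseTerm Q R c μ k ω) ∂P
      ≤ ∑' s, ENNReal.ofReal (K' * g⁻¹ * w s) * ∫⁻ ω in R.M k ⁻¹' {m}, F s ω ∂P := by
    intro m
    rcases (R.M k ⁻¹' {m}).eq_empty_or_nonempty with he | ⟨ω₀, hω₀⟩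
    · rw [he]; simp
    have hmk : R.M k ω₀ = m := hω₀
    have hm0 : 0 < m := hmk ▸ hrun.M_pos k ω₀
    have hmp : (0 : ℝ) < m := by exact_mod_cast hm0
    have hgm : g ^ 2 ≤ m := by rw [hg, ← hmk]; exact hM.sq_pow_le_M hrun hθ ω₀ k
    set G := R.M k ⁻¹' {m} with hGdef
    -- Cut off to the event `M_k = m`, the first `m` errors form a square-integrable martingale
    -- difference sequence, and the stepsize is deterministic there.
    let D : ℕ → Ω → Vec n₁ := fun s => G.indicator (R.delta Q k (s + 1))
    have hDm : ∀ s, StronglyMeasurable[𝓕 (toLex (k, s + 1))] (D s) := fun s =>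
      (Measurable.indicator (hst.measurable_delta k s)
        (hst.measurableSet_M k (s + 1) m)).stronglyMeasurable
    have hDn : ∀ s ω, ENNReal.ofReal (‖D s ω‖ ^ 2)
        = G.indicator (fun ω => ENNReal.ofReal (‖R.delta Q k (s + 1) ω‖ ^ 2)) ω := by
      intro s ω
      by_cases h : ω ∈ G
      · simp only [D, Set.indicator_of_mem h]
      · simp [D, Set.indicator_of_notMem h]
    have hDF : ∀ s < m, ∫⁻ ω, ENNReal.ofReal (‖D s ω‖ ^ 2) ∂P = ∫⁻ ω in G, F s ω ∂P := by
      intro s hs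
      simp only [hDn]
      rw [lintegral_indicator (hGm m)]
      refine setLIntegral_congr_fun (hGm m) fun ω hω => ?_
      have hω' : R.M k ω = m := hω
      have hmem : ω ∈ {ω | s + 1 ≤ R.M k ω} := show s + 1 ≤ R.M k ω by omega
      simp only [F, Set.indicator_of_mem hmem]
    have hDsq : ∀ s < m, Integrable (fun ω => ‖D s ω‖ ^ 2) P := by
      intro s hs
      have hms : AEStronglyMeasurable (fun ω => ‖D s ω‖ ^ 2) P :=
        ((((hDm s).mono (hle _)).norm).pow 2).aestronglyMeasurable
      refine (lintegral_ofReal_ne_top_iff_integrable hms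
        (Filter.Eventually.of_forall fun ω => by positivity)).1 ?_
      rw [hDF s hs]
      refine ne_top_of_le_ne_top ENNReal.ofReal_ne_top
        ((setLIntegral_le_lintegral G _).trans (hF s))
    have hL : ∀ s < m, MemLp (D s) 2 P := fun s hs =>
      (memLp_two_iff_integrable_sq_norm ((hDm s).mono (hle _)).aestronglyMeasurable).2 (hDsq s hs)
    have h0 : ∀ s < m, P[D s | 𝓕 (toLex (k, s))] =ᵐ[P] 0 := fun s hs =>
      hst.condExp_delta hd k s m ((hL s hs).integrable one_le_two)
    have hη : 0 < g⁻¹ / (m : ℝ) := by positivity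
    obtain ⟨hi, hI⟩ := integral_noiseSum_le (P := P) hle (monotone_stage 𝓕 k)
      (fun s _ => hDm s) hL h0 hη hc hμ
    have hi2 : Integrable (fun ω => (∑ s ∈ Finset.range m, ‖D s ω‖ ^ 2) / (m : ℝ) ^ 2) P :=
      (integrable_finsetSum _ fun s hs => hDsq s (Finset.mem_range.1 hs)).div_const _
    have hI2 : ∫ ω, (∑ s ∈ Finset.range m, ‖D s ω‖ ^ 2) / (m : ℝ) ^ 2 ∂P
        = (∑ s ∈ Finset.range m, ∫ ω, ‖D s ω‖ ^ 2 ∂P) / (m : ℝ) ^ 2 := by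
      rw [integral_div, integral_finsetSum _ fun s hs => hDsq s (Finset.mem_range.1 hs)]
    have hns := fun ω => noiseSum_nonneg hη hc hμ (fun s => D s ω) m
    have hsq : ∀ ω, 0 ≤ (∑ s ∈ Finset.range m, ‖D s ω‖ ^ 2) / (m : ℝ) ^ 2 := fun ω => by positivity
    calc ∫⁻ ω in G, ENNReal.ofReal (noiseTerm Q R c μ k ω) ∂P
        ≤ ∫⁻ ω in G, ENNReal.ofReal (noiseSum (g⁻¹ / m) c μ (fun s => D s ω) m
          + (∑ s ∈ Finset.range m, ‖D s ω‖ ^ 2) / (m : ℝ) ^ 2) ∂P := by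
          refine le_of_eq (setLIntegral_congr_fun (hGm m) fun ω hω => ?_)
          have hω' : R.M k ω = m := hω
          have e : (fun s => R.delta Q k (s + 1) ω) = fun s => D s ω := by
            funext s; simp only [D, Set.indicator_of_mem hω]
          have e2 : ∀ s, ‖R.delta Q k (s + 1) ω‖ = ‖D s ω‖ := fun s => by
            simp only [D, Set.indicator_of_mem hω]
          simp only [noiseTerm, hM.2 k ω, hω', e, e2, hg]
      _ ≤ ∫⁻ ω, ENNReal.ofReal (noiseSum (g⁻¹ / m) c μ (fun s => D s ω) m
          + (∑ s ∈ Finset.range m, ‖D s ω‖ ^ 2) / (m : ℝ) ^ 2) ∂P := setLIntegral_le_lintegral _ _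
      _ = ENNReal.ofReal (∫ ω, (noiseSum (g⁻¹ / m) c μ (fun s => D s ω) m
          + (∑ s ∈ Finset.range m, ‖D s ω‖ ^ 2) / (m : ℝ) ^ 2) ∂P) :=
          (ofReal_integral_eq_lintegral_ofReal (hi.add hi2)
            (Filter.Eventually.of_forall fun ω => add_nonneg (hns ω) (hsq ω))).symm
      _ ≤ ENNReal.ofReal (∑ s ∈ Finset.range m, K' / (m : ℝ) ^ 2 * ∫ ω, ‖D s ω‖ ^ 2 ∂P) := by
          refine ENNReal.ofReal_le_ofReal ?_
          rw [integral_add hi hi2, hI2, ← Finset.mul_sum, hK']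
          refine (add_le_add_left hI _).trans (le_of_eq ?_)
          ring
      _ = ∑ s ∈ Finset.range m, ENNReal.ofReal (K' / (m : ℝ) ^ 2) * ∫⁻ ω in G, F s ω ∂P := by
          rw [ENNReal.ofReal_sum_of_nonneg fun s _ => mul_nonneg (by positivity)
            (integral_nonneg fun ω => by positivity)]
          refine Finset.sum_congr rfl fun s hs => ?_
          rw [Finset.mem_range] at hs
          rw [ENNReal.ofReal_mul (by positivity), ofReal_integral_eq_lintegral_ofReal (hDsq s hs)
            (Filter.Eventually.of_forall fun ω => by positivity), hDF s hs]
      _ ≤ ∑ s ∈ Finset.range m, ENNReal.ofReal (K' * g⁻¹ * w s) * ∫⁻ ω in G, F s ω ∂P := by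
          refine Finset.sum_le_sum fun s hs => mul_le_mul_left (ENNReal.ofReal_le_ofReal ?_) _
          rw [Finset.mem_range] at hs
          have hsm : (s : ℝ) + 1 ≤ m := by exact_mod_cast hs
          -- Half a power of `m` pays for `g`, as `g² ≤ m`; the other three halves give a summable
          -- weight, as `s + 1 ≤ m`.
          have e1 : g * ((s : ℝ) + 1) ^ (3 / 2 : ℝ) ≤ (m : ℝ) ^ 2 := by
            have e2 : (m : ℝ) ^ 2 = (m : ℝ) ^ (1 / 2 : ℝ) * (m : ℝ) ^ (3 / 2 : ℝ) := by
              rw [← Real.rpow_add hmp, ← Real.rpow_natCast]; norm_num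
            rw [e2, ← Real.sqrt_eq_rpow]
            gcongr
            exact Real.le_sqrt_of_sq_le hgm
          have e3 : K' * g⁻¹ * w s = K' / (g * ((s : ℝ) + 1) ^ (3 / 2 : ℝ)) := by
            simp only [w]; field_simp
          rw [e3]
          gcongr
      _ ≤ _ := ENNReal.sum_le_tsum _
  calc ∫⁻ ω, ENNReal.ofReal (noiseTerm Q R c μ k ω) ∂P
      ≤ ∑' m, ∑' s, ENNReal.ofReal (K' * g⁻¹ * w s) * ∫⁻ ω in R.M k ⁻¹' {m}, F s ω ∂P := by
        rw [hpart]; exact ENNReal.tsum_le_tsum hmain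
    _ = ∑' s, ENNReal.ofReal (K' * g⁻¹ * w s) * ∫⁻ ω, F s ω ∂P := by
        rw [ENNReal.tsum_comm]
        exact tsum_congr fun s => by rw [ENNReal.tsum_mul_left, ← hpart]
    _ ≤ ∑' s, ENNReal.ofReal (K' * g⁻¹ * w s) * ENNReal.ofReal C :=
        ENNReal.tsum_le_tsum fun s => by gcongr; exact hF s
    _ = ENNReal.ofReal (K' * (∑' s, w s) * C * g⁻¹) := by
        rw [ENNReal.tsum_mul_right, ← ENNReal.ofReal_tsum_of_nonneg
          (fun s => mul_nonneg (by positivity) (hw0 s)) (hw.mul_left _), tsum_mul_left,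
          ← ENNReal.ofReal_mul (mul_nonneg (by positivity) (tsum_nonneg hw0))]
        congr 1
        ring

end Run

end ASADMM

/-! ### Recursion in expectation and the linear rate. -/

namespace ASADMM

open scoped RealInnerProductSpace
open Matrix

/-- From some index on, `K ρ^k` is at most `(1 - q) / 2`, so the factor is `q' = (1 + q) / 2`. With
`τ` strictly between `max q' ρ` and 1, the forcing term is absorbed once `c ≥ K / (τ - q')`; the
finitely many early terms are added to `c`. -/
theorem exists_geometric_bound {a : ℕ → ℝ} {q K ρ : ℝ} (ha : ∀ k, 0 ≤ a k) (hq : 0 < q)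
    (hq1 : q < 1) (hK : 0 < K) (hρ : 0 < ρ) (hρ1 : ρ < 1)
    (hrec : ∀ k, 1 ≤ k → a (k + 1) ≤ q * a k + K * ρ ^ k * (1 + a k)) :
    ∃ c τ : ℝ, 0 < c ∧ 0 < τ ∧ τ < 1 ∧ ∀ k, a k ≤ c * τ ^ k := by
  obtain ⟨k₀, hk₀⟩ := exists_pow_lt_of_lt_one (show 0 < (1 - q) / (2 * K) by
    have : 0 < 1 - q := by linarith
    positivity) hρ1
  obtain ⟨q', hq'⟩ : ∃ q', q' = (1 + q) / 2 := ⟨_, rfl⟩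
  obtain ⟨τ, hτ⟩ : ∃ τ, τ = (1 + max q' ρ) / 2 := ⟨_, rfl⟩
  have hm1 : max q' ρ < 1 := max_lt (by linarith) hρ1
  have hm2 := le_max_left q' ρ
  have hm3 := le_max_right q' ρ
  have hτ1 : τ < 1 := by linarith
  have hτ0 : 0 < τ := by linarith
  have hτq : 0 < τ - q' := by linarith
  have hτρ : ρ ≤ τ := by linarith
  obtain ⟨c, hc⟩ : ∃ c, c = ∑ i ∈ Finset.range (k₀ + 2), a i / τ ^ i + K / (τ - q') := ⟨_, rfl⟩
  have hs0 : ∀ i, 0 ≤ a i / τ ^ i := fun i => div_nonneg (ha i) (by positivity)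
  have hsum := Finset.sum_nonneg fun i (_ : i ∈ Finset.range (k₀ + 2)) => hs0 i
  have hKτ : 0 < K / (τ - q') := by positivity
  have hc0 : 0 < c := by linarith
  refine ⟨c, τ, hc0, hτ0, hτ1, ?_⟩
  have hsmall : ∀ k < k₀ + 2, a k ≤ c * τ ^ k := by
    intro k hk
    rw [← div_le_iff₀ (by positivity)]
    have := Finset.single_le_sum (fun i _ => hs0 i) (Finset.mem_range.2 hk)
    linarith
  have hlarge : ∀ k, k₀ + 1 ≤ k → a k ≤ c * τ ^ k := by
    intro k hk
    induction k, hk using Nat.le_induction with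
    | base => exact hsmall _ (by omega)
    | succ k hk ih =>
      have h1 := hrec k (by omega)
      have h2 : K * ρ ^ k ≤ (1 - q) / 2 := by
        have : ρ ^ k ≤ ρ ^ k₀ := pow_le_pow_of_le_one hρ.le hρ1.le (by omega)
        calc K * ρ ^ k ≤ K * ((1 - q) / (2 * K)) := by gcongr; linarith
          _ = _ := by field_simp
      have h3 : K * ρ ^ k ≤ K * τ ^ k := by gcongr
      have h4 : K * ρ ^ k * a k ≤ (1 - q) / 2 * a k := mul_le_mul_of_nonneg_right h2 (ha k)
      have h5 : K ≤ c * (τ - q') := by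
        rw [← div_le_iff₀ hτq]; linarith
      have h6 : q' * a k ≤ q' * (c * τ ^ k) := mul_le_mul_of_nonneg_left ih (by linarith)
      have h7 : K * τ ^ k ≤ c * (τ - q') * τ ^ k := by gcongr
      calc a (k + 1) ≤ q' * a k + K * ρ ^ k := by rw [hq']; linarith
        _ ≤ q' * (c * τ ^ k) + c * (τ - q') * τ ^ k := by linarith
        _ = c * τ ^ (k + 1) := by ring
  intro k
  rcases Nat.lt_or_ge k (k₀ + 2) with h | h
  · exact hsmall k h
  · exact hlarge k (by omega)

/-- Nothing is asked of `T` beyond a bound on its lower integral, so `noiseTerm` never has to be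
shown measurable. -/
theorem integrable_of_le_add {Ω : Type*} [MeasurableSpace Ω] {P : Measure Ω}
    [IsProbabilityMeasure P] {V W T : Ω → ℝ} {a b c t : ℝ} (ha : 0 ≤ a) (hb : 0 ≤ b) (hc : 0 ≤ c)
    (ht : 0 ≤ t) (hV0 : ∀ ω, 0 ≤ V ω) (hV : Integrable V P) (hW0 : ∀ ω, 0 ≤ W ω)
    (hWm : Measurable W) (hT : ∫⁻ ω, ENNReal.ofReal (T ω) ∂P ≤ ENNReal.ofReal t)
    (h : ∀ ω, W ω ≤ a * V ω + b + c * T ω) :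
    Integrable W P ∧ ∫ ω, W ω ∂P ≤ a * ∫ ω, V ω ∂P + b + c * t := by
  have hi : Integrable (fun ω => a * V ω + b) P := (hV.const_mul a).add (integrable_const b)
  have hi0 : ∀ ω, 0 ≤ a * V ω + b := fun ω => add_nonneg (mul_nonneg ha (hV0 ω)) hb
  have hI : ∫ ω, (a * V ω + b) ∂P = a * ∫ ω, V ω ∂P + b := by
    rw [integral_add (hV.const_mul a) (integrable_const b), integral_const_mul, integral_const]
    simp
  have hr0 : 0 ≤ a * ∫ ω, V ω ∂P + b := by rw [← hI]; exact integral_nonneg hi0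
  have hle : ∫⁻ ω, ENNReal.ofReal (W ω) ∂P
      ≤ ENNReal.ofReal (a * ∫ ω, V ω ∂P + b + c * t) := by
    calc _ ≤ ∫⁻ ω, (ENNReal.ofReal (a * V ω + b) + ENNReal.ofReal c * ENNReal.ofReal (T ω)) ∂P := by
          refine lintegral_mono fun ω => ?_
          rw [← ENNReal.ofReal_mul hc]
          exact (ENNReal.ofReal_le_ofReal (h ω)).trans ENNReal.ofReal_add_le
      _ = ∫⁻ ω, ENNReal.ofReal (a * V ω + b) ∂P
          + ENNReal.ofReal c * ∫⁻ ω, ENNReal.ofReal (T ω) ∂P := by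
          rw [lintegral_add_left' hi.aestronglyMeasurable.aemeasurable.ennreal_ofReal,
            lintegral_const_mul' _ _ ENNReal.ofReal_ne_top]
      _ ≤ ENNReal.ofReal (a * ∫ ω, V ω ∂P + b) + ENNReal.ofReal c * ENNReal.ofReal t := by
          rw [← ofReal_integral_eq_lintegral_ofReal hi (Filter.Eventually.of_forall hi0), hI]
          gcongr
      _ = _ := by rw [← ENNReal.ofReal_mul hc, ← ENNReal.ofReal_add hr0 (mul_nonneg hc ht)]
  refine ⟨(lintegral_ofReal_ne_top_iff_integrable hWm.aestronglyMeasurable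
    (Filter.Eventually.of_forall hW0)).1 (ne_top_of_le_ne_top ENNReal.ofReal_ne_top hle), ?_⟩
  rw [integral_eq_lintegral_of_nonneg_ae (Filter.Eventually.of_forall hW0)
    hWm.aestronglyMeasurable]
  exact ENNReal.toReal_le_of_le_ofReal (add_nonneg hr0 (mul_nonneg hc ht)) hle

/-- This makes the multiplier error measurable although no measurability of the projections is
assumed. -/
theorem IsProjection.norm_sub_eq_infDist {n : ℕ} {S : Set (Vec n)} {z p : Vec n}
    (h : IsProjection S z p) : ‖z - p‖ = Metric.infDist z S := by
  refine le_antisymm ?_ ?_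
  · rw [Metric.le_infDist ⟨p, h.1⟩]
    intro q hq
    rw [dist_eq_norm]
    exact h.2 q hq
  · rw [← dist_eq_norm]
    exact Metric.infDist_le_dist_of_mem h.1

theorem measurable_toEuclideanLin {Ω : Type*} [MeasurableSpace Ω] {m n : ℕ}
    {D : Ω → Matrix (Fin m) (Fin n) ℝ} (hD : ∀ i j, Measurable fun ω => D ω i j) {u : Ω → Vec n}
    (hu : Measurable u) : Measurable fun ω => toEuclideanLin (D ω) (u ω) := by
  refine (PiLp.continuous_toLp 2 fun _ : Fin m => ℝ).measurable.comp
    (measurable_pi_lambda (fun ω => D ω *ᵥ (u ω).ofLp) fun i => ?_)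
  have hu' : ∀ j, Measurable fun ω => u ω j := fun j => by fun_prop
  exact Finset.measurable_fun_sum Finset.univ fun j _ => (hD i j).mul (hu' j)

namespace Standing

variable {n₁ n₂ n N : ℕ} {Ω : Type*} {Q : Problem n₁ n₂ n N} {R : Run n₁ n₂ n N Ω}
  {β s ν α c₁ c₂ : ℝ} {H : Matrix (Fin n₁) (Fin n₁) ℝ} {xs : Vec n₁} {ys : Vec n₂}
  {lbar : ℕ → Ω → Vec n}

/-- The pathwise recursion for the Lyapunov function, with noise `T`. -/
theorem exists_recursion (S : Standing Q R β s ν α c₁ c₂ H xs ys lbar) {θ : ℝ} (hθ : 0 < θ)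
    (hM : R.GeometricGrowth θ) : ∃ q K μ : ℝ, 0 < q ∧ q < 1 ∧ 0 < K ∧ 0 < μ ∧ ∀ k ω,
      ‖R.y (k + 1) ω - ys‖ ^ 2
        ≤ K * (potential Q R β s xs ys lbar k ω + potential Q R β s xs ys lbar (k + 1) ω) ∧
      potential Q R β s xs ys lbar (k + 1) ω
        ≤ K * potential Q R β s xs ys lbar k ω + K + K * noiseTerm Q R c₁ μ k ω ∧
      (1 ≤ k → potential Q R β s xs ys lbar (k + 1) ω
        ≤ (q + K * ((1 + θ) ^ k)⁻¹) * potential Q R β s xs ys lbar k ω + K * ((1 + θ) ^ k)⁻¹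
          + K * noiseTerm Q R c₁ μ k ω) := by
  obtain ⟨h₁, h₂, hh₁, hh₂, hl, hu⟩ := posDef_exists_bounds S.posDef
  obtain ⟨q, K₁, hq0, hq1, hK₁, hcontr⟩ := S.potential_contraction
  obtain ⟨K₂, hK₂, hgrow⟩ := S.potential_growth
  obtain ⟨K₃, hK₃, hsub⟩ := S.subsolution_error
  obtain ⟨K₄, hK₄, hin⟩ := S.inner_error hθ hM hh₁ hh₂ hl hu
  have hc₁ := S.c₁_pos
  obtain ⟨K, hK⟩ : ∃ K, K = K₁ * K₄ + K₂ * (1 + 2 * K₄ + 2 * K₃) + K₂ * (1 + c₁⁻¹) := ⟨_, rfl⟩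
  have ki : 0 < c₁⁻¹ := by positivity
  have k1 : 0 < K₁ * K₄ := by positivity
  have k2 : 0 < K₂ * (1 + 2 * K₄ + 2 * K₃) := by positivity
  have k3 : 0 < K₂ * (1 + c₁⁻¹) := by positivity
  have k4 : K₁ * K₄ ≤ K := by linarith
  have k5 : K₂ * (1 + 2 * K₄ + 2 * K₃) ≤ K := by linarith
  have k6 : K₂ * (1 + c₁⁻¹) ≤ K := by linarith
  have hK0 : 0 < K := by linarith
  refine ⟨q, K, c₁ / h₂, hq0, hq1, hK0, by positivity, fun k ω => ?_⟩
  have hV := (S.potential_bounds k ω).1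
  obtain ⟨hV', -, hx'⟩ := S.potential_bounds (k + 1) ω
  obtain ⟨z, hz⟩ := S.exists_subsolution k ω
  have hin := hin k ω z hz
  have hsub := hsub k ω z hz
  obtain ⟨hy, hgr⟩ := hgrow k ω
  have hT : 0 ≤ noiseTerm Q R c₁ (c₁ / h₂) k ω :=
    add_nonneg (noiseSum_nonneg (S.run.eta_pos k ω) hc₁ (by positivity) _ _) (by positivity)
  have hg1 : 1 ≤ (1 + θ) ^ k := one_le_pow₀ (by linarith)
  have hr0 : 0 < ((1 + θ) ^ k)⁻¹ := by positivity
  have hr1 : ((1 + θ) ^ k)⁻¹ ≤ 1 := inv_le_one_of_one_le₀ hg1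
  have hcontr' : 1 ≤ k → potential Q R β s xs ys lbar (k + 1) ω
      ≤ q * potential Q R β s xs ys lbar k ω + K₁ * ‖R.x (k + 1) ω - z‖ ^ 2 := by
    intro hk
    obtain ⟨j, rfl⟩ := Nat.exists_eq_succ_of_ne_zero (show k ≠ 0 by omega)
    exact hcontr j ω z hz
  generalize potential Q R β s xs ys lbar k ω = V at *
  generalize potential Q R β s xs ys lbar (k + 1) ω = V' at *
  generalize noiseTerm Q R c₁ (c₁ / h₂) k ω = T at *
  generalize ((1 + θ) ^ k)⁻¹ = r at *
  have hxs : ‖R.x (k + 1) ω - xs‖ ^ 2 ≤ 2 * ‖R.x (k + 1) ω - z‖ ^ 2 + 2 * ‖z - xs‖ ^ 2 := by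
    have := norm_add_sq_le_two_mul (R.x (k + 1) ω - z) (z - xs)
    rwa [sub_add_sub_cancel] at this
  have hrV : r * (1 + V) ≤ 1 + V := mul_le_of_le_one_left (by linarith) hr1
  refine ⟨?_, ?_, fun hk => ?_⟩
  · calc _ ≤ K₂ * (V + c₁⁻¹ * V') := hy.trans (by gcongr)
      _ ≤ K₂ * (1 + c₁⁻¹) * (V + V') := by
        have : 0 ≤ K₂ * (c₁⁻¹ * V) := by positivity
        have : 0 ≤ K₂ * V' := by positivity
        linarith
      _ ≤ _ := by gcongr
  · calc V' ≤ K₂ * (V + (2 * (K₄ * ((1 + V) + T)) + 2 * (K₃ * V))) := by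
          refine hgr.trans ?_
          gcongr
          refine hxs.trans ?_
          gcongr
          refine hin.trans ?_
          gcongr
      _ ≤ K₂ * (1 + 2 * K₄ + 2 * K₃) * (V + 1 + T) := by
        have : 0 ≤ K₂ * (1 + T) := by positivity
        have : 0 ≤ K₂ * K₃ * (1 + T) := by positivity
        linarith
      _ ≤ K * (V + 1 + T) := by gcongr
      _ = _ := by ring
  · calc V' ≤ q * V + K₁ * (K₄ * (r * (1 + V) + T)) :=
          (hcontr' hk).trans (by gcongr)
      _ = q * V + K₁ * K₄ * (r * (1 + V) + T) := by ring
      _ ≤ q * V + K * (r * (1 + V) + T) := by gcongr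
      _ = _ := by ring

variable [mΩ : MeasurableSpace Ω] {P : Measure Ω} {𝓕 : Filtration (ℕ ×ₗ ℕ) mΩ}

theorem measurable_norm_lam_sub (S : Standing Q R β s ν α c₁ c₂ H xs ys lbar)
    (hst : R.IsStochastic P 𝓕) (k : ℕ) : Measurable fun ω => ‖R.lam k ω - lbar k ω‖ := by
  simp only [(S.proj k _).norm_sub_eq_infDist]
  exact (Metric.continuous_infDist_pt _).measurable.comp ((hst.meas_lam k).mono (𝓕.le _) le_rfl)

theorem measurable_potential (S : Standing Q R β s ν α c₁ c₂ H xs ys lbar)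
    (hst : R.IsStochastic P 𝓕) (k : ℕ) : Measurable (potential Q R β s xs ys lbar k) := by
  have hl := S.measurable_norm_lam_sub hst k
  have hx : Measurable fun ω => R.x k ω - xs :=
    ((hst.meas_x k).mono (𝓕.le _) le_rfl).sub_const xs
  have hy : Measurable fun ω => R.y k ω - ys :=
    ((hst.meas_y k).mono (𝓕.le _) le_rfl).sub_const ys
  have hD : ∀ i j, Measurable fun ω => R.D Q β k ω i j := fun i j =>
    ((hst.meas_MM k i j).mono (𝓕.le _) le_rfl).sub_const ((β • (Q.A.transpose * Q.A)) i j)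
  have hA := measurable_toEuclideanLin (fun i j => measurable_const (a := Q.A i j)) hx
  have hB := measurable_toEuclideanLin (fun i j => measurable_const (a := Q.B i j)) hy
  have hDu := measurable_toEuclideanLin hD hx
  exact ((((hl.pow_const 2).div_const _).add ((hB.norm.pow_const 2).const_mul β)).add
    (hx.inner hDu)).add (((hA.add hB).norm.pow_const 2).const_mul (β * residualWeight s))

/-- The starting point is deterministic; only `D_0` may be random, and it is bounded by `c₂`. -/
theorem integrable_potential_zero (S : Standing Q R β s ν α c₁ c₂ H xs ys lbar)
    (hst : R.IsStochastic P 𝓕) [IsProbabilityMeasure P] :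
    Integrable (potential Q R β s xs ys lbar 0) P := by
  obtain ⟨x₀, y₀, l₀, h0⟩ := S.run.init
  refine Integrable.of_bound (S.measurable_potential hst 0).aestronglyMeasurable
    (Metric.infDist l₀ (Q.multipliers xs ys) ^ 2 / (s * β)
      + β * ‖toEuclideanLin Q.B (y₀ - ys)‖ ^ 2 + c₂ * ‖x₀ - xs‖ ^ 2 + β * residualWeight s
        * ‖toEuclideanLin Q.A (x₀ - xs) + toEuclideanLin Q.B (y₀ - ys)‖ ^ 2)
    (Filter.Eventually.of_forall fun ω => ?_)
  rw [Real.norm_of_nonneg (S.potential_bounds 0 ω).1]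
  have h1 := S.D_upper 0 ω (R.x 0 ω - xs)
  unfold potential lyapunov
  rw [(S.proj 0 ω).norm_sub_eq_infDist]
  obtain ⟨hx, -, hy, hl⟩ := h0 ω
  rw [hx] at h1
  rw [hx, hy, hl]
  linarith

theorem exists_potential_bound (S : Standing Q R β s ν α c₁ c₂ H xs ys lbar)
    (hst : R.IsStochastic P 𝓕) [IsProbabilityMeasure P] (hd : ∀ j, Differentiable ℝ (Q.comp j))
    {σ θ : ℝ} (hn : R.NoiseBound Q P H σ) (hθ : 0 < θ) (hM : R.GeometricGrowth θ) :
    ∃ c τ K : ℝ, 0 < c ∧ 0 < τ ∧ τ < 1 ∧ 0 < K ∧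
      (∀ k ω, ‖R.y (k + 1) ω - ys‖ ^ 2
        ≤ K * (potential Q R β s xs ys lbar k ω + potential Q R β s xs ys lbar (k + 1) ω)) ∧
      ∀ k, Integrable (potential Q R β s xs ys lbar k) P ∧
        ∫ ω, potential Q R β s xs ys lbar k ω ∂P ≤ c * τ ^ k := by
  obtain ⟨q, K, μ, hq0, hq1, hK, hμ, hrec⟩ := S.exists_recursion hθ hM
  obtain ⟨K', hK', hT⟩ := R.exists_lintegral_noiseTerm_le hst S.run hd hn S.posDef hθ hM S.c₁_pos hμ
  have hV0 := fun k ω => (S.potential_bounds k ω).1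
  have hr0 : ∀ k : ℕ, 0 < ((1 + θ) ^ k)⁻¹ := fun k => by positivity
  -- Integrability comes from the growth bound, which also holds for `k = 0`, before any rate is
  -- available.
  have hint : ∀ k, Integrable (potential Q R β s xs ys lbar k) P := by
    intro k
    induction k with
    | zero => exact S.integrable_potential_zero hst
    | succ k ih =>
      exact (integrable_of_le_add hK.le hK.le hK.le (mul_nonneg hK' (hr0 k).le) (hV0 k) ih
        (hV0 (k + 1)) (S.measurable_potential hst (k + 1)) (hT k) fun ω => (hrec k ω).2.1).1
  obtain ⟨c, τ, hc, hτ0, hτ1, hb⟩ := exists_geometric_bound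
    (a := fun k => ∫ ω, potential Q R β s xs ys lbar k ω ∂P) (K := K * (1 + K')) (ρ := (1 + θ)⁻¹)
    (fun k => integral_nonneg (hV0 k)) hq0 hq1 (by positivity) (by positivity)
    (inv_lt_one_of_one_lt₀ (by linarith)) fun k hk => by
      have hr := hr0 k
      have h1 := (integrable_of_le_add (a := q + K * ((1 + θ) ^ k)⁻¹) (by positivity)
        (mul_pos hK hr).le hK.le (mul_nonneg hK' hr.le) (hV0 k) (hint k) (hV0 (k + 1))
        (S.measurable_potential hst (k + 1)) (hT k) fun ω => (hrec k ω).2.2 hk).2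
      have h2 : 0 ≤ ∫ ω, potential Q R β s xs ys lbar k ω ∂P := integral_nonneg (hV0 k)
      rw [inv_pow]
      have h3 : 0 ≤ K * K' * ((1 + θ) ^ k)⁻¹ * ∫ ω, potential Q R β s xs ys lbar k ω ∂P := by
        positivity
      refine h1.trans ?_
      linarith
  exact ⟨c, τ, K, hc, hτ0, hτ1, hK, fun k ω => (hrec k ω).1, fun k => ⟨hint k, hb k⟩⟩

theorem exists_linear_rate (S : Standing Q R β s ν α c₁ c₂ H xs ys lbar)
    (hst : R.IsStochastic P 𝓕) [IsProbabilityMeasure P] (hd : ∀ j, Differentiable ℝ (Q.comp j))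
    {σ θ : ℝ} (hn : R.NoiseBound Q P H σ) (hθ : 0 < θ) (hM : R.GeometricGrowth θ) :
    ∃ c τ : ℝ, 0 < c ∧ 0 < τ ∧ τ < 1 ∧ ∀ k : ℕ,
      Integrable (fun ω => ‖R.x k ω - xs‖ ^ 2 + ‖R.y k ω - ys‖ ^ 2
        + ‖R.lam k ω - lbar k ω‖ ^ 2) P ∧
      ∫ ω, (‖R.x k ω - xs‖ ^ 2 + ‖R.y k ω - ys‖ ^ 2 + ‖R.lam k ω - lbar k ω‖ ^ 2) ∂P
        ≤ c * τ ^ k := by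
  obtain ⟨c, τ, K, hc, hτ0, hτ1, hK, hy, hV⟩ := S.exists_potential_bound hst hd hn hθ hM
  obtain ⟨x₀, y₀, l₀, h0⟩ := S.run.init
  obtain ⟨C, hC⟩ : ∃ C, C = c₁⁻¹ + K + s * β := ⟨_, rfl⟩
  have hc₁ := S.c₁_pos
  have hβ := S.β_pos
  have hs := S.s_pos
  have hC0 : 0 < C := by rw [hC]; positivity
  obtain ⟨w, hw⟩ : ∃ w, w = ‖x₀ - xs‖ ^ 2 + ‖y₀ - ys‖ ^ 2
    + Metric.infDist l₀ (Q.multipliers xs ys) ^ 2 := ⟨_, rfl⟩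
  have hw0 : 0 ≤ w := by rw [hw]; positivity
  -- Here `w` is the deterministic initial error; the other term arises because the error at `k + 1`
  -- is bounded by the potentials at both `k` and `k + 1`, which costs one power of `τ`.
  refine ⟨w + 2 * C * c / τ, τ, by positivity, hτ0, hτ1, fun k => ?_⟩
  cases k with
  | zero =>
    have e : (fun ω => ‖R.x 0 ω - xs‖ ^ 2 + ‖R.y 0 ω - ys‖ ^ 2 + ‖R.lam 0 ω - lbar 0 ω‖ ^ 2)
        = fun _ => w := by
      funext ω
      obtain ⟨hx, -, hy, hl⟩ := h0 ω
      rw [(S.proj 0 ω).norm_sub_eq_infDist, hx, hy, hl, hw]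
    rw [e]
    refine ⟨integrable_const _, ?_⟩
    have : 0 ≤ 2 * C * c / τ := by positivity
    simpa using this
  | succ k =>
    have hbd : ∀ ω, ‖R.x (k + 1) ω - xs‖ ^ 2 + ‖R.y (k + 1) ω - ys‖ ^ 2
        + ‖R.lam (k + 1) ω - lbar (k + 1) ω‖ ^ 2
        ≤ C * (potential Q R β s xs ys lbar k ω + potential Q R β s xs ys lbar (k + 1) ω) := by
      intro ω
      have h1 := (S.potential_bounds k ω).1
      obtain ⟨-, h2, h3⟩ := S.potential_bounds (k + 1) ω
      have h4 := hy k ω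
      have h5 : 0 ≤ (c₁⁻¹ + s * β) * potential Q R β s xs ys lbar k ω := by positivity
      rw [hC]
      linarith
    have hI := ((hV k).1.add (hV (k + 1)).1).const_mul C
    have hm : Measurable fun ω => ‖R.x (k + 1) ω - xs‖ ^ 2 + ‖R.y (k + 1) ω - ys‖ ^ 2
        + ‖R.lam (k + 1) ω - lbar (k + 1) ω‖ ^ 2 :=
      (((((hst.meas_x _).mono (𝓕.le _) le_rfl).sub_const xs).norm.pow_const 2).add
        ((((hst.meas_y _).mono (𝓕.le _) le_rfl).sub_const ys).norm.pow_const 2)).add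
        ((S.measurable_norm_lam_sub hst (k + 1)).pow_const 2)
    have hint := Integrable.mono' hI hm.aestronglyMeasurable
      (Filter.Eventually.of_forall fun ω => by
        rw [Real.norm_of_nonneg (by positivity)]; exact hbd ω)
    refine ⟨hint, (integral_mono hint hI hbd).trans ?_⟩
    have e : ∫ ω, C * (potential Q R β s xs ys lbar k ω
        + potential Q R β s xs ys lbar (k + 1) ω) ∂P
        = C * (∫ ω, potential Q R β s xs ys lbar k ω ∂P
          + ∫ ω, potential Q R β s xs ys lbar (k + 1) ω ∂P) := by
      rw [integral_const_mul, integral_add (hV k).1 (hV (k + 1)).1]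
    refine (le_of_eq e).trans ?_
    have h1 := (hV k).2
    have h2 : ∫ ω, potential Q R β s xs ys lbar (k + 1) ω ∂P ≤ c * τ ^ k :=
      (hV (k + 1)).2.trans (by
        gcongr ?_ * ?_
        exact pow_le_pow_of_le_one hτ0.le hτ1.le (Nat.le_succ k))
    calc _ ≤ C * (c * τ ^ k + c * τ ^ k) := by gcongr
      _ = 2 * C * c / τ * τ ^ (k + 1) := by rw [pow_succ]; field_simp; ring
      _ ≤ _ := by gcongr; linarith

end Standing

end ASADMM

theorem mainTheorem3
    {n₁ n₂ n N : ℕ} (Q : ASADMM.Problem n₁ n₂ n N)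
    {Ω : Type*} [mΩ : MeasurableSpace Ω] (P : Measure Ω) [IsProbabilityMeasure P]
    (𝓕 : Filtration (ℕ ×ₗ ℕ) mΩ) (R : ASADMM.Run n₁ n₂ n N Ω)
    (β s ν α c₁ c₂ σ θ : ℝ) (H : Matrix (Fin n₁) (Fin n₁) ℝ)
    (hβ : 0 < β) (hH : H.PosDef)
    (hrun : R.FollowsUpdates Q β s H) (hstoch : R.IsStochastic P 𝓕)
    -- standing assumptions: existence of a primal-dual solution, regularity of the components
    (hpd : Q.primalDual.Nonempty)
    (hν : 0 < ν) (hcomp : Q.ComponentRegular H ν)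
    -- strong convexity and Lipschitz continuous gradients
    (hα : 0 < α) (hf : ASADMM.StronglyConvexSmooth Q.f α ν)
    (hg : ASADMM.StronglyConvexSmooth Q.g α ν)
    -- stepsize, proximal matrices and stochastic gradient errors
    (hs₀ : 0 < s) (hs₁ : s < (1 + Real.sqrt 5) / 2)
    (hc₁ : 0 < c₁) (hc₂ : 0 < c₂) (hD : R.ProximalBounds Q β c₁ c₂)
    (hσ : 0 < σ) (hnoise : R.NoiseBound Q P H σ)
    -- growth of the inner iteration counts
    (hθ : 0 < θ) (hM : R.GeometricGrowth θ)
    -- the solution, and the projections of the dual iterates onto its multiplier set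
    (xs : ASADMM.Vec n₁) (ys : ASADMM.Vec n₂) (hsol : Q.IsSolution xs ys)
    (lbar : ℕ → Ω → ASADMM.Vec n)
    (hlbar : ∀ k ω, ASADMM.IsProjection (Q.multipliers xs ys) (R.lam k ω) (lbar k ω)) :
    ∃ c τ : ℝ, 0 < c ∧ 0 < τ ∧ τ < 1 ∧ ∀ k : ℕ,
      Integrable (fun ω => ‖R.x k ω - xs‖ ^ 2 + ‖R.y k ω - ys‖ ^ 2
        + ‖R.lam k ω - lbar k ω‖ ^ 2) P ∧
      ∫ ω, (‖R.x k ω - xs‖ ^ 2 + ‖R.y k ω - ys‖ ^ 2 + ‖R.lam k ω - lbar k ω‖ ^ 2) ∂P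
        ≤ c * τ ^ k := by
  -- Equivalent to `s ^ 2 - s - 1 < 0`, whose positive root is the golden ratio.
  have hgolden : (1 - s) ^ 2 < 2 - s := by
    have h5 : Real.sqrt 5 ^ 2 = 5 := Real.sq_sqrt (by norm_num)
    have h1 : 1 < Real.sqrt 5 := by
      rw [Real.lt_sqrt (by norm_num)]; norm_num
    nlinarith
  have S : ASADMM.Standing Q R β s ν α c₁ c₂ H xs ys lbar :=
    ⟨hβ, hs₀, hgolden, hν, hα, hc₁, hc₂, hH, hrun, hf, hg, hD, hlbar⟩
  exact S.exists_linear_rate hstoch hcomp.differentiable hnoise hθ hM
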